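/- Let $F$ be a finite extension of $\mathbb{Q}_p$ ($p$ any prime) with ring of integers $\mathfrak{o}$, prime ideal $\mathfrak{p}$, residue field of order $q$, order function $\mathrm{ord}$, different $\mathfrak{d}$ over $\mathbb{Q}_p$, and $|x|=q^{-\mathrm{ord}(x)}$; let $e=\mathrm{ord}(2)$. Let $\psi$ be an additive character of $F$ whose order $c_\psi$ (the largest integer $c\ge 0$ with $\psi(\mathfrak{p}^{-c})=1$) is $\mathrm{ord}(\mathfrak{d})$, let $\boldsymbol\delta\in F$ have order $c_\psi$, and let $dx$ be the Haar measure on $F$ with $\mathrm{Vol}(\mathfrak{o})=1$. For a Schwartz function $\phi$ (locally constant, compactly supported) on $F$ put $\hat\phi(x)=|\boldsymbol\delta|^{1/2}\int_F\phi(y)\psi(xy)\,dy$, and let $\alpha_\psi(a)$ ($a\in F^\times$) be the Weil constant, defined by $\int\phi(x)\psi(ax^2)dx=\alpha_\psi(a)|2a|^{-1/2}\int\hat\phi(x)\psi(-x^2/4a)dx$ for all such $\phi$. Let $\widetilde{SL_2(F)}=\{[g,\zeta]: g\in SL_2(F),\ \zeta=\pm1\}$ with $[g_1,\zeta_1][g_2,\zeta_2]=[g_1g_2,\zeta_1\zeta_2\mathbf{c}(g_1,g_2)]$,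 where $\mathbf{c}(g_1,g_2)=\langle\frac{\tau(g_1)}{\tau(g_1g_2)},\frac{\tau(g_2)}{\tau(g_1g_2)}\rangle$, $\langle\,,\rangle$ is the Hilbert symbol, and $\tau\begin{pmatrix}a&b\\c&d\end{pmatrix}$ is $c$ if $c\ne0$ and $d$ if $c=0$. A function $f$ on $\widetilde{SL_2(F)}$ is genuine if $f([1,\zeta]g)=\zeta f(g)$; write $[g]=[g,1]$, and $\widetilde S$ for the inverse image of $S\subset SL_2(F)$. Put $\mathbf{u}^\sharp(b)=\left[\begin{pmatrix}1&b\\0&1\end{pmatrix}\right]$, $\mathbf{m}(a)=\left[\begin{pmatrix}a&0\\0&a^{-1}\end{pmatrix}\right]$, $\mathbf{w}_a=\left[\begin{pmatrix}0&-a^{-1}\\a&0\end{pmatrix}\right]$. The Weil representation $\omega_\psi$ of $\widetilde{SL_2(F)}$ on Schwartz functions is the genuine representation with $\omega_\psi(\mathbf{m}(a))\phi(t)=\frac{\alpha_\psi(1)}{\alpha_\psi(a)}|a|^{1/2}\phi(at)$, $\omega_\psi(\mathbf{u}^\sharp(b))\phi(t)=\psi(bt^2)\phi(t)$, $\omega_\psi(\mathbf{w}_a)\phi(t)=\overline{\alpha_\psi(a)}\,|2a^{-1}|^{1/2}\hat\phi(-2a^{-1}t)$.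 Let $\Gamma[\mathfrak{a},\mathfrak{b}]$ be the set of $\begin{pmatrix}a&b\\c&d\end{pmatrix}\in SL_2(F)$ with $a,d\in\mathfrak{o}$, $b\in\mathfrak{a}$, $c\in\mathfrak{b}$; put $\Lambda=\Gamma[\mathfrak{d}^{-1},\mathfrak{d}]$ and $\Gamma=\Gamma[\mathfrak{d}^{-1},4\mathfrak{d}]$. Let $\phi_0$ be the characteristic function of $\mathfrak{o}$ and $(\phi_1,\phi_2)=\int_F\phi_1\overline{\phi_2}\,dt$. Define $e^K(g)=q^e(\phi_0,\omega_\psi(g)\phi_0)$ for $g\in\widetilde\Lambda$, $e^K(g)=0$ for $g\notin\widetilde\Lambda$, and $E^K(g)=e^K(\mathbf{w}_{2\boldsymbol\delta}^{-1}\,g\,\mathbf{w}_{2\boldsymbol\delta})$. Let $s\in\mathbb{C}$ with $q^{-2s}\neq q^{\pm1}$, and let $\tilde I_\psi(s)$ be the space of genuine smooth (right invariant under an open subgroup) functions $f$ on $\widetilde{SL_2(F)}$ with $f(\mathbf{u}^\sharp(b)\mathbf{m}(a)g)=\frac{\alpha_\psi(1)}{\alpha_\psi(a)}|a|^{s+1}f(g)$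 for $b\in F$, $a\in F^\times$. For genuine $\phi$ let $\rho(\phi)f(g)=\int_{\widetilde{SL_2(F)}/\{\pm1\}}\phi(h)f(gh)\,dh$, where $dh$ is the Haar measure on $\widetilde{SL_2(F)}/\{\pm1\}=SL_2(F)$ giving $\Lambda$ volume $1$. For $0\le r<e$ let $\mathcal{X}_r$ be the set of $\begin{pmatrix}a&b\\c&d\end{pmatrix}\in\Lambda$ with $c\ne0$ and $\mathrm{ord}(c/\boldsymbol\delta)=2r$, and let $\mathcal{X}_e=\Gamma$. For $0\le r\le e$ let $f_r\in\tilde I_\psi(s)$ be the function whose restriction to $\widetilde\Lambda$ equals $q^{c_\psi s-e/2}\alpha_\psi(1)\overline{e^K}$ on $\widetilde{\mathcal{X}_r}$ and $0$ on $\widetilde\Lambda\setminus\widetilde{\mathcal{X}_r}$. Put $$f_K^{[0]}=\sum_{r=0}^e f_r,\qquad f_K^+=\sum_{r=0}^e q^{2sr-e+r}f_r.$$ Theorem. One has $$\{f\in\tilde I_\psi(s):\rho(e^K)f=f\}=\mathbb{C}\cdot f_K^{[0]},\qquad \{f\in\tilde I_\psi(s):\rho(E^K)f=f\}=\mathbb{C}\cdot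 f_K^+,$$ and $f_K^{[0]}\neq 0$, $f_K^+\neq 0$, so that both spaces are lines. -/

import Mathlib

noncomputable section

open MeasureTheory Topology
open scoped ComplexConjugate

namespace MetaplecticSL2

/-! ### `SL₂`, the Hilbert symbol and the metaplectic double cover -/

/-- The group `SL₂(F)`. -/
abbrev SL2 (F : Type*) [Field F] : Type _ := Matrix.SpecialLinearGroup (Fin 2) F

section Cover

variable {F : Type*} [Field F]

/-- The unipotent matrix `(1, b; 0, 1)`. -/
def upperMat (b : F) : SL2 F := ⟨!![1, b; 0, 1], by simp⟩

/-- The diagonal matrix `(a, 0; 0, a⁻¹)`. -/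
def diagMat (a : Fˣ) : SL2 F := ⟨!![(a : F), 0; 0, (a : F)⁻¹], by simp⟩

/-- The matrix `(0, -a⁻¹; a, 0)`. -/
def weylMat (a : Fˣ) : SL2 F := ⟨!![0, -(a : F)⁻¹; (a : F), 0], by simp⟩

open Classical in
/-- The Hilbert symbol of `F`: it is `1` if `z² = a x² + b y²` has a nonzero solution
and `-1` otherwise. -/
def hilbertSymbol (a b : F) : ℤˣ :=
  if ∃ x y z : F, (x, y, z) ≠ (0, 0, 0) ∧ z ^ 2 = a * x ^ 2 + b * y ^ 2 then 1 else -1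

open Classical in
/-- `τ(a, b; c, d)` is `c` if `c ≠ 0` and `d` if `c = 0`. -/
def tau (g : SL2 F) : F := if g 1 0 ≠ 0 then g 1 0 else g 1 1

/-- Kubota's 2-cocycle. -/
def kubota (g₁ g₂ : SL2 F) : ℤˣ :=
  hilbertSymbol (tau g₁ / tau (g₁ * g₂)) (tau g₂ / tau (g₁ * g₂))

variable (F) in
/-- The underlying set of the metaplectic double cover: pairs `[g, ζ]` with `g ∈ SL₂(F)`
and `ζ ∈ {±1}`. -/
@[ext] structure Mp where
  /-- the image in `SL₂(F)` -/
  mat : SL2 F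
  /-- the sign -/
  sign : ℤˣ

/-- `[g₁, ζ₁] [g₂, ζ₂] = [g₁ g₂, ζ₁ ζ₂ c(g₁, g₂)]`. -/
instance : Mul (Mp F) :=
  ⟨fun x y => ⟨x.mat * y.mat, x.sign * y.sign * kubota x.mat y.mat⟩⟩

/-- The inverse for the above multiplication: `[g, ζ]⁻¹ = [g⁻¹, ζ c(g, g⁻¹)]`. -/
instance : Inv (Mp F) :=
  ⟨fun x => ⟨x.mat⁻¹, x.sign * kubota x.mat x.mat⁻¹⟩⟩

/-- `[g] = [g, 1]`. -/
def lift (g : SL2 F) : Mp F := ⟨g, 1⟩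

/-- `u♯(b)`. -/
def uSharp (b : F) : Mp F := lift (upperMat b)

/-- `m(a)`. -/
def mDiag (a : Fˣ) : Mp F := lift (diagMat a)

/-- `w_a`. -/
def wEl (a : Fˣ) : Mp F := lift (weylMat a)

/-- A function on the cover is genuine if `f([1, ζ] g) = ζ f(g)`. -/
def IsGenuine (f : Mp F → ℂ) : Prop :=
  ∀ (g : Mp F) (ζ : ℤˣ), f (⟨1, ζ⟩ * g) = ((ζ : ℤ) : ℂ) * f g

end Cover

/-- `SL₂(F)` carries its Borel `σ`-algebra. -/
instance instMeasurableSpaceSL2 (F : Type*) [Field F] [TopologicalSpace F] :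
    MeasurableSpace (SL2 F) := borel _

instance instBorelSpaceSL2 (F : Type*) [Field F] [TopologicalSpace F] :
    BorelSpace (SL2 F) := ⟨rfl⟩

/-! ### Non-archimedean local fields of characteristic zero

`F` is a finite extension of `ℚ_p` with the norm extending the one of `ℚ_p`; its ring of
integers `𝔬` is the closed unit ball. -/

section LocalField

/-- The order `q` of the residue field `𝔬 / 𝔭`. -/
def resCard (F : Type*) [NormedField F] [IsUltrametricDist F] : ℕ :=
  Nat.card (IsLocalRing.ResidueField (NormedField.valuation (K := F)).valuationSubring)

variable (p : ℕ) [Fact p.Prime] {F : Type*} [NormedField F] [NormedAlgebra ℚ_[p] F]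

/-- The normalized absolute value, `|x| = q ^ (-ord x)`. -/
def nabs (x : F) : ℝ := ‖x‖ ^ Module.finrank ℚ_[p] F

/-- For `x ≠ 0`, the order of `x`, that is, the integer `n` with `|x| = q ^ (-n)`. -/
def ordF [IsUltrametricDist F] (x : F) : ℤ := -Int.log (resCard F) (nabs p x)

variable (F) in
/-- The inverse different `𝔡⁻¹ = {x | Tr(x 𝔬) ⊆ ℤ_p}` of `F` over `ℚ_p`. -/
def inverseDifferent : Set F :=
  {x | ∀ y : F, ‖y‖ ≤ 1 → ‖Algebra.trace ℚ_[p] F (x * y)‖ ≤ 1}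

/-- For `x y ∈ F`, the set `Γ[x𝔬, y𝔬]` of the matrices `(a, b; c, d)` in `SL₂(F)` with
`a, d ∈ 𝔬`, `b ∈ x𝔬` and `c ∈ y𝔬`. -/
def GammaSet (x y : F) : Set (SL2 F) :=
  {g | ‖g 0 0‖ ≤ 1 ∧ ‖g 1 1‖ ≤ 1 ∧ ‖g 0 1‖ ≤ ‖x‖ ∧ ‖g 1 0‖ ≤ ‖y‖}

variable (F) in
/-- The closed unit ball `𝔬` as a compact set with nonempty interior. -/
def integersCompact [FiniteDimensional ℚ_[p] F] : TopologicalSpace.PositiveCompacts F where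
  carrier := Metric.closedBall 0 1
  isCompact' := by
    have := FiniteDimensional.proper ℚ_[p] F
    exact isCompact_closedBall 0 1
  interior_nonempty' :=
    ⟨0, Metric.ball_subset_interior_closedBall (Metric.mem_ball_self one_pos)⟩

variable (F) in
/-- The Haar measure `dx` on `F` with `Vol(𝔬) = 1`. -/
def dF [FiniteDimensional ℚ_[p] F] [MeasurableSpace F] [BorelSpace F] : Measure F :=
  Measure.addHaarMeasure (integersCompact p F)

theorem isCompact_GammaSet (p : ℕ) [Fact p.Prime] {F : Type*} [NormedField F]
    [NormedAlgebra ℚ_[p] F] [FiniteDimensional ℚ_[p] F] (x y : F) :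
    IsCompact (GammaSet x y) := by
  have := FiniteDimensional.proper ℚ_[p] F
  let r : Fin 2 → Fin 2 → ℝ := ![![1, ‖x‖], ![‖y‖, 1]]
  have hK : IsCompact (Set.univ.pi fun i : Fin 2 => Set.univ.pi fun j : Fin 2 =>
      Metric.closedBall (0 : F) (r i j)) :=
    isCompact_univ_pi fun i => isCompact_univ_pi fun j => isCompact_closedBall _ _
  have h := (Matrix.SpecialLinearGroup.isClosedEmbedding_val
    (n := Fin 2) (R := F)).isCompact_preimage hK
  suffices heq : GammaSet x y = _ by rw [heq]; exact h
  ext g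
  change (‖g 0 0‖ ≤ 1 ∧ ‖g 1 1‖ ≤ 1 ∧ ‖g 0 1‖ ≤ ‖x‖ ∧ ‖g 1 0‖ ≤ ‖y‖) ↔
    ∀ i ∈ Set.univ, ∀ j ∈ Set.univ, g i j ∈ Metric.closedBall (0 : F) (r i j)
  simp [Fin.forall_fin_two, r]
  tauto

theorem interior_GammaSet_nonempty {F : Type*} [NormedField F] [IsUltrametricDist F]
    {x y : F} (hx : x ≠ 0) (hy : y ≠ 0) : (interior (GammaSet x y)).Nonempty := by
  have ho : IsOpen (GammaSet x y) := by
    have hent : ∀ i j : Fin 2, Continuous fun g : SL2 F => g i j := fun i j =>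
      (continuous_apply j).comp (Matrix.SpecialLinearGroup.continuous_apply _ continuous_id i)
    have hb : ∀ (i j : Fin 2) (r : ℝ), r ≠ 0 → IsOpen {g : SL2 F | ‖g i j‖ ≤ r} := by
      intro i j r hr
      have h := (IsUltrametricDist.isOpen_closedBall (0 : F) hr).preimage (hent i j)
      convert h using 1
      ext g
      simp
    exact (hb 0 0 1 one_ne_zero).inter ((hb 1 1 1 one_ne_zero).inter
      ((hb 0 1 _ (norm_ne_zero_iff.mpr hx)).inter (hb 1 0 _ (norm_ne_zero_iff.mpr hy))))
  refine ⟨1, ?_⟩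
  rw [ho.interior_eq]
  simp [GammaSet]

/-- Over an extension of `ℚ_p` the element `2 x` is nonzero for `x ≠ 0`. -/
theorem two_mul_ne_zero' (p : ℕ) [Fact p.Prime] {F : Type*} [NormedField F]
    [NormedAlgebra ℚ_[p] F] {x : F} (hx : x ≠ 0) : 2 * x ≠ 0 := by
  have : CharZero F := charZero_of_injective_algebraMap (algebraMap ℚ_[p] F).injective
  exact mul_ne_zero two_ne_zero hx

end LocalField

/-- The local data: `F` is a finite extension of `ℚ_p`, `ψ : F → ℂˣ` is an additive character
whose order (the largest `c ≥ 0` with `ψ(𝔭^(-c)) = 1`) equals the order of the different `𝔡`,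
and `δ` is an element of `F` of that order, so that `𝔡 = δ𝔬`. -/
structure LocalDatum (p : ℕ) [Fact p.Prime] (F : Type*) [NormedField F]
    [NormedAlgebra ℚ_[p] F] [IsUltrametricDist F] where
  /-- the additive character -/
  ψ : AddChar F ℂ
  /-- a generator of the different -/
  δ : F
  δ_ne_zero : δ ≠ 0
  δ_generates : ∀ x : F, x ∈ inverseDifferent p F ↔ ‖δ * x‖ ≤ 1
  order_ψ : IsGreatest {c : ℕ | ∀ x : F, nabs p x ≤ (resCard F : ℝ) ^ c → ψ x = 1}
    (ordF p δ).toNat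

namespace LocalDatum

variable {p : ℕ} [Fact p.Prime] {F : Type*} [NormedField F] [NormedAlgebra ℚ_[p] F]
  [IsUltrametricDist F] (D : LocalDatum p F)

/-- The order `e` of `2` in `F`. -/
def e (_ : LocalDatum p F) : ℕ := (ordF p (2 : F)).toNat

/-- The order `c_ψ` of `ψ`. -/
def cψ : ℕ := (ordF p D.δ).toNat

/-- The cardinality `q` of the residue field, as a complex number. -/
def q (_ : LocalDatum p F) : ℂ := (resCard F : ℂ)

/-- `Γ = Γ[𝔡⁻¹, 4𝔡]`. -/
def Gam : Set (SL2 F) := GammaSet D.δ⁻¹ (4 * D.δ)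

/-- `Λ = Γ[𝔡⁻¹, 𝔡]`. -/
def Lam : Set (SL2 F) := GammaSet D.δ⁻¹ D.δ

/-- `2δ` as a unit of `F`. -/
def twoδ : Fˣ := Units.mk0 (2 * D.δ) (two_mul_ne_zero' p D.δ_ne_zero)

variable [FiniteDimensional ℚ_[p] F]

/-- `Λ` as a compact set with nonempty interior. -/
def LamCompact : TopologicalSpace.PositiveCompacts (SL2 F) where
  carrier := D.Lam
  isCompact' := isCompact_GammaSet p _ _
  interior_nonempty' := interior_GammaSet_nonempty (inv_ne_zero D.δ_ne_zero) D.δ_ne_zero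

/-- The Haar measure on `SL₂(F)`, the quotient of the cover by `{±1}`, for which `Λ` has
volume `1`. -/
def dG : Measure (SL2 F) := Measure.haarMeasure D.LamCompact

variable [MeasurableSpace F] [BorelSpace F]

/-! ### The Weil constant and the Weil representation -/

/-- Schwartz functions on `F`: locally constant and compactly supported. -/
def IsSchwartz (φ : F → ℂ) : Prop := IsLocallyConstant φ ∧ HasCompactSupport φ

/-- The Fourier transform `φ̂(x) = |δ|^{1/2} ∫ φ(y) ψ(xy) dy`. -/
def fourier (φ : F → ℂ) (x : F) : ℂ :=
  ((nabs p D.δ ^ (1 / 2 : ℝ) : ℝ) : ℂ) * ∫ y, φ y * D.ψ (x * y) ∂(dF p F)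

/-- The Weil constant `α_ψ(a)` for `a ≠ 0`: the number `α` such that
`∫ φ(x) ψ(a x²) dx = α |2a|^{-1/2} ∫ φ̂(x) ψ(-x² / 4a) dx` for all Schwartz functions `φ`. -/
def weilConst (a : F) : ℂ :=
  Classical.epsilon fun α : ℂ => ∀ φ : F → ℂ, IsSchwartz φ →
    ∫ x, φ x * D.ψ (a * x ^ 2) ∂(dF p F) =
      α * ((nabs p (2 * a) ^ (-(1 / 2) : ℝ) : ℝ) : ℂ) *
        ∫ x, D.fourier φ x * D.ψ (-(x ^ 2 / (4 * a))) ∂(dF p F)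

/-- The operator `ω_ψ(u♯(b))`. -/
def opU (b : F) (φ : F → ℂ) : F → ℂ := fun t => D.ψ (b * t ^ 2) * φ t

/-- The operator `ω_ψ(m(a))`. -/
def opM (a : F) (φ : F → ℂ) : F → ℂ := fun t =>
  D.weilConst 1 / D.weilConst a * ((nabs p a ^ (1 / 2 : ℝ) : ℝ) : ℂ) * φ (a * t)

/-- The operator `ω_ψ(w_a)`. -/
def opW (a : F) (φ : F → ℂ) : F → ℂ := fun t =>
  conj (D.weilConst a) * ((nabs p (2 * a⁻¹) ^ (1 / 2 : ℝ) : ℝ) : ℂ) *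
    D.fourier φ (-(2 * a⁻¹ * t))

open Classical in
/-- The Weil representation `ω_ψ` of the metaplectic group. For `g = (a, b; c, d)` one has
`[g] = u♯(ab) m(a)` if `c = 0` and `[g] = u♯(a/c) w_c u♯(d/c)` if `c ≠ 0`, and `ω_ψ` is genuine,
so the operators of the elements `u♯(b)`, `m(a)`, `w_a` determine all others. -/
def weil (g : Mp F) (φ : F → ℂ) : F → ℂ := fun t =>
  ((g.sign : ℤ) : ℂ) *
    (if g.mat 1 0 = 0 then D.opU (g.mat 0 0 * g.mat 0 1) (D.opM (g.mat 0 0) φ)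
      else D.opU (g.mat 0 0 / g.mat 1 0) (D.opW (g.mat 1 0)
        (D.opU (g.mat 1 1 / g.mat 1 0) φ))) t

/-- The inner product `(φ₁, φ₂) = ∫ φ₁ conj(φ₂)`. -/
def innerF (_ : LocalDatum p F) (φ₁ φ₂ : F → ℂ) : ℂ := ∫ t, φ₁ t * conj (φ₂ t) ∂(dF p F)

open Classical in
/-- `φ₀`, the characteristic function of `𝔬`. -/
def φ₀ (_ : LocalDatum p F) : F → ℂ := fun t => if ‖t‖ ≤ 1 then 1 else 0

/-! ### The functions `e^K`, `E^K` -/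

open Classical in
/-- The genuine function `e^K`: `q^e (φ₀, ω_ψ(g) φ₀)` on the inverse image of `Λ`, zero
elsewhere. -/
def eK (g : Mp F) : ℂ :=
  if g.mat ∈ D.Lam then D.q ^ D.e * D.innerF D.φ₀ (D.weil g D.φ₀) else 0

/-- `E^K(g) = e^K(w_{2δ}⁻¹ g w_{2δ})`. -/
def EK (g : Mp F) : ℂ := D.eK ((wEl D.twoδ)⁻¹ * g * wEl D.twoδ)

/-! ### The induced representation -/

/-- The genuine induced representation space: genuine functions `f` on the cover with
`f(u♯(b) m(a) g) = (α_ψ(1) / α_ψ(a)) |a|^{s+1} f(g)` that are smooth, that is, invariant under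
right translation by the (lift of the) matrices close to `1`. (Close to `1`, `k ↦ [k]` is a
continuous homomorphism onto an open subgroup of the cover.) -/
def indRep (s : ℂ) : Submodule ℂ (Mp F → ℂ) where
  carrier := {f | IsGenuine f ∧
    (∀ (b : F) (a : Fˣ) (g : Mp F), f (uSharp b * mDiag a * g) =
      D.weilConst 1 / D.weilConst (a : F) * ((nabs p (a : F) : ℝ) : ℂ) ^ (s + 1) * f g) ∧
    ∃ U ∈ 𝓝 (1 : SL2 F), ∀ k ∈ U, ∀ g : Mp F, f (g * lift k) = f g}
  zero_mem' := ⟨fun _ _ => by simp, fun _ _ _ => by simp, Set.univ, Filter.univ_mem,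
    fun _ _ _ => rfl⟩
  add_mem' := by
    rintro f₁ f₂ ⟨h₁, i₁, U₁, hU₁, k₁⟩ ⟨h₂, i₂, U₂, hU₂, k₂⟩
    refine ⟨fun g ζ => ?_, fun b a g => ?_, U₁ ∩ U₂, Filter.inter_mem hU₁ hU₂,
      fun k hk g => ?_⟩
    · simp only [Pi.add_apply, h₁ g ζ, h₂ g ζ, mul_add]
    · simp only [Pi.add_apply, i₁ b a g, i₂ b a g, mul_add]
    · simp only [Pi.add_apply, k₁ k hk.1 g, k₂ k hk.2 g]
  smul_mem' := by
    rintro c f ⟨h, i, U, hU, k'⟩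
    refine ⟨fun g ζ => ?_, fun b a g => ?_, U, hU, fun k hk g => ?_⟩
    · simp only [Pi.smul_apply, smul_eq_mul, h g ζ, mul_left_comm]
    · simp only [Pi.smul_apply, smul_eq_mul, i b a g, mul_left_comm]
    · simp only [Pi.smul_apply, k' k hk g]

/-- The action by right translation, `ρ(φ) f(g) = ∫ φ(h) f(g h) dh`; for genuine `φ`, `f` the
integrand is a function on the quotient `SL₂(F)` of the cover. -/
def rho (φ f : Mp F → ℂ) : Mp F → ℂ := fun g =>
  ∫ h : SL2 F, φ (lift h) * f (g * lift h) ∂D.dG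

/-- `{f | f ∈ Ĩ_ψ(s), ρ(φ) f = f}`. -/
def fixedBy (s : ℂ) (φ : Mp F → ℂ) : Set (Mp F → ℂ) :=
  {f | f ∈ D.indRep s ∧ D.rho φ f = f}

/-! ### The functions `f_K^{[0]}` and `f_K^+` -/

/-- The sets `𝒳_r`, `0 ≤ r ≤ e`: for `r < e` the matrices `(a, b/δ; cδ, d)` in `Λ` with
`ord(c) = 2r`, and `𝒳_e = Γ`. -/
def X (r : ℕ) : Set (SL2 F) :=
  if r < D.e then {g | g ∈ D.Lam ∧ g 1 0 ≠ 0 ∧ ordF p (g 1 0 / D.δ) = 2 * (r : ℤ)} else D.Gam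

open Classical in
/-- `f_r`: the element of the induced representation whose restriction to the inverse image
of `Λ` is `q^{c_ψ s - e/2} α_ψ(1) conj(e^K)` on the inverse image of `𝒳_r` and `0` elsewhere. -/
def fr (s : ℂ) (r : ℕ) : Mp F → ℂ :=
  Classical.epsilon fun f : Mp F → ℂ => f ∈ D.indRep s ∧
    ∀ g : Mp F, g.mat ∈ D.Lam → f g =
      if g.mat ∈ D.X r then
        D.q ^ ((D.cψ : ℂ) * s - (D.e : ℂ) / 2) * D.weilConst 1 * conj (D.eK g)
      else 0

/-- `f_K^+ = ∑_{r=0}^e q^{2sr-e+r} f_r`. -/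
def fPlus (s : ℂ) : Mp F → ℂ :=
  ∑ r ∈ Finset.range (D.e + 1),
    D.q ^ (2 * s * (r : ℂ) - (D.e : ℂ) + (r : ℂ)) • D.fr s r

/-- `f_K^{[0]} = ∑_{r=0}^e f_r`. -/
def fZero (s : ℂ) : Mp F → ℂ := ∑ r ∈ Finset.range (D.e + 1), D.fr s r

end LocalDatum

end MetaplecticSL2

end

/-!
The argument runs through the Weil representation `ω_ψ` and the function `φ₀`.

**The Weil representation.** Fourier inversion and completion of the square identify the Weil
constant with a stable Gauss integral (`weilConst_eq_gauss`). The identity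
`α(c) α(cab) = ⟨a, b⟩ α(ca) α(cb)` (`weilConst_mul_weilConst`) says that the product of the Weil
constants of a multiple of the quaternion norm form `x² - a y² - b z² + a b w²` is the Hilbert
symbol. If the form is isotropic, `b` is a value of `u² - a v²` and a change of variables cancels
the factors. If it is anisotropic, it represents every element of `F`, because quadratic forms in
five variables are isotropic (`exists_diagForm_eq_zero`); so units and uniformizers act by
similitudes, and the Gauss integral over the large compact sets `‖N v‖ ≤ ρ` can be computed: it is
negative. With this identity `ω_ψ` is multiplicative (`weil_lift_mul`, `weil_mul`). As it separates
the two points over a matrix, the multiplication of the cover is associative (`mp_mul_assoc`).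

**The line fixed by `ρ(e^K)`.** The inverse image of `Λ` preserves the functions on `½𝔬 / 𝔬`, so on
it `e^K` is `q^e` times the conjugate of the coefficient `g ↦ (ω_ψ(g) φ₀)(0)` (`eK_eq`). By unitarity
`e^K(k⁻¹ h)` is an integral over `t ∈ ½𝔬` of products of the coefficients at `t`. An element `f` of
the induced representation is invariant under the unipotent elements `u(b)`, which act on the
coefficient at `t` by `ψ(b t²)`; hence only `t ∈ 𝔬` contributes and `ρ(e^K) f` is a multiple of the
coefficient at `0` on the inverse image of `Λ` (`rho_eK_lift`). By the Iwasawa decomposition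
`ρ(e^K)` has rank one, with image spanned by `sph g = H(g)^{s + 1/2} (ω_ψ(g) φ₀)(0)`, `H` the height
(`rho_eK`). The same orthogonality, after a translation by a Weyl element, gives the coefficient at
`0` square norm `|2| = q^{-e}` over `Λ` (`pairing_coeff_zero`), so `sph` is fixed (`rho_eK_sph`).

**The functions `f_K^{[0]}` and `f_K^+`.** The sets `𝒳_r` are level sets on `Λ` of a function `depth`
that is left invariant under the upper triangular matrices, so `f_r` exists and is a multiple of
`sph` on its support. Off the `𝒳_r` the coefficient at `0` is a quadratic Gauss sum at an odd level,
which vanishes (`coeff_zero_eq_zero_of_depth`); thus `f_K^{[0]}` is a multiple of `sph`. Right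
translation by `w_{2δ}`, of which `φ₀` is an eigenvector, carries `ρ(E^K)` to `ρ(e^K)` (`rho_EK`), so
the second space is spanned by `g ↦ sph (g w_{2δ})`. On `Λ` one has `H(k w_{2δ}) = |2| / depth k`
(`height_mul_weylMat`), which turns this function into a multiple of `f_K^+` (`fPlus_eq`).
-/

noncomputable section
set_option linter.unusedSectionVars false

open MeasureTheory Topology
open scoped ComplexConjugate Pointwise

namespace MetaplecticSL2

/-! ### Ultrametric norms and the residue field -/

section LocalField

section Residue

variable {F : Type*} [NormedField F] [IsUltrametricDist F]

theorem norm_add_le_of_le' {G : Type*} [SeminormedAddCommGroup G] [IsUltrametricDist G] {x y : G}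
    {r : ℝ} (hx : ‖x‖ ≤ r) (hy : ‖y‖ ≤ r) : ‖x + y‖ ≤ r :=
  (IsUltrametricDist.norm_add_le_max x y).trans (max_le hx hy)

theorem norm_add_lt_of_lt' {G : Type*} [SeminormedAddCommGroup G] [IsUltrametricDist G] {x y : G}
    {r : ℝ} (hx : ‖x‖ < r) (hy : ‖y‖ < r) : ‖x + y‖ < r :=
  (IsUltrametricDist.norm_add_le_max x y).trans_lt (max_lt hx hy)

theorem norm_sub_le_of_le' {G : Type*} [SeminormedAddCommGroup G] [IsUltrametricDist G] {x y : G}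
    {r : ℝ} (hx : ‖x‖ ≤ r) (hy : ‖y‖ ≤ r) : ‖x - y‖ ≤ r := by
  rw [sub_eq_add_neg]
  exact norm_add_le_of_le' hx (by rwa [norm_neg])

theorem norm_sub_lt_of_lt' {G : Type*} [SeminormedAddCommGroup G] [IsUltrametricDist G] {x y : G}
    {r : ℝ} (hx : ‖x‖ < r) (hy : ‖y‖ < r) : ‖x - y‖ < r := by
  rw [sub_eq_add_neg]
  exact norm_add_lt_of_lt' hx (by rwa [norm_neg])

theorem norm_add_eq_left {G : Type*} [SeminormedAddCommGroup G] [IsUltrametricDist G] {x y : G}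
    (h : ‖y‖ < ‖x‖) : ‖x + y‖ = ‖x‖ := by
  rw [IsUltrametricDist.norm_add_eq_max_of_norm_ne_norm h.ne', max_eq_left h.le]

/-- The ring of integers of `F`, as the valuation ring of the norm. -/
abbrev integerRing (F : Type*) [NormedField F] [IsUltrametricDist F] : ValuationSubring F :=
  (NormedField.valuation (K := F)).valuationSubring

theorem mem_integerRing {x : F} : x ∈ integerRing F ↔ ‖x‖ ≤ 1 := by
  rw [Valuation.mem_valuationSubring_iff, NormedField.valuation_apply, ← NNReal.coe_le_coe]
  rfl

theorem isUnit_integerRing {x : integerRing F} : IsUnit x ↔ ‖(x : F)‖ = 1 := by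
  constructor
  · rintro ⟨u, rfl⟩
    have h1 := mem_integerRing.1 (u : integerRing F).2
    have h2 := mem_integerRing.1 ((u⁻¹ : (integerRing F)ˣ) : integerRing F).2
    have h3 : ((u : integerRing F) : F) * ((u⁻¹ : (integerRing F)ˣ) : integerRing F) = 1 :=
      congrArg Subtype.val u.mul_inv
    have h4 := congrArg norm h3
    rw [norm_mul, norm_one] at h4
    nlinarith [norm_nonneg ((u : integerRing F) : F),
      norm_nonneg (((u⁻¹ : (integerRing F)ˣ) : integerRing F) : F)]
  · intro h
    have hx : (x : F) ≠ 0 := by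
      intro h0; rw [h0, norm_zero] at h; exact zero_ne_one h
    refine IsUnit.of_mul_eq_one ⟨(x : F)⁻¹, mem_integerRing.2 (by rw [norm_inv, h, inv_one])⟩ ?_
    ext
    simp [hx]

theorem residue_eq_zero_iff_norm {x : integerRing F} :
    IsLocalRing.residue (integerRing F) x = 0 ↔ ‖(x : F)‖ < 1 := by
  rw [IsLocalRing.residue_eq_zero_iff, IsLocalRing.mem_maximalIdeal, mem_nonunits_iff,
    isUnit_integerRing]
  have := mem_integerRing.1 x.2
  exact ⟨fun h => lt_of_le_of_ne this h, fun h => h.ne⟩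

theorem residue_eq_iff_norm {x y : integerRing F} :
    IsLocalRing.residue (integerRing F) x = IsLocalRing.residue (integerRing F) y ↔
      ‖(x : F) - y‖ < 1 := by
  rw [← sub_eq_zero, ← map_sub, residue_eq_zero_iff_norm]
  rfl

/-- A chosen lift of a residue class. -/
def residueRep (y : IsLocalRing.ResidueField (integerRing F)) : integerRing F :=
  (IsLocalRing.residue_surjective y).choose

theorem residue_residueRep (y : IsLocalRing.ResidueField (integerRing F)) :
    IsLocalRing.residue _ (residueRep y) = y :=
  (IsLocalRing.residue_surjective y).choose_spec

theorem norm_residueRep_le (y : IsLocalRing.ResidueField (integerRing F)) :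
    ‖(residueRep y : F)‖ ≤ 1 := mem_integerRing.1 (residueRep y).2

theorem exists_residueRep {x : F} (hx : ‖x‖ ≤ 1) :
    ∃ y : IsLocalRing.ResidueField (integerRing F), ‖x - residueRep y‖ < 1 :=
  ⟨IsLocalRing.residue _ ⟨x, mem_integerRing.2 hx⟩,
    (residue_eq_iff_norm (x := ⟨x, mem_integerRing.2 hx⟩)).1 (residue_residueRep _).symm⟩

theorem residueRep_inj {x : F} {y z : IsLocalRing.ResidueField (integerRing F)}
    (hy : ‖x - residueRep y‖ < 1) (hz : ‖x - residueRep z‖ < 1) : y = z := by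
  rw [← residue_residueRep y, ← residue_residueRep z, residue_eq_iff_norm]
  have : ((residueRep y : F) - residueRep z) = (x - residueRep z) - (x - residueRep y) := by ring
  rw [this]
  exact norm_sub_lt_of_lt' hz hy

variable (F) in
theorem finite_residueField [ProperSpace F] :
    Finite (IsLocalRing.ResidueField (integerRing F)) := by
  have hc : IsCompact (Metric.closedBall (0 : F) 1) := isCompact_closedBall 0 1
  obtain ⟨t, ht⟩ := hc.elim_finite_subcover
    (fun y : IsLocalRing.ResidueField (integerRing F) => Metric.ball (residueRep y : F) 1)
    (fun _ => Metric.isOpen_ball) (fun x hx => by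
      obtain ⟨y, hy⟩ := exists_residueRep (mem_closedBall_zero_iff.1 hx)
      exact Set.mem_iUnion.2 ⟨y, by rwa [Metric.mem_ball, dist_eq_norm]⟩)
  refine Set.finite_univ_iff.1 (t.finite_toSet.subset fun y _ => ?_)
  have := ht (mem_closedBall_zero_iff.2 (norm_residueRep_le y))
  simp only [Set.mem_iUnion, Metric.mem_ball, dist_eq_norm] at this
  obtain ⟨z, hz, h⟩ := this
  rw [residueRep_inj (x := (residueRep y : F)) (y := y) (z := z) (by simp) h]
  exact hz

variable (F) in
theorem one_lt_resCard [ProperSpace F] : 1 < resCard F := by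
  have := finite_residueField F
  exact Finite.one_lt_card

end Residue

section Uniformizer

theorem exists_uniformizer (p : ℕ) [Fact p.Prime] (F : Type*) [NormedField F]
    [NormedAlgebra ℚ_[p] F] [ProperSpace F] [IsUltrametricDist F] :
    ∃ ϖ : F, ϖ ≠ 0 ∧ ‖ϖ‖ < 1 ∧ ∀ x : F, ‖x‖ < 1 → ‖x‖ ≤ ‖ϖ‖ := by
  have hcl : IsClosed (Metric.ball (0 : F) 1) := IsUltrametricDist.isClosed_ball 0 1
  have hc : IsCompact (Metric.ball (0 : F) 1) :=
    (isCompact_closedBall (0 : F) 1).of_isClosed_subset hcl Metric.ball_subset_closedBall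
  obtain ⟨ϖ, h1, h2⟩ := hc.exists_isMaxOn ⟨0, Metric.mem_ball_self one_pos⟩
    continuous_norm.continuousOn
  have h3 : ∀ x : F, ‖x‖ < 1 → ‖x‖ ≤ ‖ϖ‖ := fun x hx => h2 (mem_ball_zero_iff.2 hx)
  refine ⟨ϖ, ?_, mem_ball_zero_iff.1 h1, h3⟩
  rintro rfl
  have h4 : ‖algebraMap ℚ_[p] F p‖ = (p : ℝ)⁻¹ := by
    rw [norm_algebraMap', Padic.norm_p]
  have hp : (1 : ℝ) < p := by exact_mod_cast (Fact.out : p.Prime).one_lt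
  have h5 := h3 (algebraMap ℚ_[p] F p) (by rw [h4]; exact inv_lt_one_of_one_lt₀ hp)
  rw [h4, norm_zero] at h5
  have : (0 : ℝ) < (p : ℝ)⁻¹ := by positivity
  linarith

end Uniformizer

theorem exists_norm_eq_zpow {F : Type*} [NormedField F] {ϖ : F} (h0 : ϖ ≠ 0) (h1 : ‖ϖ‖ < 1)
    (h2 : ∀ x : F, ‖x‖ < 1 → ‖x‖ ≤ ‖ϖ‖) {x : F} (hx : x ≠ 0) : ∃ n : ℤ, ‖x‖ = ‖ϖ‖ ^ n := by
  have hϖ : 0 < ‖ϖ‖ := norm_pos_iff.2 h0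
  obtain ⟨n, hn1, hn2⟩ := exists_mem_Ioc_zpow (norm_pos_iff.2 hx)
    (one_lt_inv_iff₀.2 ⟨hϖ, h1⟩)
  rw [inv_zpow'] at hn1 hn2
  refine ⟨-(n + 1), le_antisymm hn2 ?_⟩
  by_contra! hlt
  have h3 : ‖x * ϖ ^ (n + 1)‖ < 1 := by
    rw [norm_mul, norm_zpow]
    rw [zpow_neg] at hlt
    have : 0 < ‖ϖ‖ ^ (n + 1) := by positivity
    rwa [lt_inv_comm₀ (norm_pos_iff.2 hx) this, ← one_div, lt_div_iff₀' (norm_pos_iff.2 hx)] at hlt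
  have h4 := h2 _ h3
  rw [norm_mul, norm_zpow, zpow_add₀ hϖ.ne', zpow_one, ← mul_assoc] at h4
  have h5 : ‖x‖ * ‖ϖ‖ ^ n ≤ 1 := le_of_mul_le_mul_right (by linarith) hϖ
  rw [zpow_neg, inv_lt_iff_one_lt_mul₀' (by positivity), mul_comm] at hn1
  linarith

end LocalField

/-! ### The Haar measure and the normalized absolute value -/

theorem smul_closedBall_units {F : Type*} [NormedField F] (u : Fˣ) (r : ℝ) :
    u • Metric.closedBall (0 : F) r = Metric.closedBall 0 (‖(u : F)‖ * r) := by
  ext x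
  rw [Set.mem_smul_set_iff_inv_smul_mem, mem_closedBall_zero_iff, mem_closedBall_zero_iff,
    Units.smul_def, smul_eq_mul, norm_mul, Units.val_inv_eq_inv_val, norm_inv,
    inv_mul_le_iff₀ (norm_pos_iff.2 u.ne_zero)]

section LocalField

/-- If `S` is the disjoint union of finitely many translates of `T`, its measure is the
corresponding multiple of that of `T`. -/
theorem measure_eq_card_mul {G ι : Type*} [AddCommGroup G] [MeasurableSpace G] [MeasurableAdd G]
    [Fintype ι] (μ : Measure G) [μ.IsAddLeftInvariant] {S T : Set G} (hT : MeasurableSet T)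
    (c : ι → G) (hS : ∀ x, x ∈ S ↔ ∃ i, x - c i ∈ T)
    (huniq : ∀ x i j, x - c i ∈ T → x - c j ∈ T → i = j) :
    μ S = Fintype.card ι * μ T := by
  have hS' : S = ⋃ i, (fun x => -c i + x) ⁻¹' T := by
    ext x
    simp only [hS, Set.mem_iUnion, Set.mem_preimage, neg_add_eq_sub]
  rw [hS', measure_iUnion, tsum_fintype]
  · simp [measure_preimage_add]
  · intro i j hij
    refine Set.disjoint_left.2 fun x hi hj => hij ?_
    simp only [Set.mem_preimage, neg_add_eq_sub] at hi hj
    exact huniq x i j hi hj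
  · exact fun i => measurable_const_add _ hT

variable (p : ℕ) [Fact p.Prime] {F : Type*} [NormedField F] [NormedAlgebra ℚ_[p] F]

instance [FiniteDimensional ℚ_[p] F] [MeasurableSpace F] [BorelSpace F] :
    (dF p F).IsAddHaarMeasure := by
  unfold dF; infer_instance

instance [FiniteDimensional ℚ_[p] F] [MeasurableSpace F] [BorelSpace F] :
    (dF p F).Regular := by
  unfold dF; infer_instance

theorem dF_closedBall_one [FiniteDimensional ℚ_[p] F] [MeasurableSpace F] [BorelSpace F] :
    dF p F (Metric.closedBall 0 1) = 1 := by
  unfold dF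
  exact Measure.addHaarMeasure_self

@[simp] theorem nabs_zero [FiniteDimensional ℚ_[p] F] : nabs p (0 : F) = 0 := by
  rw [nabs, norm_zero, zero_pow Module.finrank_pos.ne']

@[simp] theorem nabs_one : nabs p (1 : F) = 1 := by simp [nabs]

@[simp] theorem nabs_neg (x : F) : nabs p (-x) = nabs p x := by simp [nabs]

@[simp] theorem nabs_mul (x y : F) : nabs p (x * y) = nabs p x * nabs p y := by
  simp [nabs, mul_pow]

@[simp] theorem nabs_inv (x : F) : nabs p x⁻¹ = (nabs p x)⁻¹ := by simp [nabs]

@[simp] theorem nabs_div (x y : F) : nabs p (x / y) = nabs p x / nabs p y := by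
  simp [nabs, div_pow]

@[simp] theorem nabs_pow (x : F) (n : ℕ) : nabs p (x ^ n) = nabs p x ^ n := by
  simp [nabs, ← pow_mul, mul_comm]

theorem nabs_zpow (x : F) (n : ℤ) : nabs p (x ^ n) = nabs p x ^ n := by
  rw [nabs, nabs, norm_zpow, ← zpow_natCast, ← zpow_natCast, ← zpow_mul, ← zpow_mul, mul_comm]

theorem nabs_nonneg (x : F) : 0 ≤ nabs p x := by unfold nabs; positivity

theorem nabs_pos {x : F} (hx : x ≠ 0) : 0 < nabs p x := by
  have := norm_pos_iff.2 hx
  unfold nabs; positivity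

theorem nabs_le_nabs_iff [FiniteDimensional ℚ_[p] F] {x y : F} :
    nabs p x ≤ nabs p y ↔ ‖x‖ ≤ ‖y‖ :=
  pow_le_pow_iff_left₀ (norm_nonneg _) (norm_nonneg _) Module.finrank_pos.ne'

theorem nabs_eq_of_norm_eq {x y : F} (h : ‖x‖ = ‖y‖) : nabs p x = nabs p y := by
  rw [nabs, nabs, h]

theorem nabs_le_one_iff [FiniteDimensional ℚ_[p] F] {x : F} : nabs p x ≤ 1 ↔ ‖x‖ ≤ 1 := by
  have := nabs_le_nabs_iff p (x := x) (y := 1)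
  rwa [nabs_one, norm_one] at this

section Modulus

variable [FiniteDimensional ℚ_[p] F] [MeasurableSpace F] [BorelSpace F]

theorem dF_closedBall_ne_top [ProperSpace F] (x : F) (r : ℝ) :
    dF p F (Metric.closedBall x r) ≠ ⊤ := (isCompact_closedBall x r).measure_ne_top

end Modulus
end LocalField

theorem distribHaarChar_of_norm_eq_one (p : ℕ) [Fact p.Prime] {F : Type*} [NormedField F]
    [NormedAlgebra ℚ_[p] F] [FiniteDimensional ℚ_[p] F] [MeasurableSpace F] [BorelSpace F]
    [ProperSpace F] (u : Fˣ) (hu : ‖(u : F)‖ = 1) :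
    distribHaarChar F u = 1 := by
  refine distribHaarChar_eq_of_measure_smul_eq_mul (μ := dF p F)
    (s := Metric.closedBall 0 1) ?_ (dF_closedBall_ne_top p _ _) ?_
  · simp [dF_closedBall_one]
  · rw [smul_closedBall_units, hu]; simp

/-- The ring `𝔬` is the disjoint union of `q` translates of `ϖ𝔬`. -/
theorem distribHaarChar_uniformizer (p : ℕ) [Fact p.Prime] {F : Type*} [NormedField F]
    [NormedAlgebra ℚ_[p] F] [FiniteDimensional ℚ_[p] F] [MeasurableSpace F] [BorelSpace F]
    [ProperSpace F] [IsUltrametricDist F] (u : Fˣ)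
    (h1 : ‖(u : F)‖ < 1) (h2 : ∀ x : F, ‖x‖ < 1 → ‖x‖ ≤ ‖(u : F)‖) :
    distribHaarChar F u = (resCard F : NNReal)⁻¹ := by
  have := finite_residueField F
  have := Fintype.ofFinite (IsLocalRing.ResidueField (integerRing F))
  have key := measure_eq_card_mul (dF p F) (S := Metric.closedBall 0 1)
    (T := u • Metric.closedBall (0 : F) 1)
    (by rw [smul_closedBall_units]; exact Metric.isClosed_closedBall.measurableSet)
    (fun y : IsLocalRing.ResidueField (integerRing F) => (residueRep y : F)) (by
      intro x
      simp_rw [smul_closedBall_units, mul_one, mem_closedBall_zero_iff]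
      constructor
      · intro hx
        obtain ⟨y, hy⟩ := exists_residueRep hx
        exact ⟨y, h2 _ hy⟩
      · rintro ⟨y, hy⟩
        rw [← sub_add_cancel x (residueRep y : F)]
        exact norm_add_le_of_le' (hy.trans h1.le) (norm_residueRep_le y)) (by
      simp_rw [smul_closedBall_units, mul_one, mem_closedBall_zero_iff]
      intro x i j hi hj
      exact residueRep_inj (hi.trans_lt h1) (hj.trans_lt h1))
  have hq : (resCard F : ENNReal) = Fintype.card (IsLocalRing.ResidueField (integerRing F)) := by
    rw [resCard, Nat.card_eq_fintype_card]
  rw [← distribHaarChar_mul, dF_closedBall_one, mul_one, ← hq] at key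
  have h3 : (1 : NNReal) = resCard F * distribHaarChar F u := by exact_mod_cast key
  have := one_lt_resCard F
  exact eq_inv_of_mul_eq_one_right h3.symm

/-- The module of `p` is computed on the lattice spanned by a `ℚ_p`-basis of `F`; this avoids any
comparison of the ramification index and the residue degree with the degree of `F`. -/
theorem distribHaarChar_prime (p : ℕ) [Fact p.Prime] {F : Type*} [NormedField F]
    [NormedAlgebra ℚ_[p] F] [FiniteDimensional ℚ_[p] F] [MeasurableSpace F] [BorelSpace F]
    [ProperSpace F] (u : Fˣ) (hu : (u : F) = algebraMap ℚ_[p] F p) :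
    distribHaarChar F u = ((p : NNReal) ^ Module.finrank ℚ_[p] F)⁻¹ := by
  set n := Module.finrank ℚ_[p] F with hn
  let A : F ≃L[ℚ_[p]] (Fin n → ℚ_[p]) := ContinuousLinearEquiv.ofFinrankEq (by simp [hn])
  have hp : (0 : ℝ) < p := by exact_mod_cast (Fact.out : p.Prime).pos
  have hAu : ∀ x : F, A (u • x) = (p : ℚ_[p]) • A x := by
    intro x
    rw [Units.smul_def, hu, smul_eq_mul, ← Algebra.smul_def, map_smul]
  let S : Set F := A ⁻¹' Metric.closedBall 0 1
  have hSc : IsCompact S := A.toHomeomorph.isCompact_preimage.2 (isCompact_closedBall 0 1)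
  have hu0 : (p : ℚ_[p]) ≠ 0 := by exact_mod_cast (Fact.out : p.Prime).ne_zero
  have huS : ∀ x, x ∈ u • S ↔ ∀ i, ‖A x i‖ ≤ ‖(p : ℚ_[p])‖ := by
    intro x
    rw [Set.mem_smul_set_iff_inv_smul_mem]
    have : A x = (p : ℚ_[p]) • A (u⁻¹ • x) := by rw [← hAu, smul_inv_smul]
    rw [this, Set.mem_preimage, mem_closedBall_zero_iff, pi_norm_le_iff_of_nonneg zero_le_one]
    refine forall_congr' fun i => ?_
    rw [Pi.smul_apply, norm_smul]
    have : 0 < ‖(p : ℚ_[p])‖ := norm_pos_iff.2 hu0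
    constructor
    · intro h; nlinarith
    · intro h; exact le_of_mul_le_mul_left (by linarith) this
  have hmS : ∀ x, x ∈ S ↔ ∀ i, ‖A x i‖ ≤ 1 := by
    intro x
    rw [Set.mem_preimage, mem_closedBall_zero_iff, pi_norm_le_iff_of_nonneg zero_le_one]
  have hlt : ∀ x : ℚ_[p], ‖x‖ ≤ ‖(p : ℚ_[p])‖ ↔ ‖x‖ < 1 := by
    intro x
    have := Padic.norm_le_pow_iff_norm_lt_pow_add_one x (-1)
    simpa [Padic.norm_p] using this
  have hcl : IsClosed (u • S) := by
    have := (hSc.smul u).isClosed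
    exact this
  have key := measure_eq_card_mul (dF p F) (S := S) (T := u • S) hcl.measurableSet
    (fun v : Fin n → ZMod p => A.symm fun i => ((v i).cast : ℤ_[p])) (by
      intro x
      simp_rw [huS, hmS, map_sub, ContinuousLinearEquiv.apply_symm_apply, Pi.sub_apply, hlt]
      constructor
      · intro h
        refine ⟨fun i => PadicInt.toZMod ⟨A x i, h i⟩, fun i => ?_⟩
        have := PadicInt.toZMod_spec (⟨A x i, h i⟩ : ℤ_[p])
        rw [IsLocalRing.mem_maximalIdeal, PadicInt.mem_nonunits] at this
        exact this
      · rintro ⟨v, hv⟩ i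
        rw [← sub_add_cancel (A x i) (((v i).cast : ℤ_[p]) : ℚ_[p])]
        exact norm_add_le_of_le' (hv i).le (PadicInt.norm_le_one _)) (by
      intro x v w
      simp_rw [huS, map_sub, ContinuousLinearEquiv.apply_symm_apply, Pi.sub_apply, hlt]
      intro hv hw
      funext i
      have h1 := norm_sub_lt_of_lt' (hw i) (hv i)
      rw [sub_sub_sub_cancel_left] at h1
      have h2 : ((v i).cast : ℤ_[p]) - ((w i).cast : ℤ_[p]) ∈
          IsLocalRing.maximalIdeal ℤ_[p] := by
        rw [IsLocalRing.mem_maximalIdeal, PadicInt.mem_nonunits]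
        exact h1
      rw [← PadicInt.ker_toZMod, RingHom.mem_ker, map_sub, sub_eq_zero] at h2
      simpa using h2)
  have hSne : dF p F S ≠ 0 := by
    have ho : (interior S).Nonempty := by
      refine ⟨0, mem_interior_iff_mem_nhds.2 ?_⟩
      refine A.continuous.continuousAt.preimage_mem_nhds ?_
      rw [map_zero]
      exact Metric.closedBall_mem_nhds _ one_pos
    exact (Measure.measure_pos_of_nonempty_interior _ ho).ne'
  rw [← distribHaarChar_mul, Fintype.card_fun, ZMod.card, Fintype.card_fin, ← mul_assoc] at key
  have h3 : (1 : ENNReal) = ((p ^ n : ℕ) : ENNReal) * distribHaarChar F u := by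
    have := (ENNReal.mul_left_inj hSne hSc.measure_ne_top).1 ((one_mul _).trans key)
    exact this
  have h4 : (1 : NNReal) = ((p ^ n : ℕ) : NNReal) * distribHaarChar F u := by exact_mod_cast h3
  push_cast at h4
  exact eq_inv_of_mul_eq_one_right h4.symm

section LocalField

variable (p : ℕ) [Fact p.Prime] {F : Type*} [NormedField F] [NormedAlgebra ℚ_[p] F]

section Modulus

variable [FiniteDimensional ℚ_[p] F] [MeasurableSpace F] [BorelSpace F]

/-- The absolute value `‖x‖ ^ [F : ℚ_p]` is normalized: it agrees with the module on `p`, hence on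
a uniformizer. -/
theorem nabs_uniformizer [ProperSpace F] [IsUltrametricDist F] {ϖ : F} (h0 : ϖ ≠ 0)
    (h1 : ‖ϖ‖ < 1) (h2 : ∀ x : F, ‖x‖ < 1 → ‖x‖ ≤ ‖ϖ‖) :
    nabs p ϖ = (resCard F : ℝ)⁻¹ := by
  have hp0 : algebraMap ℚ_[p] F p ≠ 0 := by
    rw [map_ne_zero]; exact_mod_cast (Fact.out : p.Prime).ne_zero
  have hp1 : ‖algebraMap ℚ_[p] F p‖ = (p : ℝ)⁻¹ := by rw [norm_algebraMap', Padic.norm_p]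
  obtain ⟨k, hk⟩ := exists_norm_eq_zpow h0 h1 h2 hp0
  set P : Fˣ := Units.mk0 _ hp0
  set W : Fˣ := Units.mk0 _ h0
  have hPW : distribHaarChar F (P * (W ^ k)⁻¹) = 1 := by
    refine distribHaarChar_of_norm_eq_one p _ ?_
    have : ‖ϖ‖ ^ k ≠ 0 := zpow_ne_zero _ (norm_ne_zero_iff.2 h0)
    simp only [Units.val_mul, Units.val_inv_eq_inv_val, Units.val_zpow_eq_zpow_val, norm_mul,
      norm_inv, norm_zpow, P, W, Units.val_mk0, hk]
    exact mul_inv_cancel₀ this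
  rw [map_mul, map_inv, map_zpow, distribHaarChar_prime p P rfl,
    distribHaarChar_uniformizer p W h1 h2] at hPW
  have hq := one_lt_resCard F
  have hqpos : (0 : ℝ) < resCard F := by positivity
  have hPW' : ((p : ℝ) ^ Module.finrank ℚ_[p] F)⁻¹ = ((resCard F : ℝ)⁻¹) ^ k := by
    have := (mul_inv_eq_one₀ (by
      apply zpow_ne_zero; positivity)).1 hPW
    simpa using congrArg NNReal.toReal this
  have h3 : nabs p ϖ ^ k = ((resCard F : ℝ)⁻¹) ^ k := by
    rw [← hPW', ← nabs_zpow, nabs, norm_zpow, ← hk, hp1, inv_pow]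
  have hp : (1 : ℝ) < p := by exact_mod_cast (Fact.out : p.Prime).one_lt
  have hkpos : 0 < k := by
    by_contra! hk0
    have : 1 ≤ ‖ϖ‖ ^ k := one_le_zpow_of_nonpos₀ (norm_pos_iff.2 h0) h1.le hk0
    rw [← hk, hp1] at this
    have := inv_lt_one_of_one_lt₀ hp
    linarith
  lift k to ℕ using hkpos.le
  rw [zpow_natCast, zpow_natCast] at h3
  exact (pow_left_inj₀ (nabs_nonneg p _) (by positivity) (by omega)).1 h3

theorem distribHaarChar_eq_nabs [ProperSpace F] [IsUltrametricDist F] (u : Fˣ) :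
    (distribHaarChar F u : ℝ) = nabs p (u : F) := by
  obtain ⟨ϖ, h0, h1, h2⟩ := exists_uniformizer p F
  obtain ⟨k, hk⟩ := exists_norm_eq_zpow h0 h1 h2 u.ne_zero
  set W : Fˣ := Units.mk0 _ h0
  have hPW : distribHaarChar F (u * (W ^ k)⁻¹) = 1 := by
    refine distribHaarChar_of_norm_eq_one p _ ?_
    have : ‖ϖ‖ ^ k ≠ 0 := zpow_ne_zero _ (norm_ne_zero_iff.2 h0)
    simp only [Units.val_mul, Units.val_inv_eq_inv_val, Units.val_zpow_eq_zpow_val, norm_mul,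
      norm_inv, norm_zpow, W, Units.val_mk0, hk]
    exact mul_inv_cancel₀ this
  have hq := one_lt_resCard F
  rw [map_mul, map_inv, map_zpow, distribHaarChar_uniformizer p W h1 h2,
    mul_inv_eq_one₀ (by apply zpow_ne_zero; positivity)] at hPW
  rw [hPW, nabs, hk, ← norm_zpow, ← nabs, nabs_zpow, nabs_uniformizer p h0 h1 h2]
  push_cast
  rfl

end Modulus
end LocalField

/-! ### Orders, the additive character and its integrals over balls -/

section LocalField

variable (p : ℕ) [Fact p.Prime] {F : Type*} [NormedField F] [NormedAlgebra ℚ_[p] F]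
  [FiniteDimensional ℚ_[p] F]

section Measure

variable [MeasurableSpace F] [BorelSpace F]

theorem map_mul_left_dF [ProperSpace F] [IsUltrametricDist F] {a : F} (ha : a ≠ 0) :
    (dF p F).map (a * ·) = ENNReal.ofReal (nabs p a)⁻¹ • dF p F := by
  set u : Fˣ := Units.mk0 a ha
  ext s hs
  rw [Measure.map_apply (by fun_prop) hs, Measure.smul_apply]
  have h1 : (a * ·) ⁻¹' s = u⁻¹ • s := by
    rw [← Set.preimage_smul]; rfl
  rw [h1, ← distribHaarChar_mul, smul_eq_mul]
  congr 1
  rw [← nabs_inv, ← Units.val_mk0 ha, ← Units.val_inv_eq_inv_val, ← distribHaarChar_eq_nabs,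
    ENNReal.ofReal_coe_nnreal]

theorem integral_comp_mul_left [ProperSpace F] [IsUltrametricDist F] {a : F} (ha : a ≠ 0)
    (f : F → ℂ) : ∫ x, f (a * x) ∂(dF p F) = ((nabs p a)⁻¹ : ℝ) * ∫ x, f x ∂(dF p F) := by
  have h := (Homeomorph.mulLeft₀ a ha).measurableEmbedding.integral_map (μ := dF p F) f
  rw [Homeomorph.coe_mulLeft₀, map_mul_left_dF p ha, integral_smul_measure,
    ENNReal.toReal_ofReal (inv_nonneg.2 (nabs_nonneg p a))] at h
  rw [← h, Complex.real_smul]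

theorem setIntegral_comp_mul_left [ProperSpace F] [IsUltrametricDist F] {a : F} (ha : a ≠ 0)
    (S : Set F) (f : F → ℂ) : ∫ x in (a * ·) ⁻¹' S, f (a * x) ∂(dF p F) =
      ((nabs p a)⁻¹ : ℝ) * ∫ x in S, f x ∂(dF p F) := by
  have h := (Homeomorph.mulLeft₀ a ha).measurableEmbedding.setIntegral_map (μ := dF p F) f S
  rw [Homeomorph.coe_mulLeft₀, map_mul_left_dF p ha, Measure.restrict_smul, integral_smul_measure,
    ENNReal.toReal_ofReal (inv_nonneg.2 (nabs_nonneg p a))] at h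
  rw [← h, Complex.real_smul]

theorem preimage_mul_closedBall {F : Type*} [NormedField F] {a : F} (ha : a ≠ 0) (r : F) :
    (a * ·) ⁻¹' Metric.closedBall 0 ‖r‖ = Metric.closedBall (0 : F) ‖r / a‖ := by
  ext x
  rw [Set.mem_preimage, mem_closedBall_zero_iff, mem_closedBall_zero_iff, norm_mul, norm_div,
    le_div_iff₀' (norm_pos_iff.2 ha)]

theorem dF_real_closedBall [ProperSpace F] [IsUltrametricDist F] {r : F} (hr : r ≠ 0) :
    (dF p F).real (Metric.closedBall 0 ‖r‖) = nabs p r := by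
  have h1 := smul_closedBall_units (Units.mk0 r hr) 1
  rw [Units.val_mk0, mul_one] at h1
  rw [← h1, measureReal_def, ← distribHaarChar_mul, dF_closedBall_one, mul_one,
    ENNReal.coe_toReal, distribHaarChar_eq_nabs p, Units.val_mk0]

theorem setIntegral_one_closedBall [ProperSpace F] [IsUltrametricDist F] {r : F} (hr : r ≠ 0) :
    ∫ _ in Metric.closedBall (0 : F) ‖r‖, (1 : ℂ) ∂(dF p F) = nabs p r := by
  rw [setIntegral_const, dF_real_closedBall p hr]; simp

end Measure

theorem charZero_of_padic (p : ℕ) [Fact p.Prime] (F : Type*) [NormedField F]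
    [NormedAlgebra ℚ_[p] F] : CharZero F :=
  charZero_of_injective_algebraMap (algebraMap ℚ_[p] F).injective

section Order

variable [IsUltrametricDist F]

theorem ordF_eq_of_nabs [ProperSpace F] {x : F} {n : ℤ} (h : nabs p x = (resCard F : ℝ) ^ (-n)) :
    ordF p x = n := by
  rw [ordF, h, Int.log_zpow (one_lt_resCard F), neg_neg]

theorem nabs_eq_zpow_ordF [ProperSpace F] {x : F} (hx : x ≠ 0) :
    nabs p x = (resCard F : ℝ) ^ (-ordF p x) := by
  borelize F
  obtain ⟨ϖ, h0, h1, h2⟩ := exists_uniformizer p F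
  obtain ⟨k, hk⟩ := exists_norm_eq_zpow h0 h1 h2 hx
  have h3 : nabs p x = (resCard F : ℝ) ^ (-k) := by
    rw [nabs, hk, ← norm_zpow, ← nabs, nabs_zpow, nabs_uniformizer p h0 h1 h2, inv_zpow', zpow_neg]
  rw [h3, ordF_eq_of_nabs p h3]

/-- Elements of norm at most `1` have minimal polynomials with coefficients in `ℤ_p`, since the norm
is the spectral norm; so their traces lie in `ℤ_p`. -/
theorem norm_trace_le_one {y : F} (hy : ‖y‖ ≤ 1) : ‖Algebra.trace ℚ_[p] F y‖ ≤ 1 := by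
  rw [NormedAlgebra.norm_eq_spectralNorm ℚ_[p] y, spectralNorm,
    spectralValue_le_one_iff (minpoly.monic (Algebra.IsIntegral.isIntegral y))] at hy
  rw [trace_eq_finrank_mul_minpoly_nextCoeff, norm_mul, norm_neg]
  refine mul_le_one₀ ?_ (norm_nonneg _) ?_
  · exact_mod_cast Padic.norm_int_le_one (p := p)
      (Module.finrank (IntermediateField.adjoin ℚ_[p] {y}) F : ℤ)
  · unfold Polynomial.nextCoeff
    split_ifs
    · simp
    · exact hy _

end Order

theorem setIntegral_comp_add {G : Type*} [AddCommGroup G] [MeasurableSpace G] [MeasurableAdd G]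
    (μ : Measure G) [μ.IsAddLeftInvariant] (y : G) {S : Set G}
    (hS : ∀ x, x + y ∈ S ↔ x ∈ S) (f : G → ℂ) : ∫ x in S, f (x + y) ∂μ = ∫ x in S, f x ∂μ := by
  have h := (measurePreserving_add_right μ y).setIntegral_preimage_emb
    (measurableEmbedding_addRight y) f S
  rwa [show (· + y) ⁻¹' S = S from Set.ext hS] at h

theorem add_mem_closedBall_iff {G : Type*} [SeminormedAddCommGroup G] [IsUltrametricDist G]
    {x y : G} {r : ℝ} (hy : ‖y‖ ≤ r) :
    x + y ∈ Metric.closedBall (0 : G) r ↔ x ∈ Metric.closedBall 0 r := by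
  rw [mem_closedBall_zero_iff, mem_closedBall_zero_iff]
  refine ⟨fun h => ?_, fun h => norm_add_le_of_le' h hy⟩
  have := norm_sub_le_of_le' h hy
  rwa [add_sub_cancel_right] at this

theorem setIntegral_swap {X Y : Type*} [TopologicalSpace X] [TopologicalSpace Y]
    [MeasurableSpace X] [MeasurableSpace Y] [OpensMeasurableSpace X] [OpensMeasurableSpace Y]
    [SecondCountableTopology X] [SecondCountableTopology Y] [T2Space X] [T2Space Y]
    (μ : Measure X) (ν : Measure Y)
    [SFinite μ] [SFinite ν] [IsFiniteMeasureOnCompacts μ] [IsFiniteMeasureOnCompacts ν]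
    {A : Set X} {B : Set Y} (hA : IsCompact A) (hB : IsCompact B) {f : X → Y → ℂ}
    (hf : Continuous (Function.uncurry f)) :
    ∫ x in A, ∫ y in B, f x y ∂ν ∂μ = ∫ y in B, ∫ x in A, f x y ∂μ ∂ν := by
  apply integral_integral_swap
  rw [Measure.prod_restrict]
  refine (hf.continuousOn (s := A ×ˢ B)).integrableOn_compact' (hA.prod hB)
    (hA.measurableSet.prod hB.measurableSet) |>.mono_measure le_rfl

end LocalField

namespace LocalDatum

variable {p : ℕ} [Fact p.Prime] {F : Type*} [NormedField F] [NormedAlgebra ℚ_[p] F]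
  [IsUltrametricDist F] (D : LocalDatum p F) [FiniteDimensional ℚ_[p] F] [ProperSpace F]

theorem norm_δ_le_one : ‖D.δ‖ ≤ 1 := by
  have h := (D.δ_generates 1).1 fun y hy => by
    rw [one_mul]; exact norm_trace_le_one p hy
  rwa [mul_one] at h

theorem nabs_δ : nabs p D.δ = (resCard F : ℝ) ^ (-(D.cψ : ℤ)) := by
  have h := nabs_eq_zpow_ordF p D.δ_ne_zero
  have h1 : nabs p D.δ ≤ 1 := (nabs_le_one_iff p).2 D.norm_δ_le_one
  have h2 : 0 ≤ ordF p D.δ := by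
    by_contra! hneg
    have hq : (1 : ℝ) < resCard F := by exact_mod_cast one_lt_resCard F
    have := one_lt_zpow₀ hq (n := -ordF p D.δ) (by omega)
    linarith
  rw [h, cψ, Int.toNat_of_nonneg h2]

theorem ψ_eq_one {x : F} (hx : ‖D.δ * x‖ ≤ 1) : D.ψ x = 1 := by
  refine D.order_ψ.1 x ?_
  have h1 := (nabs_le_one_iff p).2 hx
  have hq : (1 : ℝ) < resCard F := by exact_mod_cast one_lt_resCard F
  rw [nabs_mul, nabs_δ, zpow_neg, inv_mul_le_iff₀ (by positivity), mul_one, zpow_natCast] at h1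
  exact h1

/-- The maximality of the order of `ψ`: it is nontrivial on every ideal larger than `δ⁻¹𝔬`. -/
theorem exists_ψ_ne_one {t : F} (ht : 1 < ‖D.δ * t‖) : ∃ y : F, ‖y‖ ≤ 1 ∧ D.ψ (t * y) ≠ 1 := by
  have hq : (1 : ℝ) < resCard F := by exact_mod_cast one_lt_resCard F
  have h1 : ¬ ∀ x : F, nabs p x ≤ (resCard F : ℝ) ^ (D.cψ + 1) → D.ψ x = 1 := by
    intro h
    have := D.order_ψ.2 h
    unfold cψ at this
    omega
  push Not at h1
  obtain ⟨x, hx1, hx2⟩ := h1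
  have ht0 : D.δ * t ≠ 0 := by
    intro h0; rw [h0, norm_zero] at ht; linarith
  have ht1 : t ≠ 0 := right_ne_zero_of_mul ht0
  refine ⟨x / t, ?_, by rwa [mul_div_cancel₀ _ ht1]⟩
  have h2 : 1 < nabs p (D.δ * t) := by
    by_contra! h; exact absurd ((nabs_le_one_iff p).1 h) (not_le.2 ht)
  have h3 : (resCard F : ℝ) ≤ nabs p (D.δ * t) := by
    rw [nabs_eq_zpow_ordF p ht0] at h2 ⊢
    have : 0 < -ordF p (D.δ * t) := (one_lt_zpow_iff_right₀ hq).1 h2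
    calc (resCard F : ℝ) = (resCard F : ℝ) ^ (1 : ℤ) := (zpow_one _).symm
      _ ≤ _ := zpow_le_zpow_right₀ hq.le (by omega)
  rw [nabs_mul, nabs_δ, zpow_neg, zpow_natCast, ← div_eq_inv_mul,
    le_div_iff₀ (by positivity)] at h3
  rw [← nabs_le_one_iff p, nabs_div, div_le_one (nabs_pos p ht1)]
  rw [pow_succ'] at hx1
  exact hx1.trans h3

/-- The character is unitary, as every element is `p`-power torsion modulo the kernel of `ψ`. -/
theorem norm_ψ (x : F) : ‖D.ψ x‖ = 1 := by
  obtain ⟨ϖ, h0, h1, h2⟩ := exists_uniformizer p F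
  have hp1 : ‖algebraMap ℚ_[p] F p‖ = (p : ℝ)⁻¹ := by rw [norm_algebraMap', Padic.norm_p]
  have hp : (1 : ℝ) < p := by exact_mod_cast (Fact.out : p.Prime).one_lt
  have hlim := (tendsto_pow_atTop_nhds_zero_of_lt_one (r := (p : ℝ)⁻¹) (by positivity)
    (inv_lt_one_of_one_lt₀ hp)).mul_const ‖D.δ * x‖
  rw [zero_mul] at hlim
  obtain ⟨k, hk⟩ := (hlim.eventually (ge_mem_nhds zero_lt_one)).exists
  refine (pow_eq_one_iff_of_nonneg (norm_nonneg _)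
    (pow_ne_zero k (Fact.out : p.Prime).ne_zero)).1 ?_
  rw [← norm_pow, ← AddChar.map_nsmul_eq_pow, D.ψ_eq_one, norm_one]
  have h3 : ‖((p ^ k : ℕ) : F)‖ = (p : ℝ)⁻¹ ^ k := by
    rw [← hp1, ← norm_pow]; simp
  rwa [nsmul_eq_mul, mul_left_comm, norm_mul, h3]

theorem conj_ψ (x : F) : conj (D.ψ x) = D.ψ (-x) := by
  rw [AddChar.map_neg_eq_inv, Complex.inv_def, Complex.normSq_eq_norm_sq, norm_ψ]
  simp

theorem ψ_add_of_small {x y : F} (hy : ‖D.δ * y‖ ≤ 1) : D.ψ (x + y) = D.ψ x := by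
  rw [AddChar.map_add_eq_mul, D.ψ_eq_one hy, mul_one]

theorem isLocallyConstant_ψ : IsLocallyConstant D.ψ := by
  rw [IsLocallyConstant.iff_eventually_eq]
  intro x
  have hδ : 0 < ‖D.δ‖ := norm_pos_iff.2 D.δ_ne_zero
  filter_upwards [Metric.closedBall_mem_nhds x (inv_pos.2 hδ)] with y hy
  rw [mem_closedBall_iff_norm] at hy
  have := D.ψ_add_of_small (x := x) (y := y - x) (by
    rw [norm_mul]; exact (mul_le_mul_of_nonneg_left hy hδ.le).trans_eq (mul_inv_cancel₀ hδ.ne'))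
  rwa [add_sub_cancel] at this

@[fun_prop] theorem continuous_ψ : Continuous D.ψ := D.isLocallyConstant_ψ.continuous

section Fourier

variable [MeasurableSpace F] [BorelSpace F]

theorem setIntegral_ψ {r : F} (hr : r ≠ 0) (t : F) :
    ∫ x in Metric.closedBall 0 ‖r‖, D.ψ (x * t) ∂(dF p F) =
      if ‖D.δ * (r * t)‖ ≤ 1 then (nabs p r : ℂ) else 0 := by
  split_ifs with h
  · rw [← setIntegral_one_closedBall p hr]
    refine setIntegral_congr_fun Metric.isClosed_closedBall.measurableSet fun x hx => ?_
    refine D.ψ_eq_one (le_trans ?_ h)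
    rw [mem_closedBall_zero_iff] at hx
    simp only [norm_mul]
    gcongr
  · obtain ⟨y, hy1, hy2⟩ := D.exists_ψ_ne_one (not_le.1 h)
    have h1 := setIntegral_comp_add (dF p F) (r * y) (S := Metric.closedBall 0 ‖r‖)
      (fun x => add_mem_closedBall_iff (by
        rw [norm_mul]; exact mul_le_of_le_one_right (norm_nonneg _) hy1))
      (fun x => D.ψ (x * t))
    simp_rw [add_mul, AddChar.map_add_eq_mul] at h1
    rw [integral_mul_const, mul_right_comm r y t] at h1
    have h2 : (∫ x in Metric.closedBall 0 ‖r‖, D.ψ (x * t) ∂(dF p F)) *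
      (D.ψ (r * t * y) - 1) = 0 := by rw [mul_sub, h1, mul_one, sub_self]
    exact (mul_eq_zero.1 h2).resolve_right (sub_ne_zero.2 hy2)

end Fourier

end LocalDatum

/-! ### Schwartz functions -/

section LocalField

variable (p : ℕ) [Fact p.Prime] {F : Type*} [NormedField F] [NormedAlgebra ℚ_[p] F]
  [FiniteDimensional ℚ_[p] F]

theorem exists_norm_le (F : Type*) [NormedField F] [NormedAlgebra ℚ_[p] F]
    {ε : ℝ} (hε : 0 < ε) : ∃ r : F, r ≠ 0 ∧ ‖r‖ ≤ ε := by
  have hp : (1 : ℝ) < p := by exact_mod_cast (Fact.out : p.Prime).one_lt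
  obtain ⟨k, hk⟩ := exists_pow_lt_of_lt_one hε (inv_lt_one_of_one_lt₀ hp)
  refine ⟨algebraMap ℚ_[p] F (p ^ k), ?_, ?_⟩
  · rw [map_ne_zero]; exact pow_ne_zero _ (by exact_mod_cast (Fact.out : p.Prime).ne_zero)
  · rw [norm_algebraMap', norm_pow, Padic.norm_p]; exact hk.le

theorem exists_le_norm (F : Type*) [NormedField F] [NormedAlgebra ℚ_[p] F] (C : ℝ) :
    ∃ R : F, R ≠ 0 ∧ C ≤ ‖R‖ := by
  obtain ⟨r, hr, h⟩ := exists_norm_le p F (ε := (max C 1)⁻¹) (by positivity)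
  refine ⟨r⁻¹, inv_ne_zero hr, (le_max_left C 1).trans ?_⟩
  rw [norm_inv]
  exact (le_inv_comm₀ (by positivity) (norm_pos_iff.2 hr)).2 h

end LocalField

namespace LocalDatum

/-- A Schwartz function is invariant under some ball and supported in some ball. -/
theorem IsSchwartz.exists_bounds (p : ℕ) [Fact p.Prime] {F : Type*} [NormedField F]
    [NormedAlgebra ℚ_[p] F] [IsUltrametricDist F] [ProperSpace F] {φ : F → ℂ}
    (h : IsSchwartz φ) : ∃ r R : F, r ≠ 0 ∧ R ≠ 0 ∧
      (∀ x y, ‖y‖ ≤ ‖r‖ → φ (x + y) = φ x) ∧ ∀ x, φ x ≠ 0 → ‖x‖ ≤ ‖R‖ := by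
  obtain ⟨C, hC⟩ := h.2.isCompact.isBounded.exists_norm_le
  obtain ⟨R, hR0, hR⟩ := exists_le_norm p F C
  have hsupp : ∀ x, φ x ≠ 0 → ‖x‖ ≤ ‖R‖ := fun x hx => (hC x (subset_tsupport φ hx)).trans hR
  obtain ⟨ε, hε, hcov⟩ := lebesgue_number_lemma_of_metric (isCompact_closedBall (0 : F) ‖R‖)
    (c := fun z : ℂ => φ ⁻¹' {z}) (fun z => h.1.isOpen_fiber z)
    (fun x _ => Set.mem_iUnion.2 ⟨φ x, rfl⟩)
  obtain ⟨r, hr0, hr⟩ := exists_norm_le p F (ε := min (ε / 2) ‖R‖)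
    (lt_min (by positivity) (norm_pos_iff.2 hR0))
  refine ⟨r, R, hr0, hR0, fun x y hy => ?_, hsupp⟩
  by_cases hx : ‖x‖ ≤ ‖R‖
  · obtain ⟨z, hz⟩ := hcov x (mem_closedBall_zero_iff.2 hx)
    have h1 : φ x = z := hz (Metric.mem_ball_self hε)
    have h2 : φ (x + y) = z := hz (by
      rw [mem_ball_iff_norm, add_sub_cancel_left]
      have := min_le_left (ε / 2) ‖R‖
      linarith)
    rw [h1, h2]
  · have h1 : ‖y‖ < ‖x‖ := (hy.trans (hr.trans (min_le_right _ _))).trans_lt (not_le.1 hx)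
    have h2 : φ x = 0 := by by_contra h0; exact hx (hsupp x h0)
    have h3 : φ (x + y) = 0 := by
      by_contra h0
      have := hsupp _ h0
      rw [norm_add_eq_left h1] at this
      exact hx this
    rw [h2, h3]

theorem isSchwartz_of_bounds {F : Type*} [NormedField F] [ProperSpace F] {φ : F → ℂ} {r R : F}
    (hr : r ≠ 0) (h1 : ∀ x y, ‖y‖ ≤ ‖r‖ → φ (x + y) = φ x) (h2 : ∀ x, φ x ≠ 0 → ‖x‖ ≤ ‖R‖) :
    IsSchwartz φ := by
  constructor
  · rw [IsLocallyConstant.iff_eventually_eq]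
    intro x
    filter_upwards [Metric.closedBall_mem_nhds x (norm_pos_iff.2 hr)] with y hy
    rw [mem_closedBall_iff_norm] at hy
    have := h1 x (y - x) hy
    rwa [add_sub_cancel] at this
  · refine HasCompactSupport.intro (isCompact_closedBall (0 : F) ‖R‖) fun x hx => ?_
    by_contra h0
    exact hx (mem_closedBall_zero_iff.2 (h2 x h0))

section Schwartz

variable {F : Type*} [NormedField F] [ProperSpace F] {φ : F → ℂ}

theorem IsSchwartz.continuous (h : IsSchwartz φ) : Continuous φ := h.1.continuous

theorem IsSchwartz.mul_left (h : IsSchwartz φ) {g : F → ℂ} (hg : IsLocallyConstant g) :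
    IsSchwartz fun t => g t * φ t :=
  ⟨hg.mul h.1, h.2.mul_left⟩

theorem IsSchwartz.const_mul (h : IsSchwartz φ) (c : ℂ) : IsSchwartz fun t => c * φ t :=
  h.mul_left (IsLocallyConstant.const c)

theorem IsSchwartz.comp_mul (h : IsSchwartz φ) {a : F} (ha : a ≠ 0) :
    IsSchwartz fun t => φ (a * t) :=
  ⟨h.1.comp_continuous (by fun_prop), h.2.comp_homeomorph (Homeomorph.mulLeft₀ a ha)⟩

theorem isSchwartz_indicator_closedBall [IsUltrametricDist F] {r : F} (hr : r ≠ 0) (c : F) :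
    IsSchwartz ((Metric.closedBall c ‖r‖).indicator fun _ => (1 : ℂ)) := by
  constructor
  · have h := (LocallyConstant.charFn ℂ
      (IsUltrametricDist.isClopen_closedBall c (norm_ne_zero_iff.2 hr))).isLocallyConstant
    exact h
  · exact HasCompactSupport.intro (isCompact_closedBall c ‖r‖)
      fun x hx => Set.indicator_of_notMem hx _

end Schwartz

variable {p : ℕ} [Fact p.Prime] {F : Type*} [NormedField F] [NormedAlgebra ℚ_[p] F]
  [IsUltrametricDist F] (D : LocalDatum p F) [FiniteDimensional ℚ_[p] F] [ProperSpace F]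
  [MeasurableSpace F] [BorelSpace F]

/-! ### The Fourier transform -/

/-- The constant `|δ|^{1/2}` making the Haar measure self-dual. -/
def sqrtδ : ℂ := ((nabs p D.δ ^ (1 / 2 : ℝ) : ℝ) : ℂ)

theorem sqrtδ_mul_self : D.sqrtδ * D.sqrtδ = nabs p D.δ := by
  have h := nabs_pos p D.δ_ne_zero
  rw [sqrtδ, ← Complex.ofReal_mul, ← Real.rpow_add h]
  norm_num

theorem sqrtδ_ne_zero : D.sqrtδ ≠ 0 := by
  intro h
  have := D.sqrtδ_mul_self
  rw [h, mul_zero] at this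
  exact (nabs_pos p D.δ_ne_zero).ne' (by exact_mod_cast this.symm)

theorem fourier_eq_setIntegral {φ : F → ℂ} {R : ℝ} (hR : ∀ x, φ x ≠ 0 → ‖x‖ ≤ R) (x : F) :
    D.fourier φ x =
      D.sqrtδ * ∫ y in Metric.closedBall 0 R, φ y * D.ψ (x * y) ∂(dF p F) := by
  rw [fourier, setIntegral_eq_integral_of_forall_compl_eq_zero, sqrtδ]
  intro y hy
  have : φ y = 0 := by by_contra h0; exact hy (mem_closedBall_zero_iff.2 (hR y h0))
  rw [this, zero_mul]

theorem fourier_comp_mul {a : F} (ha : a ≠ 0) (φ : F → ℂ) (x : F) :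
    D.fourier (fun t => φ (a * t)) x = ((nabs p a)⁻¹ : ℝ) * D.fourier φ (x / a) := by
  have h := integral_comp_mul_left p ha fun y => φ y * D.ψ (x / a * y)
  rw [fourier, fourier, mul_left_comm, ← h]
  congr 2
  funext y
  rw [show x / a * (a * y) = x * y by field_simp]

theorem fourier_mul_ψ (u : F) (φ : F → ℂ) (x : F) :
    D.fourier (fun t => φ t * D.ψ (u * t)) x = D.fourier φ (x + u) := by
  rw [fourier, fourier]
  congr 2
  funext y
  rw [add_mul, AddChar.map_add_eq_mul]
  ring

theorem fourier_const_mul (c : ℂ) (φ : F → ℂ) (x : F) :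
    D.fourier (fun t => c * φ t) x = c * D.fourier φ x := by
  simp_rw [fourier, mul_assoc]
  rw [integral_const_mul, mul_left_comm]

/-- The Fourier transform of a function invariant under `r𝔬` is supported on `(δr)⁻¹𝔬`. -/
theorem fourier_eq_zero {φ : F → ℂ} {r : F} (h1 : ∀ x y, ‖y‖ ≤ ‖r‖ → φ (x + y) = φ x) {x : F}
    (hx : 1 < ‖D.δ * (r * x)‖) : D.fourier φ x = 0 := by
  obtain ⟨y, hy1, hy2⟩ := D.exists_ψ_ne_one hx
  have h2 := integral_add_right_eq_self (μ := dF p F) (fun t => φ t * D.ψ (x * t)) (r * y)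
  have h3 : (fun t => φ (t + r * y) * D.ψ (x * (t + r * y))) =
      fun t => φ t * D.ψ (x * t) * D.ψ (r * x * y) := by
    funext t
    rw [h1 _ _ (by rw [norm_mul]; exact mul_le_of_le_one_right (norm_nonneg _) hy1), mul_add,
      AddChar.map_add_eq_mul, mul_assoc, show x * (r * y) = r * x * y by ring]
  rw [h3, integral_mul_const] at h2
  have h4 : (∫ t, φ t * D.ψ (x * t) ∂(dF p F)) * (D.ψ (r * x * y) - 1) = 0 := by
    rw [mul_sub, h2, mul_one, sub_self]
  rw [fourier, (mul_eq_zero.1 h4).resolve_right (sub_ne_zero.2 hy2), mul_zero]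

/-- The Fourier transform of a function supported on `R𝔬` is invariant under `(δR)⁻¹𝔬`. -/
theorem fourier_add_of_small {φ : F → ℂ} {R : F} (hR : ∀ x, φ x ≠ 0 → ‖x‖ ≤ ‖R‖) {x y : F}
    (hy : ‖D.δ * (R * y)‖ ≤ 1) : D.fourier φ (x + y) = D.fourier φ x := by
  rw [fourier, fourier]
  congr 2
  funext t
  by_cases h0 : φ t = 0
  · rw [h0, zero_mul, zero_mul]
  · rw [add_mul, D.ψ_add_of_small]
    refine le_trans ?_ hy
    have := hR t h0
    simp only [norm_mul]
    rw [mul_comm ‖y‖]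
    gcongr

theorem isSchwartz_fourier {φ : F → ℂ} (h : IsSchwartz φ) : IsSchwartz (D.fourier φ) := by
  obtain ⟨r, R, hr, hR, h1, h2⟩ := h.exists_bounds p
  refine isSchwartz_of_bounds (r := (D.δ * R)⁻¹) (R := (D.δ * r)⁻¹)
    (inv_ne_zero (mul_ne_zero D.δ_ne_zero hR)) (fun x y hy => ?_) (fun x hx => ?_)
  · refine D.fourier_add_of_small h2 ?_
    rw [← mul_assoc, norm_mul, ← le_div_iff₀' (norm_pos_iff.2 (mul_ne_zero D.δ_ne_zero hR)),
      one_div, ← norm_inv]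
    exact hy
  · by_contra h0
    refine hx (D.fourier_eq_zero h1 ?_)
    rw [not_le, norm_inv, inv_lt_iff_one_lt_mul₀'
      (norm_pos_iff.2 (mul_ne_zero D.δ_ne_zero hr)), ← norm_mul, mul_assoc] at h0
    exact h0

/-- Fourier inversion. -/
theorem fourier_fourier {φ : F → ℂ} (h : IsSchwartz φ) (x : F) :
    D.fourier (D.fourier φ) x = φ (-x) := by
  obtain ⟨r, R, hr, hR, h1, h2⟩ := h.exists_bounds p
  have hδr : D.δ * r ≠ 0 := mul_ne_zero D.δ_ne_zero hr
  have h3 : ∀ y, D.fourier φ y ≠ 0 → ‖y‖ ≤ ‖(D.δ * r)⁻¹‖ := by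
    intro y hy
    by_contra h0
    refine hy (D.fourier_eq_zero h1 ?_)
    rw [not_le, norm_inv, inv_lt_iff_one_lt_mul₀' (norm_pos_iff.2 hδr), ← norm_mul,
      mul_assoc] at h0
    exact h0
  rw [D.fourier_eq_setIntegral h3]
  have h4 : ∀ y, D.fourier φ y * D.ψ (x * y) = D.sqrtδ *
      ∫ t in Metric.closedBall 0 ‖R‖, φ t * D.ψ (y * (t + x)) ∂(dF p F) := by
    intro y
    rw [D.fourier_eq_setIntegral h2, mul_assoc, ← integral_mul_const]
    congr 2
    funext t
    rw [mul_add, AddChar.map_add_eq_mul, mul_assoc, mul_comm x y]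
  simp_rw [h4]
  have hφ := h.continuous
  rw [integral_const_mul, setIntegral_swap (dF p F) (dF p F) (isCompact_closedBall _ _)
    (isCompact_closedBall _ _) (by fun_prop), ← mul_assoc, sqrtδ_mul_self]
  have h5 : ∀ t, ∫ y in Metric.closedBall 0 ‖(D.δ * r)⁻¹‖, φ t * D.ψ (y * (t + x)) ∂(dF p F) =
      φ (-x) * (nabs p (D.δ * r)⁻¹ *
        (Metric.closedBall 0 ‖r‖).indicator (fun _ => (1 : ℂ)) (t + x)) := by
    intro t
    rw [integral_const_mul, D.setIntegral_ψ (inv_ne_zero hδr)]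
    have h6 : ‖D.δ * ((D.δ * r)⁻¹ * (t + x))‖ ≤ 1 ↔ t + x ∈ Metric.closedBall 0 ‖r‖ := by
      rw [mem_closedBall_zero_iff, show D.δ * ((D.δ * r)⁻¹ * (t + x)) = (t + x) / r by
        field_simp [D.δ_ne_zero], norm_div, div_le_one (norm_pos_iff.2 hr)]
    by_cases hm : t + x ∈ Metric.closedBall 0 ‖r‖
    · have h7 := h1 (-x) (t + x) (mem_closedBall_zero_iff.1 hm)
      rw [if_pos (h6.2 hm), Set.indicator_of_mem hm, mul_one, ← h7]
      congr 2; ring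
    · rw [if_neg (fun h => hm (h6.1 h)), Set.indicator_of_notMem hm]
      simp
  rw [setIntegral_eq_integral_of_forall_compl_eq_zero]
  · simp_rw [h5]
    rw [integral_const_mul, integral_const_mul,
      integral_add_right_eq_self (μ := dF p F)
        (fun t => (Metric.closedBall (0 : F) ‖r‖).indicator (fun _ => (1 : ℂ)) t) x,
      integral_indicator Metric.isClosed_closedBall.measurableSet,
      setIntegral_one_closedBall p hr]
    have h8 : (nabs p D.δ : ℂ) * (nabs p (D.δ * r)⁻¹ * nabs p r) = 1 := by
      have ha := (nabs_pos p D.δ_ne_zero).ne'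
      have hb := (nabs_pos p hr).ne'
      norm_cast
      rw [nabs_inv, nabs_mul]
      field_simp
    rw [mul_left_comm, h8, mul_one]
  · intro t ht
    have : φ t = 0 := by by_contra h0; exact ht (mem_closedBall_zero_iff.2 (h2 t h0))
    simp [this]

theorem integral_fourier_mul {φ g : F → ℂ} (hφ : IsSchwartz φ) (hg : IsSchwartz g) :
    ∫ x, D.fourier φ x * g x ∂(dF p F) = ∫ x, φ x * D.fourier g x ∂(dF p F) := by
  obtain ⟨-, R, -, -, -, h2⟩ := hφ.exists_bounds p
  obtain ⟨-, S, -, -, -, h3⟩ := hg.exists_bounds p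
  have hφ' := hφ.continuous
  have hg' := hg.continuous
  rw [← setIntegral_eq_integral_of_forall_compl_eq_zero (s := Metric.closedBall 0 ‖S‖)
      (f := fun x => D.fourier φ x * g x),
    ← setIntegral_eq_integral_of_forall_compl_eq_zero (s := Metric.closedBall 0 ‖R‖)
      (f := fun x => φ x * D.fourier g x)]
  · have h4 : ∀ x, D.fourier φ x * g x = D.sqrtδ *
        ∫ t in Metric.closedBall 0 ‖R‖, φ t * g x * D.ψ (x * t) ∂(dF p F) := by
      intro x
      rw [D.fourier_eq_setIntegral h2, mul_assoc, ← integral_mul_const]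
      congr 2; funext t; ring
    have h5 : ∀ t, φ t * D.fourier g t = D.sqrtδ *
        ∫ x in Metric.closedBall 0 ‖S‖, φ t * g x * D.ψ (x * t) ∂(dF p F) := by
      intro t
      rw [D.fourier_eq_setIntegral h3, mul_left_comm, ← integral_const_mul]
      congr 2; funext x; rw [mul_comm t x]; ring
    simp_rw [h4, h5]
    rw [integral_const_mul, integral_const_mul, setIntegral_swap (dF p F) (dF p F)
      (isCompact_closedBall _ _) (isCompact_closedBall _ _) (by fun_prop)]
  · intro t ht
    have : φ t = 0 := by by_contra h0; exact ht (mem_closedBall_zero_iff.2 (h2 t h0))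
    simp [this]
  · intro t ht
    have : g t = 0 := by by_contra h0; exact ht (mem_closedBall_zero_iff.2 (h3 t h0))
    simp [this]

theorem conj_fourier (φ : F → ℂ) (x : F) :
    conj (D.fourier φ x) = D.fourier (fun t => conj (φ t)) (-x) := by
  rw [fourier, fourier, map_mul, Complex.conj_ofReal, ← integral_conj]
  simp_rw [map_mul, conj_ψ, neg_mul]

/-- The Fourier transform is unitary. -/
theorem innerF_fourier {φ g : F → ℂ} (hφ : IsSchwartz φ) (hg : IsSchwartz g) :
    D.innerF (D.fourier φ) (D.fourier g) = D.innerF φ g := by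
  have hgc : IsSchwartz fun t => conj (g t) := ⟨hg.1.comp conj, hg.2.comp_left (map_zero _)⟩
  rw [innerF, innerF]
  have hs : IsSchwartz fun x => D.fourier (fun t => conj (g t)) (-1 * x) :=
    (D.isSchwartz_fourier hgc).comp_mul (neg_ne_zero.2 one_ne_zero)
  have h1 := D.integral_fourier_mul hφ hs
  have h2 : ∀ x, D.fourier φ x * conj (D.fourier g x) =
      D.fourier φ x * D.fourier (fun t => conj (g t)) (-1 * x) := by
    intro x; rw [conj_fourier, neg_one_mul]
  simp_rw [h2]
  rw [h1]
  congr 1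
  funext x
  rw [D.fourier_comp_mul (neg_ne_zero.2 one_ne_zero), D.fourier_fourier hgc]
  simp [div_neg]

end LocalDatum

namespace LocalDatum

variable {p : ℕ} [Fact p.Prime] {F : Type*} [NormedField F] [NormedAlgebra ℚ_[p] F]
  [IsUltrametricDist F] (D : LocalDatum p F) [FiniteDimensional ℚ_[p] F] [ProperSpace F]
  [MeasurableSpace F] [BorelSpace F]

/-! ### The Weil constant -/

/-- The truncated quadratic Gauss integral `∫ ψ(a x²) dx` over `‖x‖ ≤ ‖R‖`. -/
def gauss (a R : F) : ℂ := ∫ x in Metric.closedBall (0 : F) ‖R‖, D.ψ (a * x ^ 2) ∂(dF p F)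

/-- The identity defining the Weil constant, with the truncated Gauss integral in its place: it
follows from Fourier inversion by completing the square. -/
theorem integral_mul_ψ_sq {a : F} (ha : a ≠ 0) {φ : F → ℂ} (hφ : IsSchwartz φ) :
    ∃ R₀ : ℝ, ∀ R : F, R₀ ≤ ‖R‖ →
      ∫ x, φ x * D.ψ (a * x ^ 2) ∂(dF p F) = D.sqrtδ * D.gauss a R *
        ∫ x, D.fourier φ x * D.ψ (-(x ^ 2 / (4 * a))) ∂(dF p F) := by
  have := charZero_of_padic p F
  obtain ⟨-, S, -, -, -, hS⟩ := hφ.exists_bounds p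
  obtain ⟨-, S', -, -, -, hS'⟩ := (D.isSchwartz_fourier hφ).exists_bounds p
  have hc := hφ.continuous
  have hc' := (D.isSchwartz_fourier hφ).continuous
  refine ⟨max ‖S‖ ‖S' / (2 * a)‖, fun R hR => ?_⟩
  have h1 : ‖S‖ ≤ ‖R‖ := (le_max_left _ _).trans hR
  have h2 : ‖S' / (2 * a)‖ ≤ ‖R‖ := (le_max_right _ _).trans hR
  rw [← setIntegral_eq_integral_of_forall_compl_eq_zero (s := Metric.closedBall 0 ‖R‖)
      (f := fun x => φ x * D.ψ (a * x ^ 2)),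
    ← setIntegral_eq_integral_of_forall_compl_eq_zero (s := Metric.closedBall 0 ‖S'‖)
      (f := fun x => D.fourier φ x * D.ψ (-(x ^ 2 / (4 * a))))]
  · have h3 : ∀ x, φ x * D.ψ (a * x ^ 2) = D.sqrtδ * ∫ y in Metric.closedBall 0 ‖S'‖,
        D.fourier φ y * D.ψ (a * x ^ 2 - x * y) ∂(dF p F) := by
      intro x
      have h4 := D.fourier_fourier hφ (-x)
      rw [neg_neg] at h4
      rw [← h4, D.fourier_eq_setIntegral hS', mul_assoc, ← integral_mul_const]
      congr 2
      funext y
      rw [mul_assoc, ← AddChar.map_add_eq_mul]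
      congr 2; ring
    simp_rw [h3]
    rw [integral_const_mul, setIntegral_swap (dF p F) (dF p F) (isCompact_closedBall _ _)
      (isCompact_closedBall _ _) (by fun_prop), mul_assoc]
    congr 1
    rw [← integral_const_mul]
    refine setIntegral_congr_fun Metric.isClosed_closedBall.measurableSet fun y hy => ?_
    have h5 : ∀ x, D.fourier φ y * D.ψ (a * x ^ 2 - x * y) =
        (D.fourier φ y * D.ψ (-(y ^ 2 / (4 * a)))) * D.ψ (a * (x + -(y / (2 * a))) ^ 2) := by
      intro x
      rw [mul_assoc, ← AddChar.map_add_eq_mul]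
      congr 2
      field_simp
      ring
    have h6 : ‖-(y / (2 * a))‖ ≤ ‖R‖ := by
      rw [norm_neg]
      refine le_trans ?_ h2
      rw [norm_div, norm_div]
      gcongr
      exact mem_closedBall_zero_iff.1 hy
    simp_rw [h5]
    rw [integral_const_mul, setIntegral_comp_add (dF p F) (-(y / (2 * a)))
      (fun x => add_mem_closedBall_iff h6) (fun x => D.ψ (a * x ^ 2)), gauss, mul_comm]
  · intro t ht
    have : D.fourier φ t = 0 := by
      by_contra h0; exact ht (mem_closedBall_zero_iff.2 (hS' t h0))
    simp [this]
  · intro t ht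
    have : φ t = 0 := by
      by_contra h0; exact ht (mem_closedBall_zero_iff.2 ((hS t h0).trans h1))
    simp [this]

theorem exists_integral_mul_ψ_sq_ne_zero (a : F) :
    ∃ φ : F → ℂ, IsSchwartz φ ∧ ∫ x, φ x * D.ψ (a * x ^ 2) ∂(dF p F) ≠ 0 := by
  obtain ⟨r, hr, h⟩ := exists_norm_le p F (ε := min 1 (‖D.δ * a‖ + 1)⁻¹) (by positivity)
  refine ⟨_, isSchwartz_indicator_closedBall hr 0, ?_⟩
  have h1 : ∀ x, (Metric.closedBall 0 ‖r‖).indicator (fun _ => (1 : ℂ)) x * D.ψ (a * x ^ 2) =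
      (Metric.closedBall 0 ‖r‖).indicator (fun _ => (1 : ℂ)) x := by
    intro x
    by_cases hx : x ∈ Metric.closedBall 0 ‖r‖
    · rw [D.ψ_eq_one, mul_one]
      have hx1 := (mem_closedBall_zero_iff.1 hx).trans h
      have hx2 := hx1.trans (min_le_left _ _)
      have hx3 := hx1.trans (min_le_right _ _)
      rw [← mul_assoc, pow_two, norm_mul, norm_mul x x]
      calc ‖D.δ * a‖ * (‖x‖ * ‖x‖) ≤ (‖D.δ * a‖ + 1) * (1 * (‖D.δ * a‖ + 1)⁻¹) := by
            gcongr; linarith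
        _ = 1 := by rw [one_mul]; exact mul_inv_cancel₀ (by positivity)
    · rw [Set.indicator_of_notMem hx, zero_mul]
  simp_rw [h1]
  rw [integral_indicator Metric.isClosed_closedBall.measurableSet,
    setIntegral_one_closedBall p hr]
  exact_mod_cast (nabs_pos p hr).ne'

/-- The truncated Gauss integrals are eventually constant, and their limit satisfies the identity
that defines the Weil constant. -/
theorem weilConst_aux {a : F} (ha : a ≠ 0) : ∃ G : ℂ, (∃ R₀ : ℝ, ∀ R : F, R₀ ≤ ‖R‖ →
      D.gauss a R = G) ∧ ∀ φ : F → ℂ, IsSchwartz φ →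
        ∫ x, φ x * D.ψ (a * x ^ 2) ∂(dF p F) = D.sqrtδ * G *
          ∫ x, D.fourier φ x * D.ψ (-(x ^ 2 / (4 * a))) ∂(dF p F) := by
  obtain ⟨φ₁, hφ₁, hne⟩ := D.exists_integral_mul_ψ_sq_ne_zero a
  obtain ⟨R₁, hR₁⟩ := D.integral_mul_ψ_sq ha hφ₁
  obtain ⟨R, -, hR⟩ := exists_le_norm p F R₁
  have h1 : D.sqrtδ * ∫ x, D.fourier φ₁ x * D.ψ (-(x ^ 2 / (4 * a))) ∂(dF p F) ≠ 0 := by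
    intro h0
    have := hR₁ R hR
    rw [mul_right_comm, h0, zero_mul] at this
    exact hne this
  have h2 : ∀ S : F, R₁ ≤ ‖S‖ → D.gauss a S = D.gauss a R := by
    intro S hS
    have := (hR₁ S hS).symm.trans (hR₁ R hR)
    rw [mul_right_comm, mul_right_comm D.sqrtδ (D.gauss a R)] at this
    exact mul_left_cancel₀ h1 this
  refine ⟨D.gauss a R, ⟨R₁, h2⟩, fun φ hφ => ?_⟩
  obtain ⟨R₂, hR₂⟩ := D.integral_mul_ψ_sq ha hφ
  obtain ⟨S, -, hS⟩ := exists_le_norm p F (max R₁ R₂)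
  rw [hR₂ S ((le_max_right _ _).trans hS), h2 S ((le_max_left _ _).trans hS)]

theorem rpow_half_mul {x : ℝ} (hx : 0 < x) : x ^ (1 / 2 : ℝ) * x ^ (-(1 / 2) : ℝ) = 1 := by
  rw [← Real.rpow_add hx]; simp

theorem weilConst_spec_and {a : F} (ha : a ≠ 0) :
    (∀ φ : F → ℂ, IsSchwartz φ → ∫ x, φ x * D.ψ (a * x ^ 2) ∂(dF p F) =
      D.weilConst a * ((nabs p (2 * a) ^ (-(1 / 2) : ℝ) : ℝ) : ℂ) *
        ∫ x, D.fourier φ x * D.ψ (-(x ^ 2 / (4 * a))) ∂(dF p F)) ∧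
    ∃ R₀ : ℝ, ∀ R : F, R₀ ≤ ‖R‖ → D.weilConst a =
      ((nabs p (2 * a) ^ (1 / 2 : ℝ) : ℝ) : ℂ) * D.sqrtδ * D.gauss a R := by
  obtain ⟨G, ⟨R₀, hG⟩, h⟩ := D.weilConst_aux ha
  have hpos : 0 < nabs p (2 * a) := nabs_pos p (two_mul_ne_zero' p ha)
  have hc : ((nabs p (2 * a) ^ (1 / 2 : ℝ) : ℝ) : ℂ) *
      ((nabs p (2 * a) ^ (-(1 / 2) : ℝ) : ℝ) : ℂ) = 1 := by
    exact_mod_cast rpow_half_mul hpos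
  have hspec := Classical.epsilon_spec (p := fun α : ℂ => ∀ φ : F → ℂ, IsSchwartz φ →
    ∫ x, φ x * D.ψ (a * x ^ 2) ∂(dF p F) =
      α * ((nabs p (2 * a) ^ (-(1 / 2) : ℝ) : ℝ) : ℂ) *
        ∫ x, D.fourier φ x * D.ψ (-(x ^ 2 / (4 * a))) ∂(dF p F))
    ⟨((nabs p (2 * a) ^ (1 / 2 : ℝ) : ℝ) : ℂ) * D.sqrtδ * G, fun φ hφ => by
      rw [h φ hφ]
      linear_combination (-(D.sqrtδ * G *
        ∫ x, D.fourier φ x * D.ψ (-(x ^ 2 / (4 * a))) ∂(dF p F))) * hc⟩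
  change ∀ φ : F → ℂ, IsSchwartz φ → ∫ x, φ x * D.ψ (a * x ^ 2) ∂(dF p F) =
      D.weilConst a * ((nabs p (2 * a) ^ (-(1 / 2) : ℝ) : ℝ) : ℂ) *
        ∫ x, D.fourier φ x * D.ψ (-(x ^ 2 / (4 * a))) ∂(dF p F) at hspec
  refine ⟨hspec, R₀, fun R hR => ?_⟩
  obtain ⟨φ₁, hφ₁, hne⟩ := D.exists_integral_mul_ψ_sq_ne_zero a
  have h1 := h φ₁ hφ₁
  have h2 := hspec φ₁ hφ₁
  rw [hG R hR]
  have h3 : (∫ x, D.fourier φ₁ x * D.ψ (-(x ^ 2 / (4 * a))) ∂(dF p F)) ≠ 0 := by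
    intro h0; rw [h0, mul_zero] at h1; exact hne h1
  have h4 := mul_right_cancel₀ h3 (h1.symm.trans h2)
  linear_combination (-((nabs p (2 * a) ^ (1 / 2 : ℝ) : ℝ) : ℂ)) * h4 - D.weilConst a * hc

theorem weilConst_spec {a : F} (ha : a ≠ 0) {φ : F → ℂ} (hφ : IsSchwartz φ) :
    ∫ x, φ x * D.ψ (a * x ^ 2) ∂(dF p F) =
      D.weilConst a * ((nabs p (2 * a) ^ (-(1 / 2) : ℝ) : ℝ) : ℂ) *
        ∫ x, D.fourier φ x * D.ψ (-(x ^ 2 / (4 * a))) ∂(dF p F) :=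
  (D.weilConst_spec_and ha).1 φ hφ

/-- The Weil constant is the normalized limit of the truncated Gauss integrals. -/
theorem weilConst_eq_gauss {a : F} (ha : a ≠ 0) : ∃ R₀ : ℝ, ∀ R : F, R₀ ≤ ‖R‖ →
    D.weilConst a = ((nabs p (2 * a) ^ (1 / 2 : ℝ) : ℝ) : ℂ) * D.sqrtδ * D.gauss a R :=
  (D.weilConst_spec_and ha).2

theorem conj_gauss (a R : F) : conj (D.gauss a R) = D.gauss (-a) R := by
  rw [gauss, gauss, ← integral_conj]
  simp_rw [conj_ψ, neg_mul]

theorem weilConst_neg {a : F} (ha : a ≠ 0) : D.weilConst (-a) = conj (D.weilConst a) := by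
  obtain ⟨R₁, h1⟩ := D.weilConst_eq_gauss ha
  obtain ⟨R₂, h2⟩ := D.weilConst_eq_gauss (neg_ne_zero.2 ha)
  obtain ⟨R, -, hR⟩ := exists_le_norm p F (max R₁ R₂)
  rw [h1 R ((le_max_left _ _).trans hR), h2 R ((le_max_right _ _).trans hR), map_mul, map_mul,
    conj_gauss, mul_neg, nabs_neg, Complex.conj_ofReal, sqrtδ, Complex.conj_ofReal]

theorem weilConst_mul_sq {a c : F} (ha : a ≠ 0) (hc : c ≠ 0) :
    D.weilConst (a * c ^ 2) = D.weilConst a := by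
  obtain ⟨R₁, h1⟩ := D.weilConst_eq_gauss ha
  obtain ⟨R₂, h2⟩ := D.weilConst_eq_gauss (mul_ne_zero ha (pow_ne_zero 2 hc))
  obtain ⟨R, -, hR⟩ := exists_le_norm p F (max (R₁ / ‖c‖) R₂)
  have hc0 : 0 < ‖c‖ := norm_pos_iff.2 hc
  have hR1 : R₁ ≤ ‖R * c‖ := by
    rw [norm_mul, ← div_le_iff₀ hc0]; exact (le_max_left _ _).trans hR
  rw [h1 (R * c) hR1, h2 R ((le_max_right _ _).trans hR)]
  have h3 := setIntegral_comp_mul_left p hc (Metric.closedBall 0 ‖R * c‖)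
    (fun x => D.ψ (a * x ^ 2))
  rw [preimage_mul_closedBall hc, mul_div_cancel_right₀ _ hc] at h3
  have h4 : D.gauss (a * c ^ 2) R = ((nabs p c)⁻¹ : ℝ) * D.gauss a (R * c) := by
    rw [gauss, gauss, ← h3]
    congr 1; funext x; congr 1; ring
  rw [h4]
  have hpc := nabs_pos p hc
  have h5 : nabs p (2 * (a * c ^ 2)) ^ (1 / 2 : ℝ) =
      nabs p (2 * a) ^ (1 / 2 : ℝ) * nabs p c := by
    rw [← mul_assoc, nabs_mul, nabs_pow, Real.mul_rpow (nabs_nonneg p _) (by positivity),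
      ← Real.sqrt_eq_rpow (nabs p c ^ 2), Real.sqrt_sq hpc.le]
  rw [h5]
  push_cast
  have : (nabs p c : ℂ) ≠ 0 := by exact_mod_cast hpc.ne'
  field_simp

/-- Applying the defining identity twice, to `φ` and to its Fourier transform, shows that the Weil
constant has absolute value `1`. -/
theorem weilConst_mul_conj {a : F} (ha : a ≠ 0) : D.weilConst a * conj (D.weilConst a) = 1 := by
  have := charZero_of_padic p F
  obtain ⟨φ, hφ, hne⟩ := D.exists_integral_mul_ψ_sq_ne_zero a
  have hb : -(1 / (4 * a)) ≠ 0 := by simp [ha]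
  have h1 := D.weilConst_spec ha hφ
  have h2 := D.weilConst_spec hb (D.isSchwartz_fourier hφ)
  have h3 : ∀ x : F, -(x ^ 2 / (4 * a)) = -(1 / (4 * a)) * x ^ 2 := by intro x; ring
  have h4 : ∀ x : F, -(x ^ 2 / (4 * -(1 / (4 * a)))) = a * x ^ 2 := by
    intro x; field_simp
  simp_rw [h3] at h1
  simp_rw [h4, D.fourier_fourier hφ] at h2
  have h5 : ∫ x, φ (-x) * D.ψ (a * x ^ 2) ∂(dF p F) = ∫ x, φ x * D.ψ (a * x ^ 2) ∂(dF p F) := by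
    rw [← integral_neg_eq_self (fun x => φ x * D.ψ (a * x ^ 2))]
    simp
  have h6 : D.weilConst (-(1 / (4 * a))) = conj (D.weilConst a) := by
    rw [← D.weilConst_neg ha, ← D.weilConst_mul_sq (neg_ne_zero.2 ha) (c := (2 * a)⁻¹) (by simp [ha])]
    congr 1; field_simp; ring
  rw [h5, h6] at h2
  rw [h2] at h1
  have hpos : 0 < nabs p (2 * a) := nabs_pos p (two_mul_ne_zero' p ha)
  have h7 : nabs p (2 * -(1 / (4 * a))) = (nabs p (2 * a))⁻¹ := by
    rw [← nabs_inv, ← nabs_neg]; congr 1; field_simp; ring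
  have h8 : ((nabs p (2 * a) ^ (-(1 / 2) : ℝ) : ℝ) : ℂ) *
      ((nabs p (2 * -(1 / (4 * a))) ^ (-(1 / 2) : ℝ) : ℝ) : ℂ) = 1 := by
    rw [h7, Real.inv_rpow hpos.le, ← Real.rpow_neg hpos.le, neg_neg, mul_comm]
    exact_mod_cast rpow_half_mul hpos
  have h9 : (D.weilConst a * conj (D.weilConst a) - 1) *
      ∫ x, φ x * D.ψ (a * x ^ 2) ∂(dF p F) = 0 := by
    linear_combination (-1 : ℂ) * h1 - (D.weilConst a * conj (D.weilConst a) *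
      ∫ x, φ x * D.ψ (a * x ^ 2) ∂(dF p F)) * h8
  exact sub_eq_zero.1 ((mul_eq_zero.1 h9).resolve_right hne)

theorem norm_weilConst {a : F} (ha : a ≠ 0) : ‖D.weilConst a‖ = 1 := by
  have h := D.weilConst_mul_conj ha
  rw [Complex.mul_conj, Complex.normSq_eq_norm_sq] at h
  have h' : ‖D.weilConst a‖ ^ 2 = 1 := by exact_mod_cast h
  exact (pow_eq_one_iff_of_nonneg (norm_nonneg _) two_ne_zero).1 h'

theorem weilConst_ne_zero {a : F} (ha : a ≠ 0) : D.weilConst a ≠ 0 := by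
  rw [← norm_ne_zero_iff, D.norm_weilConst ha]; exact one_ne_zero

end LocalDatum

/-! ### Anisotropic quadratic forms -/

section Isotropy

/-- Hensel's lemma for `ε S² - S + 1`. -/
theorem exists_eq_one_add_mul_sq {F : Type*} [NormedField F] [IsUltrametricDist F]
    [ProperSpace F] {ε : F} (hε : ‖ε‖ < 1) : ∃ S : F, S = 1 + ε * S ^ 2 := by
  have hcomp : IsComplete (Metric.closedBall (0 : F) 1) := Metric.isClosed_closedBall.isComplete
  have : CompleteSpace (Metric.closedBall (0 : F) 1) := hcomp.completeSpace_coe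
  have : Nonempty (Metric.closedBall (0 : F) 1) := ⟨⟨0, by simp⟩⟩
  let f : Metric.closedBall (0 : F) 1 → Metric.closedBall (0 : F) 1 := fun S =>
    ⟨1 + ε * (S : F) ^ 2, by
      have hS := mem_closedBall_zero_iff.1 S.2
      refine mem_closedBall_zero_iff.2 (norm_add_le_of_le' (by simp) ?_)
      rw [norm_mul, norm_pow]
      exact mul_le_one₀ hε.le (by positivity) (pow_le_one₀ (norm_nonneg _) hS)⟩
  have hf : ContractingWith ‖ε‖₊ f := by
    refine ⟨hε, LipschitzWith.of_dist_le_mul fun S T => ?_⟩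
    have hS := mem_closedBall_zero_iff.1 S.2
    have hT := mem_closedBall_zero_iff.1 T.2
    rw [Subtype.dist_eq, Subtype.dist_eq, dist_eq_norm, dist_eq_norm]
    have : (f S : F) - f T = ε * (((S : F) - T) * (S + T)) := by
      simp only [f]; ring
    rw [this, norm_mul, norm_mul, coe_nnnorm]
    have h2 : ‖(S : F) + T‖ ≤ 1 := norm_add_le_of_le' hS hT
    exact mul_le_mul_of_nonneg_left (mul_le_of_le_one_right (norm_nonneg _) h2) (norm_nonneg _)
  refine ⟨(hf.fixedPoint f : Metric.closedBall (0 : F) 1), ?_⟩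
  have := congrArg Subtype.val hf.fixedPoint_isFixedPt
  exact this.symm

/-- The local square theorem. -/
theorem isSquare_one_sub_four_mul {F : Type*} [NormedField F] [IsUltrametricDist F]
    [ProperSpace F] {ε : F} (hε : ‖ε‖ < 1) : IsSquare (1 - 4 * ε) := by
  obtain ⟨S, hS⟩ := exists_eq_one_add_mul_sq hε
  exact ⟨1 - 2 * ε * S, by linear_combination (4 * ε) * hS⟩

variable {F : Type*} [NormedField F] [IsUltrametricDist F] [ProperSpace F]
  {ι : Type*} [Fintype ι]

/-- The diagonal quadratic form `∑ cᵢ vᵢ²`. -/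
def diagForm (c v : ι → F) : F := ∑ i, c i * v i ^ 2

/-- The polar form of `diagForm c`. -/
def diagPolar (c v w : ι → F) : F := ∑ i, 2 * c i * v i * w i

theorem diagForm_add (c v w : ι → F) :
    diagForm c (v + w) = diagForm c v + diagPolar c v w + diagForm c w := by
  simp only [diagForm, diagPolar, ← Finset.sum_add_distrib, Pi.add_apply]
  exact Finset.sum_congr rfl fun i _ => by ring

theorem diagForm_smul (c v : ι → F) (t : F) : diagForm c (t • v) = t ^ 2 * diagForm c v := by
  simp only [diagForm, Finset.mul_sum, Pi.smul_apply, smul_eq_mul]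
  exact Finset.sum_congr rfl fun i _ => by ring

theorem diagPolar_smul_left (c v w : ι → F) (t : F) :
    diagPolar c (t • v) w = t * diagPolar c v w := by
  simp only [diagPolar, Finset.mul_sum, Pi.smul_apply, smul_eq_mul]
  exact Finset.sum_congr rfl fun i _ => by ring

theorem diagPolar_smul_right (c v w : ι → F) (t : F) :
    diagPolar c v (t • w) = t * diagPolar c v w := by
  simp only [diagPolar, Finset.mul_sum, Pi.smul_apply, smul_eq_mul]
  exact Finset.sum_congr rfl fun i _ => by ring

theorem diagPolar_add_left (c u v w : ι → F) :
    diagPolar c (u + v) w = diagPolar c u w + diagPolar c v w := by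
  simp only [diagPolar, ← Finset.sum_add_distrib, Pi.add_apply]
  exact Finset.sum_congr rfl fun i _ => by ring

theorem diagPolar_self (c v : ι → F) : diagPolar c v v = 2 * diagForm c v := by
  simp only [diagPolar, diagForm, Finset.mul_sum]
  exact Finset.sum_congr rfl fun i _ => by ring

theorem diagForm_smul_coeff (c v : ι → F) (t : F) : diagForm (t • c) v = t * diagForm c v := by
  simp only [diagForm, Finset.mul_sum, Pi.smul_apply, smul_eq_mul, mul_assoc]

theorem continuous_diagForm (c : ι → F) : Continuous (diagForm c) := by
  unfold diagForm; fun_prop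

/-- An anisotropic form satisfies a Cauchy–Schwarz inequality: otherwise the binary form spanned
by the two vectors would have a zero by Hensel's lemma. -/
theorem norm_diagPolar_sq_le (p : ℕ) [Fact p.Prime] [NormedAlgebra ℚ_[p] F] {c : ι → F}
    (hc : ∀ v, diagForm c v = 0 → v = 0) (v w : ι → F) :
    ‖diagPolar c v w‖ ^ 2 ≤ ‖diagForm c v‖ * ‖diagForm c w‖ := by
  by_contra! hlt
  have hB : 0 < ‖diagPolar c v w‖ ^ 2 := lt_of_le_of_lt (by positivity) hlt
  have hB0 : diagPolar c v w ≠ 0 := by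
    intro h0; rw [h0, norm_zero] at hB; norm_num at hB
  set B := diagPolar c v w
  set ε := diagForm c v * diagForm c w / B ^ 2 with hεdef
  have hε : ‖ε‖ < 1 := by
    rw [hεdef, norm_div, norm_mul, norm_pow, div_lt_one hB]; exact hlt
  obtain ⟨S, hS⟩ := exists_eq_one_add_mul_sq hε
  set T := -(diagForm c v / B) * S with hT
  have h1 : diagForm c (v + T • w) = 0 := by
    rw [diagForm_add, diagPolar_smul_right, diagForm_smul]
    have h2 : ε * B ^ 2 = diagForm c v * diagForm c w := by
      rw [hεdef]; field_simp
    have h3 : T * B = - diagForm c v * S := by rw [hT]; field_simp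
    have h4 : T ^ 2 * diagForm c w * B ^ 2 = diagForm c v * ε * S ^ 2 * B ^ 2 := by
      calc T ^ 2 * diagForm c w * B ^ 2 = (T * B) ^ 2 * diagForm c w := by ring
        _ = diagForm c v * (diagForm c v * diagForm c w) * S ^ 2 := by rw [h3]; ring
        _ = _ := by rw [← h2]; ring
    have h5 := mul_right_cancel₀ (pow_ne_zero 2 hB0) h4
    change diagForm c v + T * B + T ^ 2 * diagForm c w = 0
    rw [h3, h5]
    linear_combination (-diagForm c v) * hS
  have h6 := hc _ h1
  have h7 : v = -T • w := by rw [neg_smul]; exact eq_neg_of_add_eq_zero_left h6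
  have h8 : diagForm c v = T ^ 2 * diagForm c w := by rw [h7, diagForm_smul]; ring
  have h9 : B = -T * (2 * diagForm c w) := by
    change diagPolar c v w = _
    rw [h7, diagPolar_smul_left, diagPolar_self]
  have h10 : B ^ 2 = 4 * (diagForm c v * diagForm c w) := by rw [h8, h9]; ring
  rw [← norm_pow, h10, norm_mul, norm_mul] at hlt
  have h11 : ‖(4 : F)‖ ≤ 1 := by
    exact_mod_cast IsUltrametricDist.norm_natCast_le_one F 4
  have h12 : ‖(4 : F)‖ * (‖diagForm c v‖ * ‖diagForm c w‖) ≤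
      1 * (‖diagForm c v‖ * ‖diagForm c w‖) := by gcongr
  linarith

/-- The norm of the value of an anisotropic form is ultrametric. -/
theorem norm_diagForm_add_le (p : ℕ) [Fact p.Prime] [NormedAlgebra ℚ_[p] F] {c : ι → F}
    (hc : ∀ v, diagForm c v = 0 → v = 0) (v w : ι → F) :
    ‖diagForm c (v + w)‖ ≤ max ‖diagForm c v‖ ‖diagForm c w‖ := by
  set m := max ‖diagForm c v‖ ‖diagForm c w‖ with hm
  have h1 : ‖diagForm c v‖ ≤ m := le_max_left _ _
  have h2 : ‖diagForm c w‖ ≤ m := le_max_right _ _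
  have h3 : ‖diagPolar c v w‖ ≤ m := by
    have := norm_diagPolar_sq_le p hc v w
    refine le_of_sq_le_sq ?_ ((norm_nonneg _).trans h1)
    refine this.trans ?_
    rw [pow_two]
    gcongr
  rw [diagForm_add]
  exact norm_add_le_of_le' (norm_add_le_of_le' h1 h3) h2

/-- The values of an anisotropic form are bounded below by the square of the norm. -/
theorem exists_le_norm_diagForm {c : ι → F} (hc : ∀ v, diagForm c v = 0 → v = 0) :
    ∃ C : ℝ, 0 < C ∧ ∀ v, C * ‖v‖ ^ 2 ≤ ‖diagForm c v‖ := by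
  by_cases hne : (Metric.sphere (0 : ι → F) 1).Nonempty
  · obtain ⟨w, hw, hmin⟩ := (isCompact_sphere (0 : ι → F) 1).exists_isMinOn hne
      (continuous_norm.comp (continuous_diagForm c)).continuousOn
    have hw0 : diagForm c w ≠ 0 := by
      intro h0
      have hw1 : ‖w‖ = 1 := by simpa using hw
      rw [hc w h0, norm_zero] at hw1
      exact zero_ne_one hw1
    refine ⟨‖diagForm c w‖, norm_pos_iff.2 hw0, fun v => ?_⟩
    by_cases hv : v = 0
    · simp [hv, diagForm]
    · obtain ⟨i, hi⟩ : ∃ i, ‖v i‖ = ‖v‖ := by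
        have : Nonempty ι := by
          by_contra h
          rw [not_nonempty_iff] at h
          exact hv (Subsingleton.elim _ _)
        by_contra! hlt
        exact lt_irrefl _ ((pi_norm_lt_iff (norm_pos_iff.2 hv)).2 fun i =>
          lt_of_le_of_ne (norm_le_pi_norm v i) (hlt i))
      have hvi : v i ≠ 0 := by rw [← norm_ne_zero_iff, hi]; exact norm_ne_zero_iff.2 hv
      have h1 := hmin (a := (v i)⁻¹ • v) (by
        rw [mem_sphere_zero_iff_norm, norm_smul, norm_inv, hi,
          inv_mul_cancel₀ (norm_ne_zero_iff.2 hv)])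
      simp only [Set.mem_ofPred_eq, Function.comp, diagForm_smul, norm_mul, norm_pow, norm_inv,
        hi] at h1
      have h2 : 0 < ‖v‖ := norm_pos_iff.2 hv
      rwa [inv_pow, ← div_eq_inv_mul, le_div_iff₀ (by positivity)] at h1
  · refine ⟨1, one_pos, fun v => ?_⟩
    have hv : v = 0 := by
      by_contra hv
      have : Nontrivial (ι → F) := ⟨v, 0, hv⟩
      have : Nonempty ι := by
        by_contra h
        rw [not_nonempty_iff] at h
        exact hv (Subsingleton.elim _ _)
      exact hne ⟨fun _ => 1, by rw [mem_sphere_zero_iff_norm, pi_norm_const, norm_one]⟩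
    simp [hv]

/-- A ternary quadratic form over the finite residue field has a nontrivial zero. -/
theorem exists_ternary_zero (p : ℕ) [Fact p.Prime] [NormedAlgebra ℚ_[p] F] {c : ι → F}
    (hc : ∀ v, diagForm c v = 0 → v = 0) (v : Fin 3 → ι → F) (hv : ∀ i, ‖diagForm c (v i)‖ ≤ 1) :
    ∃ x : Fin 3 → F, (∀ i, ‖x i‖ ≤ 1) ∧ (∃ i, ‖x i‖ = 1) ∧
      ‖diagForm c (x 0 • v 0 + x 1 • v 1 + x 2 • v 2)‖ < 1 := by
  classical
  have := finite_residueField F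
  have := Fintype.ofFinite (IsLocalRing.ResidueField (integerRing F))
  set k := IsLocalRing.ResidueField (integerRing F)
  have hB : ∀ i j, ‖diagPolar c (v i) (v j)‖ ≤ 1 := by
    intro i j
    have h1 := norm_diagPolar_sq_le p hc (v i) (v j)
    have h2 := mul_le_one₀ (hv i) (norm_nonneg _) (hv j)
    exact (pow_le_one_iff_of_nonneg (norm_nonneg _) two_ne_zero).1 (h1.trans h2)
  let Q : Fin 3 → integerRing F := fun i => ⟨_, mem_integerRing.2 (hv i)⟩
  let B : Fin 3 → Fin 3 → integerRing F := fun i j => ⟨_, mem_integerRing.2 (hB i j)⟩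
  let r := IsLocalRing.residue (integerRing F)
  let f : MvPolynomial (Fin 3) k :=
    .C (r (Q 0)) * (.X 0 * .X 0) + .C (r (Q 1)) * (.X 1 * .X 1) + .C (r (Q 2)) * (.X 2 * .X 2) +
    .C (r (B 0 1)) * (.X 0 * .X 1) + .C (r (B 0 2)) * (.X 0 * .X 2) +
    .C (r (B 1 2)) * (.X 1 * .X 2)
  have hmon : ∀ (a : k) (i j : Fin 3),
      (MvPolynomial.C a * (MvPolynomial.X i * MvPolynomial.X j)).IsHomogeneous 2 :=
    fun a i j => ((MvPolynomial.isHomogeneous_X k i).mul (MvPolynomial.isHomogeneous_X k j)).C_mul a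
  have hf : f.IsHomogeneous 2 :=
    (((((hmon _ _ _).add (hmon _ _ _)).add (hmon _ _ _)).add (hmon _ _ _)).add
      (hmon _ _ _)).add (hmon _ _ _)
  obtain ⟨ℓ, hℓ⟩ := CharP.exists k
  have hℓp : ℓ.Prime := (CharP.char_is_prime_or_zero k ℓ).resolve_right (CharP.char_ne_zero_of_finite k ℓ)
  have hdvd := char_dvd_card_solutions ℓ (f := f)
    (hf.totalDegree_le.trans_lt (by simp))
  have h0 : MvPolynomial.eval (0 : Fin 3 → k) f = 0 := by simp [f]
  have hcard : 1 < Fintype.card {x // MvPolynomial.eval x f = 0} := by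
    have h1 : 0 < Fintype.card {x // MvPolynomial.eval x f = 0} :=
      Fintype.card_pos_iff.2 ⟨⟨0, h0⟩⟩
    exact hℓp.one_lt.trans_le (Nat.le_of_dvd h1 hdvd)
  obtain ⟨⟨y, hy⟩, hne⟩ := Fintype.exists_ne_of_one_lt_card hcard ⟨0, h0⟩
  have hy0 : y ≠ 0 := fun h => hne (Subtype.ext h)
  obtain ⟨i, hi⟩ := Function.ne_iff.1 hy0
  refine ⟨fun i => (residueRep (y i) : F), fun i => norm_residueRep_le _, ⟨i, ?_⟩, ?_⟩
  · refine le_antisymm (norm_residueRep_le _) (not_lt.1 fun h => hi ?_)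
    rw [← residue_residueRep (y i)]
    exact residue_eq_zero_iff_norm.2 h
  · set z : Fin 3 → integerRing F := fun i => residueRep (y i)
    have h1 : diagForm c ((z 0 : F) • v 0 + (z 1 : F) • v 1 + (z 2 : F) • v 2) =
        ((Q 0 * (z 0 * z 0) + Q 1 * (z 1 * z 1) + Q 2 * (z 2 * z 2) + B 0 1 * (z 0 * z 1) +
          B 0 2 * (z 0 * z 2) + B 1 2 * (z 1 * z 2) : integerRing F) : F) := by
      simp only [diagForm_add, diagPolar_add_left, diagPolar_smul_left, diagPolar_smul_right,
        diagForm_smul]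
      change _ = diagForm c (v 0) * ((z 0 : F) * z 0) + diagForm c (v 1) * ((z 1 : F) * z 1) +
        diagForm c (v 2) * ((z 2 : F) * z 2) + diagPolar c (v 0) (v 1) * ((z 0 : F) * z 1) +
        diagPolar c (v 0) (v 2) * ((z 0 : F) * z 2) + diagPolar c (v 1) (v 2) * ((z 1 : F) * z 2)
      ring
    change ‖diagForm c ((z 0 : F) • v 0 + (z 1 : F) • v 1 + (z 2 : F) • v 2)‖ < 1
    rw [h1, ← residue_eq_zero_iff_norm]
    simp only [map_add, map_mul, z, residue_residueRep]
    simpa [f] using hy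

/-- The vectors of norm at most `1` of an anisotropic form are spanned by two of them, modulo
those of norm less than `1`. -/
theorem exists_two_generators (p : ℕ) [Fact p.Prime] [NormedAlgebra ℚ_[p] F] {c : ι → F}
    (hc : ∀ v, diagForm c v = 0 → v = 0) :
    ∃ v₁ v₂ : ι → F, ‖diagForm c v₁‖ ≤ 1 ∧ ‖diagForm c v₂‖ ≤ 1 ∧
      ∀ v, ‖diagForm c v‖ ≤ 1 → ∃ x₁ x₂ : F, ‖x₁‖ ≤ 1 ∧ ‖x₂‖ ≤ 1 ∧
        ‖diagForm c (v - (x₁ • v₁ + x₂ • v₂))‖ < 1 := by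
  have hadd : ∀ v w, ‖diagForm c v‖ < 1 → ‖diagForm c w‖ < 1 → ‖diagForm c (v + w)‖ < 1 :=
    fun v w hv hw => (norm_diagForm_add_le p hc v w).trans_lt (max_lt hv hw)
  have hsmul : ∀ (t : F) v, ‖t‖ ≤ 1 → ‖diagForm c v‖ < 1 → ‖diagForm c (t • v)‖ < 1 := by
    intro t v ht hv
    rw [diagForm_smul, norm_mul, norm_pow]
    exact (mul_le_of_le_one_left (norm_nonneg _) (pow_le_one₀ (norm_nonneg _) ht)).trans_lt hv
  have hsmul' : ∀ (t : F) v, ‖t‖ < 1 → ‖diagForm c v‖ ≤ 1 → ‖diagForm c (t • v)‖ < 1 := by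
    intro t v ht hv
    rw [diagForm_smul, norm_mul, norm_pow]
    exact (mul_le_of_le_one_right (by positivity) hv).trans_lt
      (pow_lt_one₀ (norm_nonneg _) ht two_ne_zero)
  have h00 : diagForm c 0 = 0 := by simp [diagForm]
  by_cases h0 : ∀ v, ‖diagForm c v‖ ≤ 1 → ‖diagForm c v‖ < 1
  · exact ⟨0, 0, by simp [h00], by simp [h00],
      fun v hv => ⟨0, 0, by simp, by simp, by simpa using h0 v hv⟩⟩
  push Not at h0
  obtain ⟨v₁, hv₁, hv₁'⟩ := h0
  by_cases h1 : ∀ v, ‖diagForm c v‖ ≤ 1 → ∃ x₁ : F, ‖x₁‖ ≤ 1 ∧ ‖diagForm c (v - x₁ • v₁)‖ < 1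
  · refine ⟨v₁, 0, hv₁, by simp [h00], fun v hv => ?_⟩
    obtain ⟨x₁, hx₁, h⟩ := h1 v hv
    exact ⟨x₁, 0, hx₁, by simp, by simpa using h⟩
  push Not at h1
  obtain ⟨v₂, hv₂, hv₂'⟩ := h1
  refine ⟨v₁, v₂, hv₁, hv₂, fun v hv => ?_⟩
  obtain ⟨x, hx, hi, hlt⟩ := exists_ternary_zero p hc ![v₁, v₂, v] (fun i => by
    fin_cases i <;> assumption)
  simp only [Matrix.cons_val_zero, Matrix.cons_val_one, Matrix.cons_val] at hlt
  have hcase : ∀ {t : F}, ‖t‖ ≤ 1 → ‖t‖ ≠ 1 → ‖t‖ < 1 := fun h h' => lt_of_le_of_ne h h'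
  have hinv : ∀ {t : F}, ‖t‖ = 1 → t ≠ 0 ∧ ‖t⁻¹‖ ≤ 1 := fun {t} h =>
    ⟨by rintro rfl; simp at h, by rw [norm_inv, h, inv_one]⟩
  by_cases h2 : ‖x 2‖ = 1
  · obtain ⟨hne, hle⟩ := hinv h2
    refine ⟨-((x 2)⁻¹ * x 0), -((x 2)⁻¹ * x 1), ?_, ?_, ?_⟩
    · rw [norm_neg, norm_mul]; exact mul_le_one₀ hle (norm_nonneg _) (hx 0)
    · rw [norm_neg, norm_mul]; exact mul_le_one₀ hle (norm_nonneg _) (hx 1)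
    · convert hsmul (x 2)⁻¹ _ hle hlt using 3
      simp only [smul_add, smul_smul, inv_mul_cancel₀ hne, one_smul, neg_smul]
      abel
  · exfalso
    have h3 : ‖diagForm c (x 0 • v₁ + x 1 • v₂)‖ < 1 := by
      have h4 := hadd _ _ hlt (hsmul' (-x 2) v (by rw [norm_neg]; exact hcase (hx 2) h2) hv)
      convert h4 using 3
      rw [neg_smul]; abel
    by_cases h4 : ‖x 1‖ = 1
    · obtain ⟨hne, hle⟩ := hinv h4
      refine absurd (hsmul (x 1)⁻¹ _ hle h3) (not_lt.2 ?_)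
      have := hv₂' (-((x 1)⁻¹ * x 0))
        (by rw [norm_neg, norm_mul]; exact mul_le_one₀ hle (norm_nonneg _) (hx 0))
      convert this using 3
      simp only [smul_add, smul_smul, inv_mul_cancel₀ hne, one_smul, neg_smul]
      abel
    · have h5 : ‖diagForm c (x 0 • v₁)‖ < 1 := by
        have h6 := hadd _ _ h3 (hsmul' (-x 1) v₂ (by rw [norm_neg]; exact hcase (hx 1) h4) hv₂)
        convert h6 using 3
        rw [neg_smul]; abel
      have h7 : ‖x 0‖ = 1 := by
        obtain ⟨i, hi⟩ := hi
        fin_cases i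
        · exact hi
        · exact absurd hi h4
        · exact absurd hi h2
      obtain ⟨hne, hle⟩ := hinv h7
      have h8 := hsmul (x 0)⁻¹ _ hle h5
      rw [smul_smul, inv_mul_cancel₀ hne, one_smul] at h8
      exact absurd h8 (not_lt.2 hv₁')

end Isotropy

/-! ### Isotropy of quadratic forms in five variables -/

section Volume

variable (p : ℕ) [Fact p.Prime] {F : Type*} [NormedField F] [NormedAlgebra ℚ_[p] F]
  [IsUltrametricDist F] [FiniteDimensional ℚ_[p] F] [ProperSpace F]
  [MeasurableSpace F] [BorelSpace F] {ι : Type*} [Fintype ι]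

variable (F ι) in
/-- The product of copies of `dx` on `F^ι`. -/
def dFpi : Measure (ι → F) := Measure.pi fun _ => dF p F

instance : (dFpi p F ι).IsAddHaarMeasure := by unfold dFpi; infer_instance

instance : (dFpi p F ι).Regular := by unfold dFpi; infer_instance

theorem distribHaarChar_pi (u : Fˣ) :
    (distribHaarChar (ι → F) u : ℝ) = nabs p (u : F) ^ Fintype.card ι := by
  have hball : ∀ r : ℝ, 0 ≤ r → dFpi p F ι (Metric.closedBall 0 r) =
      (dF p F (Metric.closedBall 0 r)) ^ Fintype.card ι := by
    intro r hr
    rw [closedBall_pi _ hr, dFpi, Measure.pi_pi]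
    simp
  have hu : dF p F (Metric.closedBall 0 ‖(u : F)‖) = distribHaarChar F u := by
    have := smul_closedBall_units u 1
    rw [mul_one] at this
    rw [← this, ← distribHaarChar_mul, dF_closedBall_one, mul_one]
  have h1 : dFpi p F ι (Metric.closedBall 0 1) = 1 := by
    rw [hball 1 zero_le_one, dF_closedBall_one, one_pow]
  have h := distribHaarChar_eq_of_measure_smul_eq_mul (A := ι → F) (μ := dFpi p F ι)
    (s := Metric.closedBall 0 1) (by rw [h1]; exact one_ne_zero) (by rw [h1]; exact ENNReal.one_ne_top)
    (g := u) (r := distribHaarChar F u ^ Fintype.card ι) (by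
      have h2 : u • Metric.closedBall (0 : ι → F) 1 = Metric.closedBall 0 ‖(u : F)‖ := by
        ext x
        rw [Set.mem_smul_set_iff_inv_smul_mem, mem_closedBall_zero_iff, mem_closedBall_zero_iff,
          Units.smul_def, norm_smul, Units.val_inv_eq_inv_val, norm_inv,
          inv_mul_le_iff₀ (norm_pos_iff.2 u.ne_zero), mul_one]
      rw [h2, h1, mul_one, hball _ (norm_nonneg _), hu]
      push_cast
      rfl)
  rw [h]
  push_cast
  rw [distribHaarChar_eq_nabs p]

theorem isCompact_diagForm_le {c : ι → F} (hc : ∀ v, diagForm c v = 0 → v = 0) (r : ℝ) :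
    IsCompact {v | ‖diagForm c v‖ ≤ r} := by
  obtain ⟨C, hC, h⟩ := exists_le_norm_diagForm hc
  refine (isCompact_closedBall (0 : ι → F) (r / C + 1)).of_isClosed_subset
    (isClosed_le (continuous_norm.comp (continuous_diagForm c)) continuous_const) fun v hv => ?_
  have h1 : ‖v‖ ^ 2 ≤ r / C := by
    rw [le_div_iff₀' hC]; exact (h v).trans hv
  rw [mem_closedBall_zero_iff]
  nlinarith [norm_nonneg v, sq_nonneg (‖v‖ - 1)]

theorem dFpi_diagForm_le_pos (c : ι → F) {r : ℝ} (hr : 0 < r) :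
    0 < dFpi p F ι {v | ‖diagForm c v‖ ≤ r} := by
  refine Measure.measure_pos_of_nonempty_interior _ ⟨0, mem_interior_iff_mem_nhds.2 ?_⟩
  have h : ContinuousAt (fun v => ‖diagForm c v‖) 0 :=
    (continuous_norm.comp (continuous_diagForm c)).continuousAt
  have h0 : ‖diagForm c 0‖ < r := by simpa [diagForm] using hr
  filter_upwards [h.eventually (gt_mem_nhds h0)] with v hv using le_of_lt hv

theorem dFpi_diagForm_mul_sq (c : ι → F) {t : F} (ht : t ≠ 0) (r : ℝ) :
    dFpi p F ι {v | ‖diagForm c v‖ ≤ ‖t‖ ^ 2 * r} =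
      ENNReal.ofReal (nabs p t ^ Fintype.card ι) * dFpi p F ι {v | ‖diagForm c v‖ ≤ r} := by
  set u := Units.mk0 t ht
  have h : {v | ‖diagForm c v‖ ≤ ‖t‖ ^ 2 * r} = u • {v | ‖diagForm c v‖ ≤ r} := by
    ext v
    rw [Set.mem_smul_set_iff_inv_smul_mem, Set.mem_ofPred_eq, Set.mem_ofPred_eq, Units.smul_def,
      diagForm_smul, Units.val_inv_eq_inv_val, norm_mul, norm_pow, norm_inv, inv_pow,
      inv_mul_le_iff₀ (by have := norm_pos_iff.2 ht; positivity)]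
    rfl
  rw [h, ← distribHaarChar_mul, show nabs p t = nabs p (u : F) from rfl, ← distribHaarChar_pi,
    ENNReal.ofReal_coe_nnreal]

/-- The vectors of norm at most `1` have index at most `q²` over those of norm less than `1`. -/
theorem dFpi_diagForm_le_one {c : ι → F} (hc : ∀ v, diagForm c v = 0 → v = 0) :
    dFpi p F ι {v | ‖diagForm c v‖ ≤ 1} ≤
      (resCard F : ENNReal) ^ 2 * dFpi p F ι {v | ‖diagForm c v‖ < 1} := by
  have := finite_residueField F
  have := Fintype.ofFinite (IsLocalRing.ResidueField (integerRing F))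
  obtain ⟨v₁, v₂, hv₁, hv₂, h⟩ := exists_two_generators p hc
  set k := IsLocalRing.ResidueField (integerRing F)
  set A : Set (ι → F) := {v | ‖diagForm c v‖ < 1}
  have hadd : ∀ v w, ‖diagForm c v‖ < 1 → ‖diagForm c w‖ < 1 → ‖diagForm c (v + w)‖ < 1 :=
    fun v w hv hw => (norm_diagForm_add_le p hc v w).trans_lt (max_lt hv hw)
  have hsmul' : ∀ (t : F) v, ‖t‖ < 1 → ‖diagForm c v‖ ≤ 1 → ‖diagForm c (t • v)‖ < 1 := by
    intro t v ht hv
    rw [diagForm_smul, norm_mul, norm_pow]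
    exact (mul_le_of_le_one_right (by positivity) hv).trans_lt
      (pow_lt_one₀ (norm_nonneg _) ht two_ne_zero)
  have hsub : {v | ‖diagForm c v‖ ≤ 1} ⊆ ⋃ y : k × k,
      (fun v => -((residueRep y.1 : F) • v₁ + (residueRep y.2 : F) • v₂) + v) ⁻¹' A := by
    intro v hv
    obtain ⟨x₁, x₂, hx₁, hx₂, hlt⟩ := h v hv
    obtain ⟨y₁, hy₁⟩ := exists_residueRep hx₁
    obtain ⟨y₂, hy₂⟩ := exists_residueRep hx₂
    refine Set.mem_iUnion.2 ⟨(y₁, y₂), ?_⟩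
    have h1 := hadd _ _ hlt (hadd _ _ (hsmul' _ _ hy₁ hv₁) (hsmul' _ _ hy₂ hv₂))
    change ‖diagForm c _‖ < 1
    convert h1 using 3
    simp only [sub_smul]
    abel
  have hq : (resCard F : ENNReal) = Fintype.card k := by
    rw [resCard, Nat.card_eq_fintype_card]
  calc dFpi p F ι {v | ‖diagForm c v‖ ≤ 1} ≤ _ := measure_mono hsub
    _ ≤ ∑' y : k × k, dFpi p F ι
      ((fun v => -((residueRep y.1 : F) • v₁ + (residueRep y.2 : F) • v₂) + v) ⁻¹' A) :=
        measure_iUnion_le _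
    _ = _ := by
      rw [tsum_fintype]
      simp only [measure_preimage_add, Finset.sum_const, nsmul_eq_mul, Finset.card_univ,
        Fintype.card_prod, hq]
      push_cast
      ring

end Volume

/-- A diagonal quadratic form in at least five variables is isotropic: the vectors of norm at most
`1` of an anisotropic form have index at most `q²` over those of norm less than `1`, hence index at
most `q⁴` over their multiples by a uniformizer. -/
theorem exists_diagForm_eq_zero (p : ℕ) [Fact p.Prime] {F : Type*} [NormedField F]
    [NormedAlgebra ℚ_[p] F] [IsUltrametricDist F] [FiniteDimensional ℚ_[p] F] [ProperSpace F]
    {ι : Type*} [Fintype ι] (hι : 5 ≤ Fintype.card ι) (c : ι → F) :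
    ∃ v, v ≠ 0 ∧ diagForm c v = 0 := by
  borelize F
  by_contra! hcon
  have hc : ∀ v, diagForm c v = 0 → v = 0 := fun v hv => by
    by_contra h0; exact hcon v h0 hv
  obtain ⟨ϖ, h0, h1, h2⟩ := exists_uniformizer p F
  have hpos : 0 < ‖ϖ‖ := norm_pos_iff.2 h0
  have hlt : ∀ x : F, ‖x‖ < 1 ↔ ‖x‖ ≤ ‖ϖ‖ := fun x => ⟨h2 x, fun h => h.trans_lt h1⟩
  have hc' : ∀ v, diagForm (ϖ⁻¹ • c) v = 0 → v = 0 := fun v hv => by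
    rw [diagForm_smul_coeff] at hv
    exact hc v ((mul_eq_zero.1 hv).resolve_left (inv_ne_zero h0))
  have e1 := dFpi_diagForm_le_one p hc
  have e2 := dFpi_diagForm_le_one p hc'
  have s1 : {v | ‖diagForm c v‖ < 1} = {v | ‖diagForm (ϖ⁻¹ • c) v‖ ≤ 1} := by
    ext v
    rw [Set.mem_ofPred_eq, Set.mem_ofPred_eq, diagForm_smul_coeff, norm_mul, norm_inv,
      inv_mul_le_iff₀ hpos, mul_one, hlt]
  have s2 : {v | ‖diagForm (ϖ⁻¹ • c) v‖ < 1} = {v | ‖diagForm c v‖ ≤ ‖ϖ‖ ^ 2 * 1} := by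
    ext v
    rw [Set.mem_ofPred_eq, Set.mem_ofPred_eq, diagForm_smul_coeff, hlt, norm_mul, norm_inv,
      inv_mul_le_iff₀ hpos, mul_one, pow_two]
  rw [s1] at e1
  rw [s2, dFpi_diagForm_mul_sq p c h0, nabs_uniformizer p h0 h1 h2] at e2
  set V := dFpi p F ι {v | ‖diagForm c v‖ ≤ 1}
  have hV0 : V ≠ 0 := (dFpi_diagForm_le_pos p c one_pos).ne'
  have hVt : V ≠ ⊤ := (isCompact_diagForm_le hc 1).measure_ne_top
  have hq : 1 < resCard F := one_lt_resCard F
  have hqR : (1 : ℝ) < resCard F := by exact_mod_cast hq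
  have h3 : V ≤ (resCard F : ENNReal) ^ 4 * ENNReal.ofReal ((resCard F : ℝ)⁻¹ ^ Fintype.card ι) * V :=
    calc V ≤ _ := e1
      _ ≤ _ := mul_le_mul_right e2 _
      _ = _ := by ring
  have h4 : (resCard F : ENNReal) ^ 4 * ENNReal.ofReal ((resCard F : ℝ)⁻¹ ^ Fintype.card ι) < 1 := by
    have h5 : (resCard F : ENNReal) = ENNReal.ofReal (resCard F : ℝ) := by simp
    rw [h5, ← ENNReal.ofReal_pow (by positivity), ← ENNReal.ofReal_mul (by positivity),
      ENNReal.ofReal_lt_one, inv_pow, ← div_eq_mul_inv, div_lt_one (by positivity)]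
    exact pow_lt_pow_right₀ hqR (by omega)
  have h6 := (ENNReal.mul_lt_mul_iff_left hV0 hVt).2 h4
  rw [one_mul] at h6
  exact absurd h3 (not_le.2 h6)

/-- The quaternion norm form `x² - a y² - b z² + a b w²`. -/
def quatCoeff {F : Type*} [Field F] (a b : F) : Fin 4 → F := ![1, -a, -b, a * b]

theorem diagForm_quatCoeff {F : Type*} [NormedField F] [IsUltrametricDist F] [ProperSpace F]
    (a b : F) (v : Fin 4 → F) : diagForm (quatCoeff a b) v =
    v 0 ^ 2 - a * v 1 ^ 2 - b * v 2 ^ 2 + a * b * v 3 ^ 2 := by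
  simp [diagForm, quatCoeff, Fin.sum_univ_four]
  ring

/-- The norm form of a quaternion division algebra over `F` is universal. -/
theorem exists_diagForm_quatCoeff_eq (p : ℕ) [Fact p.Prime] {F : Type*} [NormedField F]
    [NormedAlgebra ℚ_[p] F] [IsUltrametricDist F] [FiniteDimensional ℚ_[p] F] [ProperSpace F]
    {a b : F}
    (h : ∀ v, diagForm (quatCoeff a b) v = 0 → v = 0) (t : F) :
    ∃ v, diagForm (quatCoeff a b) v = t := by
  obtain ⟨v, hv0, hv⟩ := exists_diagForm_eq_zero p (by simp) ![1, -a, -b, a * b, -t]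
  simp only [diagForm, Fin.sum_univ_five, Matrix.cons_val_zero, Matrix.cons_val_one,
    Matrix.cons_val] at hv
  have h4 : v 4 ≠ 0 := by
    intro h4
    rw [h4] at hv
    have := h ![v 0, v 1, v 2, v 3] (by
      rw [diagForm_quatCoeff]
      simp only [Matrix.cons_val_zero, Matrix.cons_val_one, Matrix.cons_val]
      linear_combination hv)
    apply hv0
    funext i
    fin_cases i
    · exact congrFun this 0
    · exact congrFun this 1
    · exact congrFun this 2
    · exact congrFun this 3
    · exact h4
  refine ⟨(v 4)⁻¹ • ![v 0, v 1, v 2, v 3], ?_⟩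
  rw [diagForm_smul, diagForm_quatCoeff]
  simp only [Matrix.cons_val_zero, Matrix.cons_val_one, Matrix.cons_val]
  field_simp
  linear_combination hv

/-! ### Weil constants of quadratic forms in several variables -/

/-- An automorphism of an additive group scales a Haar measure by a positive constant. -/
theorem exists_map_eq_smul {G : Type*} [AddCommGroup G] [TopologicalSpace G]
    [IsTopologicalAddGroup G] [LocallyCompactSpace G] [SecondCountableTopology G]
    [MeasurableSpace G] [BorelSpace G] (μ : Measure G) [μ.IsAddHaarMeasure] (L : G ≃+ G)
    (h1 : Continuous L) (h2 : Continuous L.symm) :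
    ∃ κ : ℝ, 0 < κ ∧ μ.map L = ENNReal.ofReal κ • μ ∧
      (∀ S, μ (L ⁻¹' S) = ENNReal.ofReal κ * μ S) ∧
      ∀ (S : Set G) (f : G → ℂ), ∫ x in L ⁻¹' S, f (L x) ∂μ = κ * ∫ x in S, f x ∂μ := by
  let E : G ≃ₜ G := ⟨L.toEquiv, h1, h2⟩
  have hE : ⇑E = ⇑L := rfl
  have hhaar : (μ.map L).IsAddHaarMeasure := L.isAddHaarMeasure_map μ h1 h2
  have h3 := Measure.isAddLeftInvariant_eq_smul (μ.map L) μ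
  set κ := (μ.map L).addHaarScalarFactor μ
  have hκ : κ ≠ 0 := Measure.addHaarScalarFactor_pos_of_isAddHaarMeasure _ _ |>.ne'
  have h4 : μ.map L = ENNReal.ofReal (κ : ℝ) • μ := by
    rw [ENNReal.ofReal_coe_nnreal]; exact h3
  refine ⟨κ, by positivity, h4, fun S => ?_, fun S f => ?_⟩
  · have := E.measurableEmbedding.map_apply μ S
    rw [hE, h4] at this
    rw [← this, Measure.smul_apply, smul_eq_mul]
  · have := E.measurableEmbedding.setIntegral_map (μ := μ) f S
    rw [hE, h4, Measure.restrict_smul, integral_smul_measure,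
      ENNReal.toReal_ofReal (by positivity)] at this
    rw [← this, Complex.real_smul]

namespace LocalDatum

variable {p : ℕ} [Fact p.Prime] {F : Type*} [NormedField F] [NormedAlgebra ℚ_[p] F]
  [IsUltrametricDist F] (D : LocalDatum p F) [FiniteDimensional ℚ_[p] F] [ProperSpace F]
  [MeasurableSpace F] [BorelSpace F] {ι : Type*} [Fintype ι]

theorem ψ_sum (s : Finset ι) (f : ι → F) : D.ψ (∑ i ∈ s, f i) = ∏ i ∈ s, D.ψ (f i) := by
  classical
  induction s using Finset.induction_on with
  | empty => simp
  | insert i s hi ih => rw [Finset.sum_insert hi, Finset.prod_insert hi, AddChar.map_add_eq_mul, ih]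

theorem setIntegral_pi_prod (r : F) (f : ι → F → ℂ) :
    ∫ v in Metric.closedBall (0 : ι → F) ‖r‖, ∏ i, f i (v i) ∂(dFpi p F ι) =
      ∏ i, ∫ x in Metric.closedBall (0 : F) ‖r‖, f i x ∂(dF p F) := by
  rw [closedBall_pi _ (norm_nonneg r), dFpi, Measure.restrict_pi_pi]
  exact integral_fintype_prod_eq_prod f

theorem norm_δ_mul_diagForm_le_one {c : ι → F} {r : F} (hr : ∀ i, ‖D.δ * (c i * r ^ 2)‖ ≤ 1)
    {y : ι → F} (hy : ‖y‖ ≤ ‖r‖) : ‖D.δ * diagForm c y‖ ≤ 1 := by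
  rw [diagForm, Finset.mul_sum]
  refine IsUltrametricDist.norm_sum_le_of_forall_le_of_nonneg zero_le_one fun i _ => ?_
  refine le_trans ?_ (hr i)
  have := (norm_le_pi_norm y i).trans hy
  simp only [norm_mul, norm_pow]
  gcongr

/-- Averaging over small translations localizes the integral of `ψ` of a quadratic form. -/
theorem setIntegral_ψ_diagForm {c : ι → F} {r : F} (hr0 : r ≠ 0)
    (hr : ∀ i, ‖D.δ * (c i * r ^ 2)‖ ≤ 1) {A : Set (ι → F)} (hA : IsCompact A)
    (hinv : ∀ y, ‖y‖ ≤ ‖r‖ → ∀ x, x + y ∈ A ↔ x ∈ A)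
    (hsub : {v | ∀ i, ‖D.δ * (r * (2 * c i * v i))‖ ≤ 1} ⊆ A) :
    ∫ v in A, D.ψ (diagForm c v) ∂(dFpi p F ι) =
      ∫ v in {v | ∀ i, ‖D.δ * (r * (2 * c i * v i))‖ ≤ 1}, D.ψ (diagForm c v) ∂(dFpi p F ι) := by
  set K : Set (ι → F) := {v | ∀ i, ‖D.δ * (r * (2 * c i * v i))‖ ≤ 1}
  have hKm : MeasurableSet K := by
    have : IsClosed K := by
      simp only [K, Set.ofPred_forall]
      exact isClosed_iInter fun i => isClosed_le (by fun_prop) continuous_const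
    exact this.measurableSet
  have hc1 := continuous_diagForm c
  have hc2 : Continuous fun z : (ι → F) × (ι → F) => diagPolar c z.1 z.2 := by
    unfold diagPolar; fun_prop
  have h1 : ∀ y ∈ Metric.closedBall (0 : ι → F) ‖r‖,
      ∫ v in A, D.ψ (diagForm c v) ∂(dFpi p F ι) =
        ∫ v in A, D.ψ (diagForm c v) * D.ψ (diagPolar c v y) ∂(dFpi p F ι) := by
    intro y hy
    rw [mem_closedBall_zero_iff] at hy
    rw [← setIntegral_comp_add (dFpi p F ι) y (hinv y hy)]
    congr 1
    funext v
    rw [diagForm_add, D.ψ_add_of_small (D.norm_δ_mul_diagForm_le_one hr hy),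
      AddChar.map_add_eq_mul]
  have h2 := setIntegral_congr_fun (μ := dFpi p F ι)
    Metric.isClosed_closedBall.measurableSet h1
  rw [setIntegral_const,
    setIntegral_swap (dFpi p F ι) (dFpi p F ι) (isCompact_closedBall _ _) hA (by fun_prop)] at h2
  have h3 : ∀ v, ∫ y in Metric.closedBall (0 : ι → F) ‖r‖,
      D.ψ (diagForm c v) * D.ψ (diagPolar c v y) ∂(dFpi p F ι) =
        ((dFpi p F ι).real (Metric.closedBall 0 ‖r‖) : ℂ) *
          K.indicator (fun v => D.ψ (diagForm c v)) v := by
    intro v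
    have h4 : ∀ y, D.ψ (diagPolar c v y) = ∏ i, D.ψ (y i * (2 * c i * v i)) := by
      intro y
      rw [← ψ_sum, diagPolar]
      congr 1
      exact Finset.sum_congr rfl fun i _ => by ring
    have h5 : ((dFpi p F ι).real (Metric.closedBall 0 ‖r‖) : ℂ) =
        ∏ _i : ι, (nabs p r : ℂ) := by
      have h6 := setIntegral_pi_prod (p := p) r fun (_ : ι) (_ : F) => (1 : ℂ)
      rw [setIntegral_one_closedBall p hr0] at h6
      rw [← h6]
      simp
    rw [integral_const_mul]
    simp_rw [h4]
    rw [setIntegral_pi_prod (p := p) r fun i x => D.ψ (x * (2 * c i * v i)), h5]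
    simp_rw [D.setIntegral_ψ hr0]
    by_cases hv : v ∈ K
    · rw [Set.indicator_of_mem hv, mul_comm]
      congr 1
      exact Finset.prod_congr rfl fun i _ => if_pos (hv i)
    · rw [Set.indicator_of_notMem hv, mul_zero]
      simp only [K, Set.mem_ofPred_eq, not_forall] at hv
      obtain ⟨i, hi⟩ := hv
      rw [Finset.prod_eq_zero (Finset.mem_univ i) (if_neg hi), mul_zero]
  simp_rw [h3] at h2
  rw [integral_const_mul, setIntegral_indicator hKm, Set.inter_eq_self_of_subset_right hsub,
    Complex.real_smul] at h2
  refine mul_left_cancel₀ ?_ h2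
  have hpos : 0 < dFpi p F ι (Metric.closedBall 0 ‖r‖) :=
    Metric.measure_closedBall_pos _ _ (norm_pos_iff.2 hr0)
  have := ENNReal.toReal_pos hpos.ne' (isCompact_closedBall (0 : ι → F) ‖r‖).measure_ne_top
  exact_mod_cast this.ne'

/-- Over any sufficiently large compact set that is invariant under small translations, the
integral of `ψ` of a diagonal form is a positive multiple of the product of the Weil constants. -/
theorem exists_setIntegral_ψ_diagForm {c : ι → F} (hc : ∀ i, c i ≠ 0) {r : F} (hr0 : r ≠ 0) :
    ∃ K : ℝ, 0 < K ∧ ∃ N : ℝ, ∀ A : Set (ι → F), IsCompact A →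
      (∀ y, ‖y‖ ≤ ‖r‖ → ∀ x, x + y ∈ A ↔ x ∈ A) → Metric.closedBall 0 N ⊆ A →
      ∫ v in A, D.ψ (diagForm c v) ∂(dFpi p F ι) = K * ∏ i, D.weilConst (c i) := by
  have := charZero_of_padic p F
  -- shrink `r` so that `ψ` is trivial on the values of the form on the ball of radius `‖r‖`
  obtain ⟨s, hs0, hs⟩ := exists_norm_le p F
    (ε := min ‖r‖ (min 1 (1 + ∑ i, ‖D.δ * c i‖)⁻¹)) (by
      refine lt_min (norm_pos_iff.2 hr0) (lt_min one_pos (inv_pos.2 ?_))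
      have : 0 ≤ ∑ i, ‖D.δ * c i‖ := Finset.sum_nonneg fun i _ => norm_nonneg _
      linarith)
  have hsr : ‖s‖ ≤ ‖r‖ := hs.trans (min_le_left _ _)
  have hs1 : ‖s‖ ≤ 1 := hs.trans ((min_le_right _ _).trans (min_le_left _ _))
  have hs2 : ∀ i, ‖D.δ * (c i * s ^ 2)‖ ≤ 1 := by
    intro i
    have h1 : ‖s‖ ≤ (1 + ∑ i, ‖D.δ * c i‖)⁻¹ :=
      hs.trans ((min_le_right _ _).trans (min_le_right _ _))
    have h2 : ‖D.δ * c i‖ ≤ ∑ i, ‖D.δ * c i‖ :=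
      Finset.single_le_sum (f := fun i => ‖D.δ * c i‖) (fun i _ => norm_nonneg _)
        (Finset.mem_univ i)
    have h3 : 0 < 1 + ∑ i, ‖D.δ * c i‖ := by linarith [norm_nonneg (D.δ * c i)]
    rw [← mul_assoc, norm_mul, norm_pow, pow_two]
    calc ‖D.δ * c i‖ * (‖s‖ * ‖s‖) ≤ (1 + ∑ i, ‖D.δ * c i‖) * (1 * (1 + ∑ i, ‖D.δ * c i‖)⁻¹) := by
          gcongr; linarith
      _ = 1 := by rw [one_mul]; exact mul_inv_cancel₀ h3.ne'
  -- the region of localization lies in a ball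
  obtain ⟨N₁, hN₁⟩ : ∃ N : ℝ, {v : ι → F | ∀ i, ‖D.δ * (s * (2 * c i * v i))‖ ≤ 1} ⊆
      Metric.closedBall 0 N := by
    refine ⟨∑ i, ‖D.δ * (s * (2 * c i))‖⁻¹, fun v hv => ?_⟩
    have hnn : ∀ i, 0 ≤ ‖D.δ * (s * (2 * c i))‖⁻¹ := fun i => inv_nonneg.2 (norm_nonneg _)
    rw [mem_closedBall_zero_iff, pi_norm_le_iff_of_nonneg (Finset.sum_nonneg fun i _ => hnn i)]
    intro i
    refine le_trans ?_ (Finset.single_le_sum (f := fun i => ‖D.δ * (s * (2 * c i))‖⁻¹)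
      (fun i _ => hnn i) (Finset.mem_univ i))
    have hpos : 0 < ‖D.δ * (s * (2 * c i))‖ := by
      rw [norm_pos_iff]
      exact mul_ne_zero D.δ_ne_zero (mul_ne_zero hs0 (mul_ne_zero two_ne_zero (hc i)))
    have h1 := hv i
    rw [← mul_assoc, ← mul_assoc, norm_mul] at h1
    rw [← one_div, le_div_iff₀' hpos, ← mul_assoc]
    exact h1
  choose N₂ hN₂ using fun i => D.weilConst_eq_gauss (hc i)
  obtain ⟨R, hR0, hR⟩ := exists_le_norm p F (max (max N₁ ‖s‖) (∑ i, |N₂ i|))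
  have hRN : ∀ i, N₂ i ≤ ‖R‖ := fun i => (le_abs_self _).trans
    ((Finset.single_le_sum (f := fun i => |N₂ i|) (fun i _ => abs_nonneg _)
      (Finset.mem_univ i)).trans ((le_max_right _ _).trans hR))
  have key : ∀ A : Set (ι → F), IsCompact A →
      (∀ y, ‖y‖ ≤ ‖r‖ → ∀ x, x + y ∈ A ↔ x ∈ A) → Metric.closedBall 0 N₁ ⊆ A →
      ∫ v in A, D.ψ (diagForm c v) ∂(dFpi p F ι) = ∏ i, D.gauss (c i) R := by
    intro A hA hinv hsub
    rw [D.setIntegral_ψ_diagForm hs0 hs2 hA (fun y hy => hinv y (hy.trans hsr))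
      (hN₁.trans hsub), ← D.setIntegral_ψ_diagForm hs0 hs2
        (isCompact_closedBall (0 : ι → F) ‖R‖) (fun y hy x => add_mem_closedBall_iff
          (hy.trans ((le_max_right _ _).trans ((le_max_left _ _).trans hR))))
        (hN₁.trans (Metric.closedBall_subset_closedBall
          ((le_max_left _ _).trans ((le_max_left _ _).trans hR))))]
    have := setIntegral_pi_prod (p := p) R fun i x => D.ψ (c i * x ^ 2)
    simp_rw [← ψ_sum] at this
    exact this
  have hpos : ∀ i, 0 < nabs p (2 * c i) ^ (1 / 2 : ℝ) * nabs p D.δ ^ (1 / 2 : ℝ) := fun i =>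
    mul_pos (Real.rpow_pos_of_pos (nabs_pos p (two_mul_ne_zero' p (hc i))) _)
      (Real.rpow_pos_of_pos (nabs_pos p D.δ_ne_zero) _)
  refine ⟨∏ i, (nabs p (2 * c i) ^ (1 / 2 : ℝ) * nabs p D.δ ^ (1 / 2 : ℝ))⁻¹,
    Finset.prod_pos fun i _ => inv_pos.2 (hpos i), N₁, fun A hA hinv hsub => ?_⟩
  rw [key A hA hinv hsub]
  push_cast
  rw [← Finset.prod_mul_distrib]
  refine Finset.prod_congr rfl fun i _ => ?_
  rw [hN₂ i R (hRN i), sqrtδ]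
  have h1 : ((nabs p (2 * c i) ^ (1 / 2 : ℝ) : ℝ) : ℂ) * ((nabs p D.δ ^ (1 / 2 : ℝ) : ℝ) : ℂ) ≠ 0 := by
    exact_mod_cast (hpos i).ne'
  rw [← mul_assoc, inv_mul_cancel₀ h1, one_mul]

end LocalDatum

/-! ### The quaternion norm form and the Hilbert symbol -/

/-- Left multiplication by `x` in the quaternion algebra with `i² = a`, `j² = b`, in the basis
`1, i, j, ij`. -/
def quatMul {F : Type*} [Field F] (a b : F) (x y : Fin 4 → F) : Fin 4 → F :=
  ![x 0 * y 0 + a * x 1 * y 1 + b * x 2 * y 2 - a * b * x 3 * y 3,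
    x 0 * y 1 + x 1 * y 0 - b * x 2 * y 3 + b * x 3 * y 2,
    x 0 * y 2 + x 2 * y 0 + a * x 1 * y 3 - a * x 3 * y 1,
    x 0 * y 3 + x 3 * y 0 + x 1 * y 2 - x 2 * y 1]

section Quaternion

variable {F : Type*} [NormedField F] [IsUltrametricDist F] [ProperSpace F]

theorem diagForm_quatMul (a b : F) (x y : Fin 4 → F) :
    diagForm (quatCoeff a b) (quatMul a b x y) =
      diagForm (quatCoeff a b) x * diagForm (quatCoeff a b) y := by
  simp only [diagForm_quatCoeff, quatMul, Matrix.cons_val_zero, Matrix.cons_val_one,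
    Matrix.cons_val]
  ring

/-- The conjugate quaternion divided by the norm. -/
def quatInv (a b : F) (x : Fin 4 → F) : Fin 4 → F :=
  (diagForm (quatCoeff a b) x)⁻¹ • ![x 0, -x 1, -x 2, -x 3]

theorem quatMul_quatInv_left {a b : F} {x : Fin 4 → F} (hx : diagForm (quatCoeff a b) x ≠ 0)
    (y : Fin 4 → F) : quatMul a b (quatInv a b x) (quatMul a b x y) = y := by
  have h : ∀ t : F, t = (diagForm (quatCoeff a b) x)⁻¹ * (diagForm (quatCoeff a b) x * t) :=
    fun t => by rw [inv_mul_cancel_left₀ hx]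
  funext i
  rw [h (y i)]
  fin_cases i <;>
  · simp [quatMul, quatInv]
    rw [diagForm_quatCoeff]
    ring

theorem quatMul_quatInv_right {a b : F} {x : Fin 4 → F} (hx : diagForm (quatCoeff a b) x ≠ 0)
    (y : Fin 4 → F) : quatMul a b x (quatMul a b (quatInv a b x) y) = y := by
  have h : ∀ t : F, t = (diagForm (quatCoeff a b) x)⁻¹ * (diagForm (quatCoeff a b) x * t) :=
    fun t => by rw [inv_mul_cancel_left₀ hx]
  funext i
  rw [h (y i)]
  fin_cases i <;>
  · simp [quatMul, quatInv]
    rw [diagForm_quatCoeff]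
    ring

theorem quatMul_add (a b : F) (x y z : Fin 4 → F) :
    quatMul a b x (y + z) = quatMul a b x y + quatMul a b x z := by
  funext i
  fin_cases i <;> · simp [quatMul]; ring

theorem continuous_quatMul (a b : F) (x : Fin 4 → F) : Continuous (quatMul a b x) := by
  refine continuous_pi fun i => ?_
  fin_cases i <;> · simp [quatMul]; fun_prop

/-- Left multiplication by a quaternion of nonzero norm, as an additive automorphism. -/
def quatEquiv (a b : F) {x : Fin 4 → F} (hx : diagForm (quatCoeff a b) x ≠ 0) :
    (Fin 4 → F) ≃+ (Fin 4 → F) where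
  toFun := quatMul a b x
  invFun := quatMul a b (quatInv a b x)
  left_inv := quatMul_quatInv_left hx
  right_inv := quatMul_quatInv_right hx
  map_add' := quatMul_add a b x

end Quaternion

theorem eq_of_pos_mul_eq {x y : ℂ} (hx : ‖x‖ = 1) (hy : ‖y‖ = 1) {A B : ℝ} (hA : 0 < A)
    (hB : 0 < B) (h : (A : ℂ) * x = B * y) : x = y := by
  have h1 := congrArg norm h
  rw [norm_mul, norm_mul, hx, hy, mul_one, mul_one, Complex.norm_real, Complex.norm_real,
    Real.norm_of_nonneg hA.le, Real.norm_of_nonneg hB.le] at h1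
  rw [h1] at h
  exact mul_left_cancel₀ (by exact_mod_cast hB.ne') h

namespace LocalDatum

variable {p : ℕ} [Fact p.Prime] {F : Type*} [NormedField F] [NormedAlgebra ℚ_[p] F]
  [IsUltrametricDist F] (D : LocalDatum p F) [FiniteDimensional ℚ_[p] F] [ProperSpace F]
  [MeasurableSpace F] [BorelSpace F]

/-- Multiplication by `u + v √a` is a similitude of the binary form `x² - a y²`. -/
theorem weilConst_binary {a c u v : F} (ha : a ≠ 0) (hc : c ≠ 0) (hb : u ^ 2 - a * v ^ 2 ≠ 0) :
    D.weilConst c * D.weilConst (-(c * a)) =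
      D.weilConst (c * (u ^ 2 - a * v ^ 2)) * D.weilConst (-(c * (u ^ 2 - a * v ^ 2) * a)) := by
  set b := u ^ 2 - a * v ^ 2 with hbdef
  let T : (Fin 2 → F) ≃+ (Fin 2 → F) :=
    { toFun := fun x => ![u * x 0 + a * v * x 1, v * x 0 + u * x 1]
      invFun := fun x => ![b⁻¹ * (u * x 0 - a * v * x 1), b⁻¹ * (u * x 1 - v * x 0)]
      left_inv := fun x => by
        funext i
        fin_cases i
        · simp
          field_simp
          rw [hbdef]; ring
        · simp
          field_simp
          rw [hbdef]; ring
      right_inv := fun x => by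
        funext i
        fin_cases i
        · simp
          field_simp
          rw [hbdef]; ring
        · simp
          field_simp
          rw [hbdef]; ring
      map_add' := fun x y => by
        funext i
        fin_cases i <;> · simp; ring }
  have hT : Continuous T := by
    refine continuous_pi fun i => ?_
    fin_cases i <;> · simp [T]; fun_prop
  have hT' : Continuous T.symm := by
    refine continuous_pi fun i => ?_
    fin_cases i <;> · simp [T, AddEquiv.symm]; fun_prop
  obtain ⟨κ, hκ, -, -, hint⟩ := exists_map_eq_smul (dFpi p F (Fin 2)) T hT hT'
  -- the two forms
  set c₁ : Fin 2 → F := ![c, -(c * a)]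
  set c₂ : Fin 2 → F := ![c * b, -(c * b * a)]
  have hform : ∀ x, diagForm c₁ (T x) = diagForm c₂ x := by
    intro x
    simp [diagForm, c₁, c₂, T, Fin.sum_univ_two]
    rw [hbdef]; ring
  have hc₁ : ∀ i, c₁ i ≠ 0 := by
    intro i; fin_cases i
    · exact hc
    · exact neg_ne_zero.2 (mul_ne_zero hc ha)
  have hc₂ : ∀ i, c₂ i ≠ 0 := by
    intro i; fin_cases i
    · exact mul_ne_zero hc hb
    · exact neg_ne_zero.2 (mul_ne_zero (mul_ne_zero hc hb) ha)
  -- a ball on which the inverse of `T` is bounded by `1`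
  obtain ⟨r, hr0, hr⟩ : ∃ r : F, r ≠ 0 ∧ ∀ y, ‖y‖ ≤ ‖r‖ → ‖T.symm y‖ ≤ 1 := by
    have : ∀ᶠ y in 𝓝 (0 : Fin 2 → F), ‖T.symm y‖ < 1 := by
      have h0 : ‖T.symm 0‖ < 1 := by simp
      exact (continuous_norm.comp hT').continuousAt.eventually (gt_mem_nhds h0)
    obtain ⟨ε, hε, h⟩ := Metric.eventually_nhds_iff.1 this
    obtain ⟨r, hr0, hr⟩ := exists_norm_le p F (half_pos hε)
    exact ⟨r, hr0, fun y hy => (h (by rw [dist_zero_right]; linarith)).le⟩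
  obtain ⟨K₁, hK₁, N₁, h₁⟩ := D.exists_setIntegral_ψ_diagForm hc₁ hr0
  obtain ⟨K₂, hK₂, N₂, h₂⟩ := D.exists_setIntegral_ψ_diagForm hc₂ (one_ne_zero (α := F))
  obtain ⟨C, hC⟩ := ((isCompact_closedBall (0 : Fin 2 → F) N₁).image hT').isBounded.exists_norm_le
  obtain ⟨R, -, hR⟩ := exists_le_norm p F (max 1 (max N₂ C))
  have hR1 : 1 ≤ ‖R‖ := (le_max_left _ _).trans hR
  have hR2 : N₂ ≤ ‖R‖ := (le_max_left _ _).trans ((le_max_right _ _).trans hR)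
  have hR3 : C ≤ ‖R‖ := (le_max_right _ _).trans ((le_max_right _ _).trans hR)
  set B := Metric.closedBall (0 : Fin 2 → F) ‖R‖
  have hBc : IsCompact B := isCompact_closedBall _ _
  have hpre : T ⁻¹' (T.symm ⁻¹' B) = B := by ext x; simp
  have himg : T.symm ⁻¹' B = T '' B := by
    ext x
    constructor
    · intro hx; exact ⟨T.symm x, hx, T.apply_symm_apply x⟩
    · rintro ⟨y, hy, rfl⟩; simpa using hy
  have e₂ := h₂ B hBc (fun y hy x => add_mem_closedBall_iff
    (hy.trans (by rw [norm_one]; exact hR1))) (Metric.closedBall_subset_closedBall hR2)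
  have e₁ := h₁ (T.symm ⁻¹' B) (himg ▸ hBc.image hT) (fun y hy x => by
      rw [Set.mem_preimage, Set.mem_preimage, map_add]
      exact add_mem_closedBall_iff ((hr y hy).trans hR1))
    (fun x hx => mem_closedBall_zero_iff.2 ((hC _ ⟨x, hx, rfl⟩).trans hR3))
  have e₃ := hint (T.symm ⁻¹' B) fun x => D.ψ (diagForm c₁ x)
  rw [hpre] at e₃
  simp_rw [hform] at e₃
  rw [e₁, e₂, ← mul_assoc, ← Complex.ofReal_mul] at e₃
  have hn₁ : ‖∏ i, D.weilConst (c₁ i)‖ = 1 := by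
    rw [norm_prod]; exact Finset.prod_eq_one fun i _ => D.norm_weilConst (hc₁ i)
  have hn₂ : ‖∏ i, D.weilConst (c₂ i)‖ = 1 := by
    rw [norm_prod]; exact Finset.prod_eq_one fun i _ => D.norm_weilConst (hc₂ i)
  have := eq_of_pos_mul_eq hn₂ hn₁ hK₂ (mul_pos hκ hK₁) e₃
  rw [Fin.prod_univ_two, Fin.prod_univ_two] at this
  exact this.symm

theorem setIntegral_sphere_ψ {ϖ : F} (h0 : ϖ ≠ 0) (h1 : ‖ϖ‖ < 1)
    (h2 : ∀ x : F, ‖x‖ < 1 → ‖x‖ ≤ ‖ϖ‖) (t : F) :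
    ∫ u in Metric.sphere (0 : F) 1, D.ψ (u * t) ∂(dF p F) =
      (if ‖D.δ * t‖ ≤ 1 then 1 else 0) -
        if ‖D.δ * (ϖ * t)‖ ≤ 1 then ((resCard F : ℝ)⁻¹ : ℂ) else 0 := by
  have hsph : Metric.sphere (0 : F) 1 =
      Metric.closedBall 0 ‖(1 : F)‖ \ Metric.closedBall 0 ‖ϖ‖ := by
    ext x
    rw [Set.mem_sdiff, mem_sphere_zero_iff_norm, mem_closedBall_zero_iff, mem_closedBall_zero_iff,
      norm_one]
    constructor
    · intro h; exact ⟨h.le, by rw [h]; exact not_le.2 h1⟩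
    · rintro ⟨ha, hb⟩
      exact le_antisymm ha (not_lt.1 fun h => hb (h2 x h))
  have hc : Continuous fun u => D.ψ (u * t) := by fun_prop
  rw [hsph, setIntegral_sdiff Metric.isClosed_closedBall.measurableSet
    (hc.continuousOn.integrableOn_compact (isCompact_closedBall _ _))
    (Metric.closedBall_subset_closedBall (by rw [norm_one]; exact h1.le)),
    D.setIntegral_ψ one_ne_zero, D.setIntegral_ψ h0, nabs_uniformizer p h0 h1 h2, nabs_one,
    one_mul]
  simp

/-- The Weil constant of a multiple of an anisotropic quaternion norm form is `-1`. -/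
theorem weilConst_quat_of_anisotropic {a b c : F} (ha : a ≠ 0) (hb : b ≠ 0) (hc : c ≠ 0)
    (h : ∀ v, diagForm (quatCoeff a b) v = 0 → v = 0) :
    ∏ i, D.weilConst (c * quatCoeff a b i) = -1 := by
  obtain ⟨ϖ, h0, h1, h2⟩ := exists_uniformizer p F
  have hϖ : 0 < ‖ϖ‖ := norm_pos_iff.2 h0
  have hq : (1 : ℝ) < resCard F := by exact_mod_cast one_lt_resCard F
  set μ := dFpi p F (Fin 4)
  set N : (Fin 4 → F) → F := diagForm (quatCoeff a b)
  have hNc : Continuous N := continuous_diagForm _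
  set S : ℝ → Set (Fin 4 → F) := fun ρ => {v | ‖N v‖ ≤ ρ}
  have hSc : ∀ ρ, IsCompact (S ρ) := fun ρ => isCompact_diagForm_le h ρ
  have hSfin : ∀ ρ, μ (S ρ) ≠ ⊤ := fun ρ => (hSc ρ).measure_ne_top
  have hSpos : ∀ ρ, 0 < ρ → 0 < μ.real (S ρ) := fun ρ hρ =>
    ENNReal.toReal_pos (dFpi_diagForm_le_pos p _ hρ).ne' (hSfin ρ)
  -- similitudes
  have hsim : ∀ t : F, t ≠ 0 → ∃ κ : ℝ, 0 < κ ∧ (∀ ρ, μ.real (S ρ) = κ * μ.real (S (‖t‖ * ρ))) ∧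
      ∀ ρ d, ∫ v in S ρ, D.ψ (d * (t * N v)) ∂μ =
        κ * ∫ v in S (‖t‖ * ρ), D.ψ (d * N v) ∂μ := by
    intro t ht
    obtain ⟨x, hx⟩ := exists_diagForm_quatCoeff_eq p h t
    have hx0 : diagForm (quatCoeff a b) x ≠ 0 := by rw [hx]; exact ht
    obtain ⟨κ, hκ, -, hμ, hint⟩ := exists_map_eq_smul μ (quatEquiv a b hx0)
      (continuous_quatMul a b x) (continuous_quatMul a b _)
    have hN : ∀ v, N (quatEquiv a b hx0 v) = t * N v := by
      intro v; rw [← hx]; exact diagForm_quatMul a b x v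
    have hpre : ∀ ρ, quatEquiv a b hx0 ⁻¹' (S (‖t‖ * ρ)) = S ρ := by
      intro ρ
      ext v
      rw [Set.mem_preimage, Set.mem_ofPred_eq, Set.mem_ofPred_eq, hN, norm_mul]
      exact mul_le_mul_iff_right₀ (norm_pos_iff.2 ht)
    refine ⟨κ, hκ, fun ρ => ?_, fun ρ d => ?_⟩
    · rw [← hpre, measureReal_def, hμ, ENNReal.toReal_mul, ENNReal.toReal_ofReal hκ.le,
        measureReal_def]
    · rw [← hpre, ← hint]
      simp_rw [hN]
  -- units preserve the integrals
  have hunit : ∀ ρ, 0 < ρ → ∀ u ∈ Metric.sphere (0 : F) 1,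
      ∫ v in S ρ, D.ψ (c * N v) ∂μ = ∫ v in S ρ, D.ψ (u * (c * N v)) ∂μ := by
    intro ρ hρ u hu
    rw [mem_sphere_zero_iff_norm] at hu
    obtain ⟨κ, hκ, hvol, hint⟩ := hsim u (by rintro rfl; simp at hu)
    have h3 := hvol ρ
    rw [hu, one_mul] at h3
    have hκ1 : κ = 1 := by
      have := hSpos ρ hρ
      exact mul_right_cancel₀ this.ne' (by rw [one_mul]; exact h3.symm)
    have h4 := hint ρ c
    rw [hu, one_mul, hκ1, Complex.ofReal_one, one_mul] at h4
    rw [← h4]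
    congr 1
    funext v
    congr 1; ring
  -- the volumes of the shells
  have hshell : ∀ ρ, 0 < ρ → μ.real (S (‖ϖ⁻¹‖ * ρ)) = (resCard F : ℝ) ^ 2 * μ.real (S ρ) := by
    intro ρ hρ
    obtain ⟨κ, hκ, hvol, -⟩ := hsim ϖ⁻¹ (inv_ne_zero h0)
    have h3 := hvol ρ
    have h4 := hvol (‖ϖ⁻¹‖ * ρ)
    have h5 := congrArg ENNReal.toReal
      (dFpi_diagForm_mul_sq p (quatCoeff a b) h0 (‖ϖ⁻¹‖ * (‖ϖ⁻¹‖ * ρ)))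
    have h6 : ‖ϖ‖ ^ 2 * (‖ϖ⁻¹‖ * (‖ϖ⁻¹‖ * ρ)) = ρ := by rw [norm_inv]; field_simp
    rw [h6, ENNReal.toReal_mul, ENNReal.toReal_ofReal (by have := nabs_nonneg p ϖ; positivity),
      nabs_uniformizer p h0 h1 h2, Fintype.card_fin] at h5
    change μ.real (S ρ) = _ * μ.real (S (‖ϖ⁻¹‖ * (‖ϖ⁻¹‖ * ρ))) at h5
    have hV := hSpos ρ hρ
    have hV2 := hSpos (‖ϖ⁻¹‖ * (‖ϖ⁻¹‖ * ρ)) (by rw [norm_inv]; positivity)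
    rw [h4, ← mul_assoc] at h3
    have h7 : κ * κ = ((resCard F : ℝ)⁻¹) ^ 4 := mul_right_cancel₀ hV2.ne' (h3.symm.trans h5)
    have h8 : κ = ((resCard F : ℝ)⁻¹) ^ 2 := by
      have : κ ^ 2 = (((resCard F : ℝ)⁻¹) ^ 2) ^ 2 := by rw [pow_two, h7]; ring
      exact (pow_left_inj₀ hκ.le (by positivity) two_ne_zero).1 this
    rw [hvol ρ, h8]
    field_simp
  -- large balls for the norm form
  obtain ⟨r, hr0, hr⟩ : ∃ r : F, r ≠ 0 ∧ ∀ y, ‖y‖ ≤ ‖r‖ → ‖N y‖ ≤ 1 := by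
    have : ∀ᶠ y in 𝓝 (0 : Fin 4 → F), ‖N y‖ < 1 := by
      have h0 : ‖N 0‖ < 1 := by simp [N, diagForm]
      exact (continuous_norm.comp hNc).continuousAt.eventually (gt_mem_nhds h0)
    obtain ⟨ε, hε, h⟩ := Metric.eventually_nhds_iff.1 this
    obtain ⟨r, hr0, hr⟩ := exists_norm_le p F (half_pos hε)
    exact ⟨r, hr0, fun y hy => (h (by rw [dist_zero_right]; linarith)).le⟩
  have hcoef : ∀ i, c * quatCoeff a b i ≠ 0 := by
    intro i
    refine mul_ne_zero hc ?_
    fin_cases i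
    · exact one_ne_zero
    · exact neg_ne_zero.2 ha
    · exact neg_ne_zero.2 hb
    · exact mul_ne_zero ha hb
  obtain ⟨K, hK, M, hM⟩ := D.exists_setIntegral_ψ_diagForm hcoef hr0
  obtain ⟨C, hC⟩ := ((isCompact_closedBall (0 : Fin 4 → F) M).image hNc).isBounded.exists_norm_le
  have hδc : 0 < ‖D.δ * c‖ := norm_pos_iff.2 (mul_ne_zero D.δ_ne_zero hc)
  set ρ₁ := ‖D.δ * c‖⁻¹
  have hρ₁ : 0 < ρ₁ := inv_pos.2 hδc
  have hinv1 : 1 ≤ ‖ϖ⁻¹‖ := by rw [norm_inv]; exact (one_le_inv₀ hϖ).2 h1.le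
  set ρ := max 1 (max C (‖ϖ⁻¹‖ * ρ₁))
  have hρ1 : 1 ≤ ρ := le_max_left _ _
  have hρC : C ≤ ρ := (le_max_left _ _).trans (le_max_right _ _)
  have hρρ : ‖ϖ⁻¹‖ * ρ₁ ≤ ρ := (le_max_right _ _).trans (le_max_right _ _)
  have hρpos : 0 < ρ := one_pos.trans_le hρ1
  have e₁ := hM (S ρ) (hSc ρ) (fun y hy x => by
      have h3 : ‖N y‖ ≤ ρ := (hr y hy).trans hρ1
      have hneg : ‖N (-y)‖ ≤ ρ := (hr (-y) (by rwa [norm_neg])).trans hρ1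
      constructor
      · intro hx
        have := norm_diagForm_add_le p h (x + y) (-y)
        rw [add_neg_cancel_right] at this
        exact this.trans (max_le hx hneg)
      · intro hx
        exact (norm_diagForm_add_le p h x y).trans (max_le hx h3))
    (fun x hx => (hC _ ⟨x, hx, rfl⟩).trans hρC)
  have hform : ∀ v, diagForm (fun i => c * quatCoeff a b i) v = c * N v := fun v =>
    diagForm_smul_coeff _ _ _
  simp_rw [hform] at e₁
  -- average over the units
  have e₂ := setIntegral_congr_fun (μ := dF p F) Metric.isClosed_sphere.measurableSet
    (hunit ρ hρpos)
  have hvolS : ((dF p F).real (Metric.sphere (0 : F) 1) : ℂ) = 1 - (resCard F : ℝ)⁻¹ := by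
    have h3 := D.setIntegral_sphere_ψ h0 h1 h2 0
    simpa using h3
  rw [setIntegral_const, Complex.real_smul, hvolS, setIntegral_swap (dF p F) μ
    (isCompact_sphere _ _) (hSc ρ) (by fun_prop)] at e₂
  have hmem : ∀ v, ‖D.δ * (c * N v)‖ ≤ 1 ↔ v ∈ S ρ₁ := by
    intro v
    rw [← mul_assoc, norm_mul, ← le_div_iff₀' hδc, one_div]; rfl
  have hmem' : ∀ v, ‖D.δ * (ϖ * (c * N v))‖ ≤ 1 ↔ v ∈ S (‖ϖ⁻¹‖ * ρ₁) := by
    intro v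
    rw [mul_left_comm, norm_mul, ← le_div_iff₀' hϖ, ← mul_assoc, norm_mul, ← le_div_iff₀' hδc,
      Set.mem_ofPred_eq, norm_inv]
    simp only [ρ₁]
    rw [one_div, div_eq_mul_inv]
  have hmeas : ∀ ρ, MeasurableSet (S ρ) := fun ρ => (hSc ρ).measurableSet
  have hind : ∀ (ρ' : ℝ) (z : ℂ), ρ' ≤ ρ →
      ∫ v in S ρ, (S ρ').indicator (fun _ => z) v ∂μ = μ.real (S ρ') * z := by
    intro ρ' z hle
    have hsub : S ρ' ⊆ S ρ := fun v hv => le_trans (show ‖N v‖ ≤ ρ' from hv) hle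
    rw [setIntegral_indicator (hmeas _), Set.inter_eq_self_of_subset_right hsub,
      setIntegral_const, Complex.real_smul]
  have hint : ∀ (ρ' : ℝ) (z : ℂ), IntegrableOn ((S ρ').indicator fun _ => z) (S ρ) μ := by
    intro ρ' z
    exact (integrableOn_const (hSfin ρ)).indicator (hmeas _)
  have e₃ : ∀ v, ∫ u in Metric.sphere (0 : F) 1, D.ψ (u * (c * N v)) ∂(dF p F) =
      (S ρ₁).indicator (fun _ => (1 : ℂ)) v -
        (S (‖ϖ⁻¹‖ * ρ₁)).indicator (fun _ => ((resCard F : ℝ)⁻¹ : ℂ)) v := by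
    intro v
    rw [D.setIntegral_sphere_ψ h0 h1 h2]
    simp only [Set.indicator_apply, ← hmem, ← hmem']
  simp_rw [e₃] at e₂
  have hle : ρ₁ ≤ ‖ϖ⁻¹‖ * ρ₁ := le_mul_of_one_le_left hρ₁.le hinv1
  rw [integral_sub (hint _ _) (hint _ _), hind _ _ (hle.trans hρρ), hind _ _ hρρ, hshell _ hρ₁,
    e₁] at e₂
  -- the result is negative
  have hV := hSpos ρ₁ hρ₁
  have hA : 0 < (1 - (resCard F : ℝ)⁻¹) * K :=
    mul_pos (sub_pos.2 (inv_lt_one_of_one_lt₀ hq)) hK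
  have hB : 0 < μ.real (S ρ₁) * (resCard F - 1) := mul_pos hV (sub_pos.2 hq)
  refine eq_of_pos_mul_eq ?_ (by simp) hA hB ?_
  · rw [norm_prod]; exact Finset.prod_eq_one fun i _ => D.norm_weilConst (hcoef i)
  · have hq0 : (resCard F : ℂ) ≠ 0 := by
      have : (resCard F : ℝ) ≠ 0 := by positivity
      exact_mod_cast this
    push_cast at e₂ ⊢
    rw [mul_assoc, e₂]
    field_simp
    ring

open Classical in
/-- Weil's formula: the Hilbert symbol is the Weil constant of a multiple of the quaternion norm
form. -/
theorem weilConst_mul_weilConst {a b c : F} (ha : a ≠ 0) (hb : b ≠ 0) (hc : c ≠ 0) :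
    D.weilConst c * D.weilConst (c * a * b) =
      ((hilbertSymbol a b : ℤ) : ℂ) * (D.weilConst (c * a) * D.weilConst (c * b)) := by
  have hconj : ∀ x : F, x ≠ 0 → D.weilConst x * D.weilConst (-x) = 1 := fun x hx => by
    rw [D.weilConst_neg hx, D.weilConst_mul_conj hx]
  have hca := mul_ne_zero hc ha
  have hcb := mul_ne_zero hc hb
  suffices hprod : D.weilConst c * D.weilConst (-(c * a)) * D.weilConst (-(c * b)) *
      D.weilConst (c * a * b) = ((hilbertSymbol a b : ℤ) : ℂ) by
    rw [← hprod]
    linear_combination (-(D.weilConst c * D.weilConst (c * a * b) * (D.weilConst (c * b)) *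
      (D.weilConst (-(c * b))))) * hconj _ hca
      - (D.weilConst c * D.weilConst (c * a * b)) * hconj _ hcb
  by_cases hsol : ∃ x y z : F, (x, y, z) ≠ (0, 0, 0) ∧ z ^ 2 = a * x ^ 2 + b * y ^ 2
  · rw [hilbertSymbol, if_pos hsol]
    obtain ⟨x, y, z, hne, heq⟩ := hsol
    by_cases hy : y = 0
    · have hx : x ≠ 0 := by
        rintro rfl
        apply hne
        rw [hy] at heq ⊢
        have : z = 0 := by
          apply pow_eq_zero_iff (two_ne_zero) |>.1; rw [heq]; ring
        rw [this]
      have ha' : a = (z / x) ^ 2 := by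
        rw [hy] at heq; field_simp; linear_combination -heq
      have hzx : z / x ≠ 0 := by
        intro h0; rw [h0] at ha'; exact ha (by rw [ha']; ring)
      have e1 : D.weilConst (-(c * a)) = D.weilConst (-c) := by
        rw [ha', ← neg_mul, D.weilConst_mul_sq (neg_ne_zero.2 hc) hzx]
      have e2 : D.weilConst (c * a * b) = D.weilConst (c * b) := by
        rw [mul_right_comm, ha', D.weilConst_mul_sq hcb hzx]
      rw [e1, e2]
      have h1 := hconj c hc
      have h2 := hconj _ hcb
      push_cast
      linear_combination h1 + D.weilConst c * D.weilConst (-c) * h2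
    · have hb' : (z / y) ^ 2 - a * (x / y) ^ 2 = b := by
        field_simp; linear_combination heq
      have h1 := D.weilConst_binary (c := c) (u := z / y) (v := x / y) ha hc (by rwa [hb'])
      rw [hb'] at h1
      have h2 := hconj _ hcb
      have h3 := hconj (c * b * a) (mul_ne_zero hcb ha)
      rw [h1, mul_right_comm c a b]
      push_cast
      linear_combination h2 + D.weilConst (c * b) * D.weilConst (-(c * b)) * h3
  · rw [hilbertSymbol, if_neg hsol]
    have haniso : ∀ v, diagForm (quatCoeff a b) v = 0 → v = 0 := by
      intro v hv
      rw [diagForm_quatCoeff] at hv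
      by_contra hv0
      apply hsol
      set n := v 2 ^ 2 - a * v 3 ^ 2 with hn
      by_cases hn0 : n = 0
      · by_cases h3 : v 3 = 0
        · have h2 : v 2 = 0 := by
            apply pow_eq_zero_iff (two_ne_zero) |>.1
            rw [hn, h3] at hn0; linear_combination hn0
          refine ⟨v 1, 0, v 0, ?_, by rw [h2, h3] at hv; linear_combination hv⟩
          intro h4
          rw [Prod.mk.injEq, Prod.mk.injEq] at h4
          apply hv0
          funext i
          fin_cases i
          · exact h4.2.2
          · exact h4.1
          · exact h2
          · exact h3
        · refine ⟨v 3, 0, v 2, fun h4 => h3 ?_, by linear_combination hn0⟩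
          rw [Prod.mk.injEq] at h4
          exact h4.1
      -- divide `v 0 + v 1 √a` by `v 2 + v 3 √a` in `F(√a)` and clear the denominator `n`
      · refine ⟨v 0 * v 3 - v 1 * v 2, n, v 0 * v 2 - a * v 1 * v 3, fun h4 => hn0 ?_, ?_⟩
        · rw [Prod.mk.injEq, Prod.mk.injEq] at h4
          exact h4.2.1
        · rw [hn]; linear_combination (v 2 ^ 2 - a * v 3 ^ 2) * hv
    have h1 := D.weilConst_quat_of_anisotropic ha hb hc haniso
    rw [Fin.prod_univ_four] at h1
    simp only [quatCoeff, Matrix.cons_val_zero, Matrix.cons_val_one, Matrix.cons_val, mul_one,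
      mul_neg, ← mul_assoc] at h1
    rw [h1]
    simp

end LocalDatum

/-! ### The Hilbert symbol -/

section Hilbert

variable {F : Type*} [Field F]

theorem hilbertSymbol_comm (a b : F) : hilbertSymbol a b = hilbertSymbol b a := by
  have h : ∀ a b : F, (∃ x y z : F, (x, y, z) ≠ (0, 0, 0) ∧ z ^ 2 = a * x ^ 2 + b * y ^ 2) →
      ∃ x y z : F, (x, y, z) ≠ (0, 0, 0) ∧ z ^ 2 = b * x ^ 2 + a * y ^ 2 := by
    rintro a b ⟨x, y, z, h0, h⟩
    refine ⟨y, x, z, fun h1 => h0 ?_, by rw [h, add_comm]⟩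
    simp only [Prod.mk.injEq] at h1 ⊢
    tauto
  classical
  rw [hilbertSymbol, hilbertSymbol]
  exact if_congr ⟨h a b, h b a⟩ rfl rfl

theorem hilbertSymbol_mul_sq_left (a b : F) {c : F} (hc : c ≠ 0) :
    hilbertSymbol (a * c ^ 2) b = hilbertSymbol a b := by
  classical
  rw [hilbertSymbol, hilbertSymbol]
  refine if_congr ⟨?_, ?_⟩ rfl rfl
  · rintro ⟨x, y, z, h0, h⟩
    refine ⟨c * x, y, z, fun h1 => h0 ?_, by rw [h]; ring⟩
    simp only [Prod.mk.injEq, mul_eq_zero, hc, false_or] at h1 ⊢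
    exact h1
  · rintro ⟨x, y, z, h0, h⟩
    refine ⟨c⁻¹ * x, y, z, fun h1 => h0 ?_, by rw [h]; field_simp⟩
    simp only [Prod.mk.injEq, mul_eq_zero, inv_eq_zero, hc, false_or] at h1 ⊢
    exact h1

theorem hilbertSymbol_mul_sq_right (a b : F) {c : F} (hc : c ≠ 0) :
    hilbertSymbol a (b * c ^ 2) = hilbertSymbol a b := by
  rw [hilbertSymbol_comm, hilbertSymbol_mul_sq_left _ _ hc, hilbertSymbol_comm]

theorem hilbertSymbol_inv_left {a : F} (b : F) (ha : a ≠ 0) :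
    hilbertSymbol a⁻¹ b = hilbertSymbol a b := by
  rw [← hilbertSymbol_mul_sq_left a b (inv_ne_zero ha)]
  congr 1; field_simp

theorem hilbertSymbol_inv_right (a : F) {b : F} (hb : b ≠ 0) :
    hilbertSymbol a b⁻¹ = hilbertSymbol a b := by
  rw [hilbertSymbol_comm, hilbertSymbol_inv_left _ hb, hilbertSymbol_comm]

theorem hilbertSymbol_sq_left (b c : F) : hilbertSymbol (c ^ 2) b = 1 := by
  rw [hilbertSymbol, if_pos]
  exact ⟨1, 0, c, by simp, by ring⟩

theorem hilbertSymbol_sq_right (b c : F) : hilbertSymbol b (c ^ 2) = 1 := by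
  rw [hilbertSymbol_comm, hilbertSymbol_sq_left]

theorem hilbertSymbol_one_left (b : F) : hilbertSymbol 1 b = 1 := by
  simpa using hilbertSymbol_sq_left b 1

theorem hilbertSymbol_one_right (b : F) : hilbertSymbol b 1 = 1 := by
  simpa using hilbertSymbol_sq_right b 1

end Hilbert

namespace LocalDatum

variable {p : ℕ} [Fact p.Prime] {F : Type*} [NormedField F] [NormedAlgebra ℚ_[p] F]
  [IsUltrametricDist F] (D : LocalDatum p F) [FiniteDimensional ℚ_[p] F] [ProperSpace F]
  [MeasurableSpace F] [BorelSpace F]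

/-! ### The operators of the Weil representation -/

/-- The constant `|a|^{1/2}`. -/
def sqrtAbs (_ : LocalDatum p F) (a : F) : ℂ := ((nabs p a ^ (1 / 2 : ℝ) : ℝ) : ℂ)

theorem sqrtAbs_mul (a b : F) : D.sqrtAbs (a * b) = D.sqrtAbs a * D.sqrtAbs b := by
  rw [sqrtAbs, sqrtAbs, sqrtAbs, nabs_mul, Real.mul_rpow (nabs_nonneg p a) (nabs_nonneg p b),
    Complex.ofReal_mul]

theorem sqrtAbs_mul_self (a : F) : D.sqrtAbs a * D.sqrtAbs a = nabs p a := by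
  rw [sqrtAbs, ← Complex.ofReal_mul, ← Real.mul_rpow (nabs_nonneg p a) (nabs_nonneg p a),
    ← sq, ← Real.rpow_natCast, ← Real.rpow_mul (nabs_nonneg p a)]
  norm_num

theorem sqrtAbs_one : D.sqrtAbs 1 = 1 := by simp [sqrtAbs]

theorem sqrtAbs_neg (a : F) : D.sqrtAbs (-a) = D.sqrtAbs a := by simp [sqrtAbs]

theorem sqrtAbs_ne_zero {a : F} (ha : a ≠ 0) : D.sqrtAbs a ≠ 0 := by
  have := nabs_pos p ha
  rw [sqrtAbs]; exact_mod_cast (Real.rpow_pos_of_pos this _).ne'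

theorem sqrtAbs_inv (a : F) : D.sqrtAbs a⁻¹ = (D.sqrtAbs a)⁻¹ := by
  rw [sqrtAbs, sqrtAbs, nabs_inv, Real.inv_rpow (nabs_nonneg p a), Complex.ofReal_inv]

theorem sqrtAbs_div (a b : F) : D.sqrtAbs (a / b) = D.sqrtAbs a / D.sqrtAbs b := by
  rw [div_eq_mul_inv, sqrtAbs_mul, sqrtAbs_inv, div_eq_mul_inv]

theorem conj_sqrtAbs (a : F) : conj (D.sqrtAbs a) = D.sqrtAbs a := Complex.conj_ofReal _

theorem conj_weilConst {a : F} (ha : a ≠ 0) : conj (D.weilConst a) = (D.weilConst a)⁻¹ :=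
  eq_inv_of_mul_eq_one_right (D.weilConst_mul_conj ha)

theorem opM_apply (a : F) (φ : F → ℂ) (t : F) :
    D.opM a φ t = D.weilConst 1 / D.weilConst a * D.sqrtAbs a * φ (a * t) := rfl

theorem opW_apply (a : F) (φ : F → ℂ) (t : F) :
    D.opW a φ t = conj (D.weilConst a) * D.sqrtAbs (2 * a⁻¹) * D.fourier φ (-(2 * a⁻¹ * t)) := rfl

theorem isSchwartz_opU {φ : F → ℂ} (h : IsSchwartz φ) (b : F) : IsSchwartz (D.opU b φ) :=
  h.mul_left (D.isLocallyConstant_ψ.comp_continuous (by fun_prop))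

theorem isSchwartz_opM {φ : F → ℂ} (h : IsSchwartz φ) {a : F} (ha : a ≠ 0) :
    IsSchwartz (D.opM a φ) :=
  (h.comp_mul ha).const_mul _

theorem isSchwartz_opW {φ : F → ℂ} (h : IsSchwartz φ) {a : F} (ha : a ≠ 0) :
    IsSchwartz (D.opW a φ) := by
  have := charZero_of_padic p F
  have h1 : -(2 * a⁻¹) ≠ 0 := by simp [ha]
  have h2 := ((D.isSchwartz_fourier h).comp_mul h1).const_mul
    (conj (D.weilConst a) * D.sqrtAbs (2 * a⁻¹))
  convert h2 using 2 with t
  rw [opW_apply, neg_mul]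

theorem opU_zero (φ : F → ℂ) : D.opU 0 φ = φ := by
  funext t; simp [opU]

theorem opU_opU (b b' : F) (φ : F → ℂ) : D.opU b (D.opU b' φ) = D.opU (b + b') φ := by
  funext t; rw [opU, opU, opU, add_mul, AddChar.map_add_eq_mul]; ring

theorem opM_opU (a b : F) (φ : F → ℂ) : D.opM a (D.opU b φ) = D.opU (a ^ 2 * b) (D.opM a φ) := by
  funext t; rw [opU, opM_apply, opU, opM_apply, mul_pow, mul_left_comm, mul_assoc (a ^ 2),
    mul_left_comm (a ^ 2)]

theorem opM_one (φ : F → ℂ) : D.opM 1 φ = φ := by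
  funext t
  rw [opM_apply, div_self (D.weilConst_ne_zero one_ne_zero), sqrtAbs_one, one_mul, one_mul,
    one_mul]

theorem opU_const_mul (b : F) (z : ℂ) (φ : F → ℂ) :
    D.opU b (fun t => z * φ t) = fun t => z * D.opU b φ t := by
  funext t; simp only [opU]; ring

theorem opM_const_mul (a : F) (z : ℂ) (φ : F → ℂ) :
    D.opM a (fun t => z * φ t) = fun t => z * D.opM a φ t := by
  funext t; simp only [opM_apply]; ring

theorem opW_const_mul (a : F) (z : ℂ) (φ : F → ℂ) :
    D.opW a (fun t => z * φ t) = fun t => z * D.opW a φ t := by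
  funext t; simp only [opW_apply, fourier_const_mul]; ring

theorem weilConst_mul {a b : F} (ha : a ≠ 0) (hb : b ≠ 0) :
    D.weilConst 1 * D.weilConst (a * b) =
      ((hilbertSymbol a b : ℤ) : ℂ) * (D.weilConst a * D.weilConst b) := by
  simpa using D.weilConst_mul_weilConst ha hb one_ne_zero

theorem weilConst_inv {a : F} (ha : a ≠ 0) : D.weilConst a⁻¹ = D.weilConst a := by
  rw [← D.weilConst_mul_sq ha (inv_ne_zero ha)]
  congr 1; field_simp

theorem weilConst_div {a b : F} (ha : a ≠ 0) (hb : b ≠ 0) :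
    D.weilConst (a / b) = D.weilConst (a * b) := by
  rw [← D.weilConst_mul_sq (mul_ne_zero ha hb) (inv_ne_zero hb)]
  congr 1; field_simp

theorem hilbert_mul_self (a b : F) :
    ((hilbertSymbol a b : ℤ) : ℂ) * ((hilbertSymbol a b : ℤ) : ℂ) = 1 := by
  rcases Int.units_eq_one_or (hilbertSymbol a b) with h | h <;> rw [h] <;> simp

theorem opM_opM {a b : F} (ha : a ≠ 0) (hb : b ≠ 0) (φ : F → ℂ) :
    D.opM a (D.opM b φ) = fun t => ((hilbertSymbol a b : ℤ) : ℂ) * D.opM (a * b) φ t := by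
  funext t
  have h1 := D.weilConst_mul ha hb
  have h2 := D.weilConst_ne_zero ha
  have h3 := D.weilConst_ne_zero hb
  have h4 := D.weilConst_ne_zero (mul_ne_zero ha hb)
  rw [opM_apply, opM_apply, opM_apply, sqrtAbs_mul, ← mul_assoc b, mul_comm b a]
  have h5 : D.weilConst 1 / D.weilConst a * (D.weilConst 1 / D.weilConst b) =
      ((hilbertSymbol a b : ℤ) : ℂ) * (D.weilConst 1 / D.weilConst (a * b)) := by
    field_simp
    linear_combination D.weilConst 1 * h1
  linear_combination (D.sqrtAbs a * D.sqrtAbs b * φ (a * b * t)) * h5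

theorem weilConst_mul' {a c : F} (ha : a ≠ 0) (hc : c ≠ 0) :
    D.weilConst 1 / D.weilConst a * conj (D.weilConst c) =
      ((hilbertSymbol a c : ℤ) : ℂ) * conj (D.weilConst (c * a)) := by
  have h1 := D.weilConst_mul ha hc
  have h2 := D.weilConst_ne_zero ha
  have h3 := D.weilConst_ne_zero hc
  have h4 := D.weilConst_ne_zero (mul_ne_zero hc ha)
  rw [D.conj_weilConst hc, D.conj_weilConst (mul_ne_zero hc ha)]
  rw [mul_comm a c] at h1
  field_simp
  linear_combination h1

theorem opM_opW {a c : F} (ha : a ≠ 0) (hc : c ≠ 0) (φ : F → ℂ) :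
    D.opM a (D.opW c φ) = fun t => ((hilbertSymbol a c : ℤ) : ℂ) * D.opW (c / a) φ t := by
  funext t
  have h1 := D.weilConst_mul' ha hc
  rw [opM_apply, opW_apply, opW_apply, D.weilConst_div hc ha,
    show 2 * (c / a)⁻¹ = a * (2 * c⁻¹) by field_simp, D.sqrtAbs_mul a,
    show 2 * c⁻¹ * (a * t) = a * (2 * c⁻¹) * t by ring]
  linear_combination
    (D.sqrtAbs a * D.sqrtAbs (2 * c⁻¹) * D.fourier φ (-(a * (2 * c⁻¹) * t))) * h1

theorem opW_opM {a c : F} (ha : a ≠ 0) (hc : c ≠ 0) (φ : F → ℂ) :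
    D.opW c (D.opM a φ) = fun t => ((hilbertSymbol a c : ℤ) : ℂ) * D.opW (c * a) φ t := by
  funext t
  have h1 := D.weilConst_mul' ha hc
  have h2 := D.sqrtAbs_ne_zero ha
  rw [opW_apply, opW_apply, show D.opM a φ =
    fun t => (D.weilConst 1 / D.weilConst a * D.sqrtAbs a) * φ (a * t) from rfl,
    fourier_const_mul, D.fourier_comp_mul ha, Complex.ofReal_inv, ← D.sqrtAbs_mul_self a,
    show 2 * (c * a)⁻¹ = 2 * c⁻¹ * a⁻¹ by field_simp, D.sqrtAbs_mul _ a⁻¹, sqrtAbs_inv,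
    show -(2 * c⁻¹ * t) / a = -(2 * c⁻¹ * a⁻¹ * t) by field_simp]
  have h3 : D.sqrtAbs a * (D.sqrtAbs a * D.sqrtAbs a)⁻¹ = (D.sqrtAbs a)⁻¹ := by
    field_simp
  rw [mul_assoc (D.weilConst 1 / D.weilConst a)]
  linear_combination (D.sqrtAbs (2 * c⁻¹) * (D.sqrtAbs a)⁻¹ *
    D.fourier φ (-(2 * c⁻¹ * a⁻¹ * t))) * h1 + conj (D.weilConst c) * D.sqrtAbs (2 * c⁻¹) *
    D.fourier φ (-(2 * c⁻¹ * a⁻¹ * t)) * D.weilConst 1 / D.weilConst a * h3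

theorem opW_opW {c c' : F} (hc : c ≠ 0) (hc' : c' ≠ 0) {φ : F → ℂ} (hφ : IsSchwartz φ) :
    D.opW c (D.opW c' φ) =
      fun t => ((hilbertSymbol (-c) (-c') : ℤ) : ℂ) * D.opM (-(c' / c)) φ t := by
  have := charZero_of_padic p F
  funext t
  have h0 : -(2 * c'⁻¹) ≠ 0 := by simp [hc']
  have h1 := D.weilConst_mul (neg_ne_zero.2 hc) (neg_ne_zero.2 hc')
  have h3 : D.opW c' φ = fun t => (conj (D.weilConst c') * D.sqrtAbs (2 * c'⁻¹)) *
      (fun x => D.fourier φ (-(2 * c'⁻¹) * x)) t := by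
    funext t; rw [opW_apply]; simp only [neg_mul]
  rw [h3, opW_apply, fourier_const_mul, D.fourier_comp_mul h0, D.fourier_fourier hφ,
    Complex.ofReal_inv, nabs_neg, ← D.sqrtAbs_mul_self (2 * c'⁻¹), opM_apply,
    show -(-(2 * c⁻¹ * t) / -(2 * c'⁻¹)) = -(c' / c) * t by field_simp, sqrtAbs_neg,
    ← neg_div, D.weilConst_div (neg_ne_zero.2 hc') hc]
  have h5 := D.weilConst_ne_zero (a := c) hc
  have h6 := D.weilConst_ne_zero (a := c') hc'
  have h7 : D.weilConst 1 ≠ 0 := D.weilConst_ne_zero one_ne_zero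
  have h2 : conj (D.weilConst c) * conj (D.weilConst c') =
      ((hilbertSymbol (-c) (-c') : ℤ) : ℂ) * (D.weilConst 1 / D.weilConst (-c' * c)) := by
    rw [D.weilConst_neg hc, D.weilConst_neg hc', neg_mul_neg] at h1
    rw [neg_mul, D.weilConst_neg (mul_ne_zero hc' hc), D.conj_weilConst (mul_ne_zero hc' hc),
      div_inv_eq_mul, mul_comm c']
    linear_combination (-((hilbertSymbol (-c) (-c') : ℤ) : ℂ)) * h1 -
      conj (D.weilConst c) * conj (D.weilConst c') * hilbert_mul_self (-c) (-c')
  have h8 := D.sqrtAbs_ne_zero (a := 2) two_ne_zero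
  have h9 := D.sqrtAbs_ne_zero hc
  have h10 := D.sqrtAbs_ne_zero hc'
  have h11 : D.sqrtAbs (2 * c⁻¹) * D.sqrtAbs (2 * c'⁻¹) *
      (D.sqrtAbs (2 * c'⁻¹) * D.sqrtAbs (2 * c'⁻¹))⁻¹ = D.sqrtAbs (c' / c) := by
    simp only [sqrtAbs_mul, sqrtAbs_inv, sqrtAbs_div]
    field_simp
  rw [← h11]
  linear_combination (D.sqrtAbs (2 * c⁻¹) * D.sqrtAbs (2 * c'⁻¹) *
      (D.sqrtAbs (2 * c'⁻¹) * D.sqrtAbs (2 * c'⁻¹))⁻¹ * φ (-c' / c * t)) * h2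

/-- The product of two Weyl elements and a unipotent element between them: the Gaussian integral over
the middle variable is evaluated by the identity that defines the Weil constant. -/
theorem opW_opU_opW {c c' x : F} (hc : c ≠ 0) (hc' : c' ≠ 0) (hx : x ≠ 0) {φ : F → ℂ}
    (hφ : IsSchwartz φ) {c₃ : F} (hc₃ : c₃ = c * c' * x) :
    D.opW c (D.opU x (D.opW c' φ)) = fun t => ((hilbertSymbol (c / c₃) (c' / c₃) : ℤ) : ℂ) *
      D.opU (-(c' / (c * c₃))) (D.opW c₃ (D.opU (-(c / (c' * c₃))) φ)) t := by
  have := charZero_of_padic p F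
  funext t
  have h0 : -(2 * c'⁻¹) ≠ 0 := by simp [hc']
  have h0' : 2 * c'⁻¹ ≠ 0 := by simp [hc']
  have hc₃0 : c₃ ≠ 0 := by rw [hc₃]; positivity
  have h3 : D.opU x (D.opW c' φ) = fun s => (conj (D.weilConst c') * D.sqrtAbs (2 * c'⁻¹)) *
      (D.fourier φ (-(2 * c'⁻¹) * s) * D.ψ (x * s ^ 2)) := by
    funext s; rw [opU, opW_apply, neg_mul]; ring
  set Φ : F → ℂ := fun s => D.fourier φ (-(2 * c'⁻¹) * s) * D.ψ (-(2 * c⁻¹ * t) * s) with hΦ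
  have hΦs : IsSchwartz Φ := by
    have h4 := ((D.isSchwartz_fourier hφ).comp_mul h0).mul_left
      (D.isLocallyConstant_ψ.comp_continuous (f := fun s => -(2 * c⁻¹ * t) * s) (by fun_prop))
    convert h4 using 2
    rw [hΦ]; simp only [Function.comp, mul_comm]
  have h5 := D.weilConst_spec hx hΦs
  have h6 : ∀ y, D.fourier Φ y = ((nabs p (2 * c'⁻¹))⁻¹ : ℝ) *
      φ ((2 * c'⁻¹)⁻¹ * y + -(c' * c⁻¹ * t)) := by
    intro y
    rw [hΦ, fourier_mul_ψ, D.fourier_comp_mul h0, D.fourier_fourier hφ, nabs_neg]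
    congr 2
    field_simp
  have h7 : ∫ y, D.fourier Φ y * D.ψ (-(y ^ 2 / (4 * x))) ∂(dF p F) =
      ∫ z, φ z * D.ψ (-((z * c'⁻¹ + t * c⁻¹) ^ 2 / x)) ∂(dF p F) := by
    have h8 := integral_comp_mul_left p (inv_ne_zero h0') fun u => φ (u + -(c' * c⁻¹ * t)) *
      D.ψ (-((u * c'⁻¹) ^ 2 / x))
    have h9 := integral_add_right_eq_self (μ := dF p F) (fun z =>
      φ z * D.ψ (-((z * c'⁻¹ + t * c⁻¹) ^ 2 / x))) (-(c' * c⁻¹ * t))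
    rw [← h9]
    have h10 : (fun y => D.fourier Φ y * D.ψ (-(y ^ 2 / (4 * x)))) = fun y =>
        (((nabs p (2 * c'⁻¹))⁻¹ : ℝ) : ℂ) * (φ ((2 * c'⁻¹)⁻¹ * y + -(c' * c⁻¹ * t)) *
      D.ψ (-(((2 * c'⁻¹)⁻¹ * y * c'⁻¹) ^ 2 / x))) := by
      funext y
      rw [h6, mul_assoc, show (2 * c'⁻¹)⁻¹ * y * c'⁻¹ = y / 2 by field_simp]
      congr 3
      field_simp; norm_num
    rw [h10, integral_const_mul, h8, ← mul_assoc, ← Complex.ofReal_mul, nabs_inv, inv_inv,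
      inv_mul_cancel₀ (nabs_pos p h0').ne', Complex.ofReal_one, one_mul]
    congr 1
    funext u
    congr 4
    field_simp; ring
  rw [h7] at h5
  have h11 : D.opW c₃ (D.opU (-(c / (c' * c₃))) φ) t = conj (D.weilConst c₃) *
      D.sqrtAbs (2 * c₃⁻¹) * (D.sqrtδ * ∫ z, D.ψ (-(c / (c' * c₃)) * z ^ 2) * φ z *
        D.ψ (-(2 * c₃⁻¹ * t) * z) ∂(dF p F)) := rfl
  have h12 : ∫ z, φ z * D.ψ (-((z * c'⁻¹ + t * c⁻¹) ^ 2 / x)) ∂(dF p F) =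
      D.ψ (-(c' / (c * c₃)) * t ^ 2) * ∫ z, D.ψ (-(c / (c' * c₃)) * z ^ 2) * φ z *
        D.ψ (-(2 * c₃⁻¹ * t) * z) ∂(dF p F) := by
    rw [← integral_const_mul]
    congr 1
    funext z
    rw [mul_right_comm (D.ψ _), ← AddChar.map_add_eq_mul, ← mul_assoc, ← AddChar.map_add_eq_mul,
      mul_comm]
    congr 2
    rw [hc₃]; field_simp; ring
  rw [h3, opW_apply, fourier_const_mul]
  have h13 : D.fourier (fun s => D.fourier φ (-(2 * c'⁻¹) * s) * D.ψ (x * s ^ 2))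
      (-(2 * c⁻¹ * t)) = D.sqrtδ * ∫ s, Φ s * D.ψ (x * s ^ 2) ∂(dF p F) := by
    rw [fourier, sqrtδ]; congr 2; funext s; rw [hΦ]; ring
  rw [h13, h5, h12, opU, h11]
  set I := ∫ z, D.ψ (-(c / (c' * c₃)) * z ^ 2) * φ z * D.ψ (-(2 * c₃⁻¹ * t) * z) ∂(dF p F)
  have h14 : ((nabs p (2 * x) ^ (-(1 / 2) : ℝ) : ℝ) : ℂ) = (D.sqrtAbs (2 * x))⁻¹ := by
    rw [sqrtAbs, Real.rpow_neg (nabs_nonneg p _), Complex.ofReal_inv]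
  have h15 : conj (D.weilConst c) * conj (D.weilConst c') * D.weilConst x =
      ((hilbertSymbol (c / c₃) (c' / c₃) : ℤ) : ℂ) * conj (D.weilConst c₃) := by
    have h16 := D.weilConst_mul_weilConst (a := c / c₃) (b := c' / c₃) (c := x)
      (div_ne_zero hc hc₃0) (div_ne_zero hc' hc₃0) hx
    rw [show x * (c / c₃) = c'⁻¹ by rw [hc₃]; field_simp,
      show x * (c' / c₃) = c⁻¹ by rw [hc₃]; field_simp,
      show c'⁻¹ * (c' / c₃) = c₃⁻¹ by field_simp,
      D.weilConst_inv hc, D.weilConst_inv hc', D.weilConst_inv hc₃0] at h16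
    have h17 := D.weilConst_ne_zero hc
    have h18 := D.weilConst_ne_zero hc'
    have h19 := D.weilConst_ne_zero hc₃0
    rw [D.conj_weilConst hc, D.conj_weilConst hc', D.conj_weilConst hc₃0]
    field_simp
    linear_combination h16
  rw [h14]
  have h20 : D.sqrtAbs (2 * c⁻¹) * D.sqrtAbs (2 * c'⁻¹) * (D.sqrtAbs (2 * x))⁻¹ =
      D.sqrtAbs (2 * c₃⁻¹) := by
    have h21 := D.sqrtAbs_ne_zero (a := 2) two_ne_zero
    have h22 := D.sqrtAbs_ne_zero hc
    have h23 := D.sqrtAbs_ne_zero hc'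
    have h24 := D.sqrtAbs_ne_zero hx
    rw [hc₃]
    simp only [sqrtAbs_mul, sqrtAbs_inv]
    field_simp
  rw [← h20]
  linear_combination (D.sqrtAbs (2 * c⁻¹) * D.sqrtAbs (2 * c'⁻¹) * (D.sqrtAbs (2 * x))⁻¹ *
    D.sqrtδ * D.ψ (-(c' / (c * c₃)) * t ^ 2) * I) * h15

end LocalDatum

/-! ### The multiplicativity of the Weil representation -/

section Matrices

variable {F : Type*} [Field F]

theorem mat_det_eq (g : SL2 F) : g 0 0 * g 1 1 - g 0 1 * g 1 0 = 1 := by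
  rw [← Matrix.det_fin_two]; exact g.2

theorem mat_mul_apply (g h : SL2 F) (i j : Fin 2) :
    (g * h) i j = g i 0 * h 0 j + g i 1 * h 1 j := by
  rw [Matrix.SpecialLinearGroup.coe_mul, Matrix.mul_apply, Fin.sum_univ_two]

theorem SL2_ext {g h : SL2 F} (h00 : g 0 0 = h 0 0) (h01 : g 0 1 = h 0 1) (h10 : g 1 0 = h 1 0)
    (h11 : g 1 1 = h 1 1) : g = h := by
  apply Matrix.SpecialLinearGroup.ext
  intro i j
  fin_cases i <;> fin_cases j <;> assumption

theorem inv_apply_00 (g : SL2 F) : g⁻¹ 0 0 = g 1 1 := by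
  simp [Matrix.SpecialLinearGroup.SL2_inv_expl]
theorem inv_apply_01 (g : SL2 F) : g⁻¹ 0 1 = -g 0 1 := by
  simp [Matrix.SpecialLinearGroup.SL2_inv_expl]
theorem inv_apply_10 (g : SL2 F) : g⁻¹ 1 0 = -g 1 0 := by
  simp [Matrix.SpecialLinearGroup.SL2_inv_expl]
theorem inv_apply_11 (g : SL2 F) : g⁻¹ 1 1 = g 0 0 := by
  simp [Matrix.SpecialLinearGroup.SL2_inv_expl]

theorem exists_mat {a b c d : F}
    (h : a * d - b * c = 1) :
    ∃ k : SL2 F, k 0 0 = a ∧ k 0 1 = b ∧ k 1 0 = c ∧ k 1 1 = d :=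
  ⟨⟨!![a, b; c, d], by rw [Matrix.det_fin_two_of, h]⟩, rfl, rfl, rfl, rfl⟩

theorem eq_upper_mul {g : SL2 F} (h : g 1 0 = 0) :
    ∃ (b : F) (a : Fˣ), g = upperMat b * diagMat a := by
  have h1 := mat_det_eq g
  rw [h, mul_zero, sub_zero] at h1
  have ha : g 0 0 ≠ 0 := left_ne_zero_of_mul_eq_one h1
  refine ⟨g 0 0 * g 0 1, Units.mk0 _ ha, SL2_ext ?_ ?_ ?_ ?_⟩ <;>
    refine Eq.trans ?_ (mat_mul_apply _ _ _ _).symm <;> simp [upperMat, diagMat, h]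
  · field_simp
  · exact eq_inv_of_mul_eq_one_right h1

theorem tau_of_eq_zero {g : SL2 F} (h : g 1 0 = 0) : tau g = g 1 1 := if_neg (not_not.2 h)

theorem tau_of_ne_zero {g : SL2 F} (h : g 1 0 ≠ 0) : tau g = g 1 0 := if_pos h

theorem tau_ne_zero (g : SL2 F) : tau g ≠ 0 := by
  rw [tau]
  split_ifs with h
  · exact h
  · have := mat_det_eq g
    intro h1
    rw [h1, not_not.1 h] at this
    simp at this

theorem kubota_one_left (g : SL2 F) : kubota 1 g = 1 := by
  rw [kubota, one_mul, div_self (tau_ne_zero g), hilbertSymbol_one_right]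

theorem kubota_one_right (g : SL2 F) : kubota g 1 = 1 := by
  rw [kubota, mul_one, div_self (tau_ne_zero g), hilbertSymbol_one_left]

theorem mp_mul_mat (x y : Mp F) : (x * y).mat = x.mat * y.mat := rfl

theorem mp_mul_sign (x y : Mp F) : (x * y).sign = x.sign * y.sign * kubota x.mat y.mat := rfl

theorem mp_inv_mat (x : Mp F) : (x⁻¹).mat = x.mat⁻¹ := rfl

theorem lift_mat (g : SL2 F) : (lift g).mat = g := rfl

theorem lift_sign (g : SL2 F) : (lift g).sign = 1 := rfl

theorem mp_one_mul (x : Mp F) : lift 1 * x = x := by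
  ext1
  · rw [mp_mul_mat, lift_mat, one_mul]
  · rw [mp_mul_sign, lift_mat, kubota_one_left, lift_sign, one_mul, mul_one]

theorem mp_mul_one (x : Mp F) : x * lift 1 = x := by
  ext1
  · rw [mp_mul_mat, lift_mat, mul_one]
  · rw [mp_mul_sign, lift_mat, kubota_one_right, lift_sign, mul_one, mul_one]

theorem mp_mul_inv (x : Mp F) : x * x⁻¹ = lift 1 := by
  ext1
  · rw [mp_mul_mat, mp_inv_mat, mul_inv_cancel, lift_mat]
  · rw [mp_mul_sign, mp_inv_mat, lift_sign, show (x⁻¹).sign = x.sign * kubota x.mat x.mat⁻¹ from rfl,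
      ← mul_assoc x.sign, Int.units_mul_self, one_mul, Int.units_mul_self]

theorem mp_sign_mul (ζ : ℤˣ) (x : Mp F) : (⟨1, ζ⟩ : Mp F) * x = ⟨x.mat, ζ * x.sign⟩ := by
  ext1
  · rw [mp_mul_mat, one_mul]
  · rw [mp_mul_sign, kubota_one_left, mul_one]

theorem mp_eq_sign_mul_lift (x : Mp F) : x = ⟨1, x.sign⟩ * lift x.mat := by
  rw [mp_sign_mul, lift_sign, mul_one, lift_mat]

theorem IsGenuine.eq_sign_mul {f : Mp F → ℂ} (hf : IsGenuine f) (x : Mp F) :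
    f x = ((x.sign : ℤ) : ℂ) * f (lift x.mat) := by
  rw [← hf, ← mp_eq_sign_mul_lift]

end Matrices

namespace LocalDatum

variable {p : ℕ} [Fact p.Prime] {F : Type*} [NormedField F] [NormedAlgebra ℚ_[p] F]
  [IsUltrametricDist F] (D : LocalDatum p F) [FiniteDimensional ℚ_[p] F] [ProperSpace F]
  [MeasurableSpace F] [BorelSpace F]

theorem weil_eq_sign_mul (x : Mp F) (φ : F → ℂ) (t : F) :
    D.weil x φ t = ((x.sign : ℤ) : ℂ) * D.weil (lift x.mat) φ t := by
  rw [weil, weil, lift_sign, Units.val_one, Int.cast_one, one_mul]; rfl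

theorem weil_lift_of_eq_zero {g : SL2 F} (h : g 1 0 = 0) (φ : F → ℂ) :
    D.weil (lift g) φ = D.opU (g 0 0 * g 0 1) (D.opM (g 0 0) φ) := by
  funext t; simp [weil, lift, h]

theorem weil_lift_of_ne_zero {g : SL2 F} (h : g 1 0 ≠ 0) (φ : F → ℂ) :
    D.weil (lift g) φ =
      D.opU (g 0 0 / g 1 0) (D.opW (g 1 0) (D.opU (g 1 1 / g 1 0) φ)) := by
  funext t; simp [weil, lift, h]

theorem weil_one (φ : F → ℂ) : D.weil (lift 1) φ = φ := by
  rw [weil_lift_of_eq_zero _ (by simp)]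
  simp [opM_one, opU_zero]

theorem weil_const_mul (x : Mp F) (z : ℂ) (φ : F → ℂ) :
    D.weil x (fun t => z * φ t) = fun t => z * D.weil x φ t := by
  funext t
  rw [weil_eq_sign_mul, D.weil_eq_sign_mul x φ]
  by_cases h : x.mat 1 0 = 0
  · rw [weil_lift_of_eq_zero _ h, weil_lift_of_eq_zero _ h, opM_const_mul, opU_const_mul]; ring
  · rw [weil_lift_of_ne_zero _ h, weil_lift_of_ne_zero _ h, opU_const_mul, opW_const_mul,
      opU_const_mul]; ring

theorem mat_00_ne_zero {g : SL2 F} (h : g 1 0 = 0) : g 0 0 ≠ 0 := by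
  intro h0
  have := mat_det_eq g
  rw [h0, h] at this
  simp at this

theorem mat_11_eq_inv {g : SL2 F} (h : g 1 0 = 0) : g 1 1 = (g 0 0)⁻¹ := by
  have := mat_det_eq g
  rw [h, mul_zero, sub_zero] at this
  exact eq_inv_of_mul_eq_one_right this

theorem isSchwartz_weil {φ : F → ℂ} (hφ : IsSchwartz φ) (x : Mp F) :
    IsSchwartz (D.weil x φ) := by
  have h1 : IsSchwartz (D.weil (lift x.mat) φ) := by
    by_cases h : x.mat 1 0 = 0
    · rw [weil_lift_of_eq_zero _ h]
      exact D.isSchwartz_opU (D.isSchwartz_opM hφ (mat_00_ne_zero h)) _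
    · rw [weil_lift_of_ne_zero _ h]
      exact D.isSchwartz_opU (D.isSchwartz_opW (D.isSchwartz_opU hφ _) h) _
  convert h1.const_mul ((x.sign : ℤ) : ℂ) using 2 with t
  exact D.weil_eq_sign_mul x φ t

/-- The Weil representation is multiplicative up to the cocycle of Kubota. The cases are those of the
Bruhat decomposition of `x`, `y` and `x y`. -/
theorem weil_lift_mul (x y : SL2 F) {φ : F → ℂ} (hφ : IsSchwartz φ) :
    D.weil (lift x) (D.weil (lift y) φ) =
      fun t => ((kubota x y : ℤ) : ℂ) * D.weil (lift (x * y)) φ t := by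
  have dx := mat_det_eq x
  have dy := mat_det_eq y
  have m00 := mat_mul_apply x y 0 0
  have m01 := mat_mul_apply x y 0 1
  have m10 := mat_mul_apply x y 1 0
  have m11 := mat_mul_apply x y 1 1
  by_cases hc : x 1 0 = 0
  · have ha := mat_00_ne_zero hc
    have hd := mat_11_eq_inv hc
    by_cases hc' : y 1 0 = 0
    · have ha' := mat_00_ne_zero hc'
      have hd' := mat_11_eq_inv hc'
      have hC : (x * y) 1 0 = 0 := by rw [m10, hc, hc']; ring
      have hk : kubota x y = hilbertSymbol (x 0 0) (y 0 0) := by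
        have hD : (x * y) 1 1 = (x 0 0)⁻¹ * (y 0 0)⁻¹ := by rw [m11, hc, hd, hd']; ring
        rw [kubota, tau_of_eq_zero hc, tau_of_eq_zero hc', tau_of_eq_zero hC, hD, hd, hd',
          hilbertSymbol_comm]
        congr 1 <;> field_simp
      rw [weil_lift_of_eq_zero _ hc, weil_lift_of_eq_zero _ hc', weil_lift_of_eq_zero _ hC,
        opM_opU, opU_opU, D.opM_opM ha ha', opU_const_mul, hk]
      have e1 : (x * y) 0 0 = x 0 0 * y 0 0 := by rw [m00, hc']; ring
      have e2 : (x * y) 0 0 * (x * y) 0 1 =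
          x 0 0 * x 0 1 + x 0 0 ^ 2 * (y 0 0 * y 0 1) := by
        rw [e1, m01, hd']; field_simp; ring
      rw [e2, e1]
    · have hC0 : (x * y) 1 0 = y 1 0 / x 0 0 := by rw [m10, hc, hd]; field_simp; ring
      have hC : (x * y) 1 0 ≠ 0 := by rw [hC0]; exact div_ne_zero hc' ha
      have hk : kubota x y = hilbertSymbol (x 0 0) (y 1 0) := by
        rw [kubota, tau_of_eq_zero hc, tau_of_ne_zero hc', tau_of_ne_zero hC, hC0, hd,
          hilbertSymbol_comm]
        refine Eq.trans ?_ (hilbertSymbol_inv_right _ hc')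
        congr 1 <;> field_simp
      rw [weil_lift_of_eq_zero _ hc, weil_lift_of_ne_zero _ hc', weil_lift_of_ne_zero _ hC,
        opM_opU, opU_opU, D.opM_opW ha hc', opU_const_mul, hk, hC0]
      have e1 : (x * y) 0 0 / (y 1 0 / x 0 0) =
          x 0 0 * x 0 1 + x 0 0 ^ 2 * (y 0 0 / y 1 0) := by
        rw [m00]; field_simp; ring
      have e2 : (x * y) 1 1 / (y 1 0 / x 0 0) = y 1 1 / y 1 0 := by
        rw [m11, hc, hd]; field_simp; ring
      rw [e1, e2]
  · by_cases hc' : y 1 0 = 0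
    · have ha' := mat_00_ne_zero hc'
      have hd' := mat_11_eq_inv hc'
      have hC0 : (x * y) 1 0 = x 1 0 * y 0 0 := by rw [m10, hc']; ring
      have hC : (x * y) 1 0 ≠ 0 := by rw [hC0]; exact mul_ne_zero hc ha'
      have hk : kubota x y = hilbertSymbol (y 0 0) (x 1 0) := by
        rw [kubota, tau_of_ne_zero hc, tau_of_eq_zero hc', tau_of_ne_zero hC, hC0, hd']
        refine Eq.trans ?_ ((hilbertSymbol_mul_sq_right _ _ (inv_ne_zero ha')).trans
          ((hilbertSymbol_inv_left _ ha').trans (hilbertSymbol_inv_right _ hc)))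
        congr 1 <;> field_simp
      have e3 : D.opU (x 1 1 / x 1 0 + y 0 0 * y 0 1) (D.opM (y 0 0) φ) =
          D.opM (y 0 0) (D.opU ((x 1 1 / x 1 0 + y 0 0 * y 0 1) / y 0 0 ^ 2) φ) := by
        rw [opM_opU]; congr 1; field_simp
      rw [weil_lift_of_ne_zero _ hc, weil_lift_of_eq_zero _ hc', weil_lift_of_ne_zero _ hC,
        opU_opU, e3, D.opW_opM ha' hc, opU_const_mul, hk, hC0]
      have e1 : (x * y) 0 0 / (x 1 0 * y 0 0) = x 0 0 / x 1 0 := by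
        rw [m00, hc']; field_simp; ring
      have e2 : (x * y) 1 1 / (x 1 0 * y 0 0) =
          (x 1 1 / x 1 0 + y 0 0 * y 0 1) / y 0 0 ^ 2 := by
        rw [m11, hd']; field_simp; ring
      rw [e1, e2]
    · set X := x 1 1 / x 1 0 + y 0 0 / y 1 0 with hX
      have hC3 : (x * y) 1 0 = x 1 0 * y 1 0 * X := by rw [m10, hX]; field_simp; ring
      rw [weil_lift_of_ne_zero _ hc, weil_lift_of_ne_zero _ hc', opU_opU, ← hX]
      have hφ' := D.isSchwartz_opU hφ (y 1 1 / y 1 0)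
      by_cases hX0 : X = 0
      · have hC : (x * y) 1 0 = 0 := by rw [hC3, hX0, mul_zero]
        have hdx : x 1 1 = -(x 1 0 * y 0 0 / y 1 0) := by
          rw [hX] at hX0; field_simp at hX0 ⊢; linear_combination hX0
        have e1 : (x * y) 0 0 = -(y 1 0 / x 1 0) := by
          rw [hdx] at dx
          rw [m00]; field_simp at dx ⊢; linear_combination -dx
        have hD : (x * y) 1 1 = -(x 1 0 / y 1 0) := by
          rw [mat_11_eq_inv hC, e1]; field_simp
        have hk : kubota x y = hilbertSymbol (-x 1 0) (-y 1 0) := by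
          rw [kubota, tau_of_ne_zero hc, tau_of_ne_zero hc', tau_of_eq_zero hC, hD,
            hilbertSymbol_comm]
          refine Eq.trans ?_ ((hilbertSymbol_mul_sq_left _ _ hc').trans
            (hilbertSymbol_inv_left _ (neg_ne_zero.2 hc)))
          congr 1 <;> field_simp
        rw [hX0, opU_zero, D.opW_opW hc hc' hφ', opM_opU, opU_const_mul, opU_opU,
          weil_lift_of_eq_zero _ hC, hk, e1]
        have e2 : -(y 1 0 / x 1 0) * (x * y) 0 1 =
            x 0 0 / x 1 0 + (-(y 1 0 / x 1 0)) ^ 2 * (y 1 1 / y 1 0) := by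
          have hB : x 1 0 * (x * y) 0 1 = x 0 0 * (x * y) 1 1 - y 1 1 := by
            rw [m01, m11]; linear_combination -(y 1 1) * dx
          have hB' : (x * y) 0 1 = (x 0 0 * -(x 1 0 / y 1 0) - y 1 1) / x 1 0 := by
            rw [eq_div_iff hc, mul_comm, hB, hD]
          rw [hB']; field_simp; ring
        rw [e2]
      · have hC : (x * y) 1 0 ≠ 0 := by
          rw [hC3]; exact mul_ne_zero (mul_ne_zero hc hc') hX0
        have hk : kubota x y =
            hilbertSymbol (x 1 0 / (x * y) 1 0) (y 1 0 / (x * y) 1 0) := by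
          rw [kubota, tau_of_ne_zero hc, tau_of_ne_zero hc', tau_of_ne_zero hC]
        rw [D.opW_opU_opW hc hc' hX0 hφ' hC3, opU_const_mul, opU_opU, opU_opU,
          weil_lift_of_ne_zero _ hC, hk]
        have e1 : (x * y) 0 0 / (x * y) 1 0 =
            x 0 0 / x 1 0 + -(y 1 0 / (x 1 0 * (x * y) 1 0)) := by
          rw [div_eq_iff hC, add_mul]
          rw [show -(y 1 0 / (x 1 0 * (x * y) 1 0)) * (x * y) 1 0 = -(y 1 0 / x 1 0) by
            field_simp, m10, m00]
          field_simp
          linear_combination -(y 1 0) * dx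
        have e2 : (x * y) 1 1 / (x * y) 1 0 =
            -(x 1 0 / (y 1 0 * (x * y) 1 0)) + y 1 1 / y 1 0 := by
          rw [div_eq_iff hC, add_mul]
          rw [show -(x 1 0 / (y 1 0 * (x * y) 1 0)) * (x * y) 1 0 = -(x 1 0 / y 1 0) by
            field_simp, m10, m11]
          field_simp
          linear_combination -(x 1 0) * dy
        rw [e1, e2]

theorem weil_mul (x y : Mp F) {φ : F → ℂ} (hφ : IsSchwartz φ) :
    D.weil (x * y) φ = D.weil x (D.weil y φ) := by
  funext t
  rw [weil_eq_sign_mul, D.weil_eq_sign_mul x,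
    show D.weil y φ = fun t => ((y.sign : ℤ) : ℂ) * D.weil (lift y.mat) φ t from
      funext fun t => D.weil_eq_sign_mul y φ t, weil_const_mul, D.weil_lift_mul _ _ hφ,
    mp_mul_sign, mp_mul_mat]
  push_cast
  ring

theorem weil_ne_zero (x : Mp F) {φ : F → ℂ} (hφ : IsSchwartz φ) (h0 : φ ≠ 0) :
    D.weil x φ ≠ 0 := by
  intro h
  have h1 := D.weil_mul (lift x.mat⁻¹) x hφ
  rw [h] at h1
  have h2 : D.weil (lift x.mat⁻¹) (0 : F → ℂ) = 0 := by
    have h3 := D.weil_const_mul (lift x.mat⁻¹) 0 (0 : F → ℂ)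
    simp only [Pi.zero_apply, mul_zero, zero_mul] at h3
    exact h3
  rw [h2] at h1
  apply h0
  funext t
  have h4 := congrFun h1 t
  rw [weil_eq_sign_mul, mp_mul_mat, lift_mat, inv_mul_cancel, weil_one] at h4
  rcases mul_eq_zero.1 h4 with h5 | h5
  · rcases Int.units_eq_one_or (lift x.mat⁻¹ * x).sign with h6 | h6 <;> rw [h6] at h5 <;>
      norm_num at h5
  · exact h5

theorem isSchwartz_φ₀ : IsSchwartz D.φ₀ := by
  refine isSchwartz_of_bounds (r := 1) (R := 1) one_ne_zero (fun x y hy => ?_) fun x hx => ?_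
  · rw [norm_one] at hy
    simp only [φ₀]
    congr 1
    apply propext
    refine ⟨fun h => ?_, fun h => norm_add_le_of_le' h hy⟩
    have := norm_sub_le_of_le' h hy
    rwa [add_sub_cancel_right] at this
  · rw [φ₀] at hx
    rw [norm_one]
    by_contra h0
    simp [h0] at hx

theorem φ₀_zero : D.φ₀ 0 = 1 := by simp [φ₀]

/-- The Weil representation separates the two elements of the cover over a matrix. -/
theorem mp_eq_of_weil_eq {x y : Mp F} (hm : x.mat = y.mat) {φ : F → ℂ} (hφ : IsSchwartz φ)
    (h0 : φ ≠ 0) (h : D.weil x φ = D.weil y φ) : x = y := by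
  ext1
  · exact hm
  · have h1 := D.weil_ne_zero (lift y.mat) hφ h0
    obtain ⟨t, ht⟩ := Function.ne_iff.1 h1
    have h2 := congrFun h t
    rw [weil_eq_sign_mul, D.weil_eq_sign_mul y, hm] at h2
    have h3 := mul_right_cancel₀ ht h2
    exact Units.ext (by exact_mod_cast h3)

theorem φ₀_ne_zero : D.φ₀ ≠ 0 := fun h => by
  have := congrFun h 0
  rw [φ₀_zero] at this
  exact one_ne_zero this

/-- Kubota's cocycle defines an associative multiplication: the Weil representation, which is
multiplicative, separates the points of the cover. -/
theorem mp_mul_assoc (D : LocalDatum p F) (x y z : Mp F) : x * y * z = x * (y * z) := by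
  refine D.mp_eq_of_weil_eq (by simp only [mp_mul_mat, mul_assoc]) D.isSchwartz_φ₀ D.φ₀_ne_zero ?_
  have h := D.isSchwartz_φ₀
  rw [D.weil_mul _ _ h, D.weil_mul _ _ (D.isSchwartz_weil h z), D.weil_mul _ _ h,
    D.weil_mul _ _ h]

theorem mp_inv_mul (D : LocalDatum p F) (x : Mp F) : x⁻¹ * x = lift 1 := by
  have h1 := mp_mul_inv x⁻¹
  have h2 : x⁻¹⁻¹ = x := by
    rw [← mp_one_mul x⁻¹⁻¹, ← mp_mul_inv x, D.mp_mul_assoc, h1, mp_mul_one]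
  rwa [h2] at h1

theorem mp_mul_inv_cancel_right (D : LocalDatum p F) (x y : Mp F) : x * y * y⁻¹ = x := by
  rw [D.mp_mul_assoc, mp_mul_inv, mp_mul_one]

theorem mp_inv_mul_cancel_right (D : LocalDatum p F) (x y : Mp F) : x * y⁻¹ * y = x := by
  rw [D.mp_mul_assoc, D.mp_inv_mul, mp_mul_one]

theorem mp_inv_mul_cancel_left (D : LocalDatum p F) (x y : Mp F) : x⁻¹ * (x * y) = y := by
  rw [← D.mp_mul_assoc, D.mp_inv_mul, mp_one_mul]

theorem mp_mul_inv_cancel_left (D : LocalDatum p F) (x y : Mp F) : x * (x⁻¹ * y) = y := by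
  rw [← D.mp_mul_assoc, mp_mul_inv, mp_one_mul]

/-! ### Unitarity -/

theorem innerF_opU (b : F) (φ g : F → ℂ) : D.innerF (D.opU b φ) (D.opU b g) = D.innerF φ g := by
  rw [innerF, innerF]
  congr 1
  funext t
  rw [opU, opU, map_mul (starRingEnd ℂ), conj_ψ, mul_mul_mul_comm, ← AddChar.map_add_eq_mul, add_neg_cancel,
    AddChar.map_zero_eq_one, one_mul]

theorem innerF_const_mul (a b : ℂ) (φ g : F → ℂ) :
    D.innerF (fun t => a * φ t) (fun t => b * g t) = a * conj b * D.innerF φ g := by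
  rw [innerF, innerF, ← integral_const_mul]
  congr 1; funext t
  rw [map_mul]; ring

theorem innerF_comp_mul {a : F} (ha : a ≠ 0) (φ g : F → ℂ) :
    D.innerF (fun t => φ (a * t)) (fun t => g (a * t)) =
      ((nabs p a)⁻¹ : ℝ) * D.innerF φ g :=
  integral_comp_mul_left p ha fun t => φ t * conj (g t)

theorem innerF_opM {a : F} (ha : a ≠ 0) (φ g : F → ℂ) :
    D.innerF (D.opM a φ) (D.opM a g) = D.innerF φ g := by
  have h := D.innerF_const_mul (D.weilConst 1 / D.weilConst a * D.sqrtAbs a)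
    (D.weilConst 1 / D.weilConst a * D.sqrtAbs a) (fun t => φ (a * t)) fun t => g (a * t)
  rw [D.innerF_comp_mul ha] at h
  refine h.trans ?_
  have h1 := D.weilConst_ne_zero ha
  have h2 : D.weilConst 1 ≠ 0 := D.weilConst_ne_zero one_ne_zero
  have h3 := D.sqrtAbs_ne_zero ha
  rw [map_mul, map_div₀, D.conj_weilConst ha, D.conj_weilConst one_ne_zero, conj_sqrtAbs,
    Complex.ofReal_inv, ← D.sqrtAbs_mul_self a]
  field_simp

theorem innerF_opW {a : F} (ha : a ≠ 0) {φ g : F → ℂ} (hφ : IsSchwartz φ) (hg : IsSchwartz g) :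
    D.innerF (D.opW a φ) (D.opW a g) = D.innerF φ g := by
  have := charZero_of_padic p F
  have h0 : 2 * a⁻¹ ≠ 0 := by simp [ha]
  have h := D.innerF_const_mul (conj (D.weilConst a) * D.sqrtAbs (2 * a⁻¹))
    (conj (D.weilConst a) * D.sqrtAbs (2 * a⁻¹)) (fun t => D.fourier φ (-(2 * a⁻¹) * t))
    fun t => D.fourier g (-(2 * a⁻¹) * t)
  rw [D.innerF_comp_mul (neg_ne_zero.2 h0), D.innerF_fourier hφ hg] at h
  have h4 : ∀ φ, (fun t => conj (D.weilConst a) * D.sqrtAbs (2 * a⁻¹) *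
      D.fourier φ (-(2 * a⁻¹) * t)) = D.opW a φ := by
    intro φ; funext t; rw [opW_apply, neg_mul]
  rw [h4, h4] at h
  refine h.trans ?_
  have h1 := D.weilConst_ne_zero ha
  have h3 := D.sqrtAbs_ne_zero h0
  rw [map_mul, Complex.conj_conj, D.conj_weilConst ha, conj_sqrtAbs, nabs_neg,
    Complex.ofReal_inv, ← D.sqrtAbs_mul_self (2 * a⁻¹)]
  generalize D.sqrtAbs (2 * a⁻¹) = z at h3 ⊢
  field_simp

theorem innerF_weil (x : Mp F) {φ g : F → ℂ} (hφ : IsSchwartz φ) (hg : IsSchwartz g) :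
    D.innerF (D.weil x φ) (D.weil x g) = D.innerF φ g := by
  have h1 : ∀ φ, D.weil x φ = fun t => ((x.sign : ℤ) : ℂ) * D.weil (lift x.mat) φ t :=
    fun φ => funext fun t => D.weil_eq_sign_mul x φ t
  have h2 : ((x.sign : ℤ) : ℂ) * conj ((x.sign : ℤ) : ℂ) = 1 := by
    rcases Int.units_eq_one_or x.sign with h6 | h6 <;> rw [h6] <;> simp
  rw [h1, h1, innerF_const_mul, h2, one_mul]
  by_cases h : x.mat 1 0 = 0
  · rw [weil_lift_of_eq_zero _ h, weil_lift_of_eq_zero _ h, innerF_opU,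
      D.innerF_opM (mat_00_ne_zero h)]
  · rw [weil_lift_of_ne_zero _ h, weil_lift_of_ne_zero _ h, innerF_opU,
      D.innerF_opW h (D.isSchwartz_opU hφ _) (D.isSchwartz_opU hg _), innerF_opU]

end LocalDatum

namespace LocalDatum

variable {p : ℕ} [Fact p.Prime] {F : Type*} [NormedField F] [NormedAlgebra ℚ_[p] F]
  [IsUltrametricDist F] (D : LocalDatum p F) [FiniteDimensional ℚ_[p] F] [ProperSpace F]
  [MeasurableSpace F] [BorelSpace F]

/-! ### The group `Λ` and its action on the functions on `½𝔬 / 𝔬` -/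

theorem norm_δ_pos : 0 < ‖D.δ‖ := norm_pos_iff.2 D.δ_ne_zero

theorem norm_mul_δ_le {x y : F} (hx : ‖x‖ ≤ ‖D.δ⁻¹‖) (hy : ‖y‖ ≤ ‖D.δ‖) : ‖x * y‖ ≤ 1 := by
  have h := D.norm_δ_pos
  rw [norm_mul]
  refine (mul_le_mul hx hy (norm_nonneg _) (norm_nonneg _)).trans ?_
  rw [norm_inv, inv_mul_cancel₀ h.ne']

theorem norm_mul_le_left {x y : F} {r : ℝ} (hx : ‖x‖ ≤ 1) (hy : ‖y‖ ≤ r) : ‖x * y‖ ≤ r := by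
  rw [norm_mul]
  exact (mul_le_of_le_one_left (norm_nonneg _) hx).trans hy

theorem norm_mul_le_right {x y : F} {r : ℝ} (hx : ‖x‖ ≤ r) (hy : ‖y‖ ≤ 1) : ‖x * y‖ ≤ r := by
  rw [mul_comm]; exact norm_mul_le_left hy hx

theorem Lam_mul {g h : SL2 F} (hg : g ∈ D.Lam) (hh : h ∈ D.Lam) : g * h ∈ D.Lam := by
  obtain ⟨ga, gd, gb, gc⟩ := hg
  obtain ⟨ha, hd, hb, hc⟩ := hh
  refine ⟨?_, ?_, ?_, ?_⟩ <;> rw [mat_mul_apply]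
  · exact norm_add_le_of_le' (norm_mul_le_left ga ha) (D.norm_mul_δ_le gb hc)
  · refine norm_add_le_of_le' ?_ (norm_mul_le_left gd hd)
    rw [mul_comm]; exact D.norm_mul_δ_le hb gc
  · exact norm_add_le_of_le' (norm_mul_le_left ga hb) (norm_mul_le_right gb hd)
  · exact norm_add_le_of_le' (norm_mul_le_right gc ha) (norm_mul_le_left gd hc)

theorem Lam_inv {g : SL2 F} (hg : g ∈ D.Lam) : g⁻¹ ∈ D.Lam := by
  obtain ⟨ga, gd, gb, gc⟩ := hg
  refine ⟨?_, ?_, ?_, ?_⟩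
  · rwa [inv_apply_00]
  · rwa [inv_apply_11]
  · rwa [inv_apply_01, norm_neg]
  · rwa [inv_apply_10, norm_neg]

theorem one_mem_Lam : (1 : SL2 F) ∈ D.Lam := by
  simp [Lam, GammaSet]

/-- `Λ` as a subgroup of `SL₂(F)`. -/
def LamSubgroup : Subgroup (SL2 F) where
  carrier := D.Lam
  mul_mem' := D.Lam_mul
  one_mem' := D.one_mem_Lam
  inv_mem' := D.Lam_inv

/-- `δ` as a unit of `F`. -/
def δUnit : Fˣ := Units.mk0 D.δ D.δ_ne_zero

theorem weylMat_δ_mem_Lam : weylMat D.δUnit ∈ D.Lam := by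
  refine ⟨?_, ?_, ?_, ?_⟩ <;> simp [weylMat, δUnit]

/-- Functions on `½𝔬 / 𝔬`, viewed as functions on `F`. They form a subspace that the inverse image
of `Λ` preserves. -/
def halfIntegral (_ : LocalDatum p F) : Set (F → ℂ) :=
  {v | (∀ t, v t ≠ 0 → ‖2 * t‖ ≤ 1) ∧ ∀ t y, ‖y‖ ≤ 1 → v (t + y) = v t}

theorem norm_two_le_one (_ : LocalDatum p F) : ‖(2 : F)‖ ≤ 1 := by
  have := norm_add_le_of_le' (x := (1 : F)) (y := 1) norm_one.le norm_one.le
  rwa [one_add_one_eq_two] at this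

theorem const_mul_mem_halfIntegral {v : F → ℂ} (hv : v ∈ D.halfIntegral) (z : ℂ) :
    (fun t => z * v t) ∈ D.halfIntegral :=
  ⟨fun t ht => hv.1 t (right_ne_zero_of_mul ht), fun t y hy => by simp only [hv.2 t y hy]⟩

theorem φ₀_mem_halfIntegral : D.φ₀ ∈ D.halfIntegral := by
  refine ⟨fun t ht => norm_mul_le_left D.norm_two_le_one ?_, fun t y hy => ?_⟩
  · by_contra h; exact ht (if_neg h)
  · rw [φ₀, φ₀]
    congr 1
    have := add_mem_closedBall_iff (x := t) hy
    rw [mem_closedBall_zero_iff, mem_closedBall_zero_iff] at this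
    exact propext this

theorem opU_mem_halfIntegral {v : F → ℂ} (hv : v ∈ D.halfIntegral) {b : F}
    (hb : ‖D.δ * b‖ ≤ 1) : D.opU b v ∈ D.halfIntegral := by
  refine ⟨fun t ht => hv.1 t (right_ne_zero_of_mul ht), fun t y hy => ?_⟩
  rw [opU, opU, hv.2 t y hy]
  by_cases h0 : v t = 0
  · rw [h0, mul_zero, mul_zero]
  · have h1 : ‖2 * t * y + y ^ 2‖ ≤ 1 := norm_add_le_of_le'
      (norm_mul_le_left (hv.1 t h0) hy) (by rw [sq]; exact norm_mul_le_left hy hy)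
    rw [show b * (t + y) ^ 2 = b * t ^ 2 + b * (2 * t * y + y ^ 2) by ring,
      D.ψ_add_of_small (by rw [← mul_assoc]; exact norm_mul_le_left hb h1)]

theorem opW_mem_halfIntegral {v : F → ℂ} (hv : v ∈ D.halfIntegral) {c : F}
    (hc : ‖c‖ = ‖D.δ‖) : D.opW c v ∈ D.halfIntegral := by
  have := charZero_of_padic p F
  have hδ := D.norm_δ_pos
  have h1 : ∀ t : F, ‖D.δ * -(2 * c⁻¹ * t)‖ = ‖2 * t‖ := by
    intro t
    rw [mul_neg, norm_neg, norm_mul, norm_mul, norm_mul, norm_mul, norm_inv, hc]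
    field_simp
  refine ⟨fun t ht => ?_, fun t y hy => ?_⟩
  · rw [opW_apply] at ht
    by_contra h0
    refine right_ne_zero_of_mul ht (D.fourier_eq_zero (r := 1) (fun x y hy => hv.2 x y
      (by rwa [norm_one] at hy)) ?_)
    rw [one_mul, h1]; exact not_le.1 h0
  · rw [opW_apply, opW_apply]
    congr 1
    rw [mul_add, neg_add]
    refine D.fourier_add_of_small (R := 2⁻¹) (fun x hx => ?_) ?_
    · have := hv.1 x hx
      rw [norm_mul] at this
      rw [norm_inv, ← one_div, le_div_iff₀' (norm_pos_iff.2 two_ne_zero)]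
      exact this
    · rw [show D.δ * (2⁻¹ * -(2 * c⁻¹ * y)) = 2⁻¹ * (D.δ * -(2 * c⁻¹ * y)) by ring, norm_mul, h1,
        ← norm_mul]
      rwa [inv_mul_cancel_left₀ two_ne_zero]

theorem norm_δ_mul_div_le {x c : F} (hx : ‖x‖ ≤ 1) (hc : ‖c‖ = ‖D.δ‖) : ‖D.δ * (x / c)‖ ≤ 1 := by
  have hδ := D.norm_δ_pos
  rw [norm_mul, norm_div, hc]
  rwa [mul_div_cancel₀ _ hδ.ne']

theorem weil_lift_mem_halfIntegral_aux {v : F → ℂ} (hv : v ∈ D.halfIntegral) {g : SL2 F}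
    (hg : g ∈ D.Lam) (hc : ‖g 1 0‖ = ‖D.δ‖) : D.weil (lift g) v ∈ D.halfIntegral := by
  have h0 : g 1 0 ≠ 0 := by rw [← norm_ne_zero_iff, hc]; exact D.norm_δ_pos.ne'
  rw [D.weil_lift_of_ne_zero h0]
  exact D.opU_mem_halfIntegral (D.opW_mem_halfIntegral (D.opU_mem_halfIntegral hv
    (D.norm_δ_mul_div_le hg.2.1 hc)) hc) (D.norm_δ_mul_div_le hg.1 hc)

/-- In `Λ` the diagonal entry `d` is a unit if `c ∈ 𝔭𝔡`. -/
theorem norm_11_eq_one {g : SL2 F} (hg : g ∈ D.Lam) (hc : ‖g 1 0‖ < ‖D.δ‖) : ‖g 1 1‖ = 1 := by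
  obtain ⟨ga, gd, gb, gc⟩ := hg
  refine le_antisymm gd ?_
  have hdet := mat_det_eq g
  have h1 : ‖g 0 1 * g 1 0‖ < 1 := by
    have hδ := D.norm_δ_pos
    rw [norm_mul]
    refine (mul_le_mul_of_nonneg_right gb (norm_nonneg _)).trans_lt ?_
    rwa [norm_inv, inv_mul_lt_iff₀ hδ, mul_one]
  have h2 : ‖g 0 0 * g 1 1‖ = 1 := by
    rw [show g 0 0 * g 1 1 = 1 + g 0 1 * g 1 0 by linear_combination hdet,
      norm_add_eq_left (by rwa [norm_one]), norm_one]
  rw [norm_mul] at h2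
  rw [← h2]
  exact mul_le_of_le_one_left (norm_nonneg _) ga

theorem weil_mem_halfIntegral {v : F → ℂ} (hvs : IsSchwartz v) (hv : v ∈ D.halfIntegral)
    {x : Mp F} (hx : x.mat ∈ D.Lam) : D.weil x v ∈ D.halfIntegral := by
  have h1 : D.weil (lift x.mat) v ∈ D.halfIntegral := by
    set g := x.mat
    by_cases hc : ‖g 1 0‖ = ‖D.δ‖
    · exact D.weil_lift_mem_halfIntegral_aux hv hx hc
    · have hc' : ‖g 1 0‖ < ‖D.δ‖ := lt_of_le_of_ne hx.2.2.2 hc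
      have hw := D.weylMat_δ_mem_Lam
      set w := weylMat D.δUnit with hwdef
      -- multiplication by the Weyl element makes the lower left entry a generator of `𝔡`
      have h2 := D.weil_lift_mul (g * w) w⁻¹ hvs
      rw [mul_inv_cancel_right] at h2
      have h3 : ‖w⁻¹ 1 0‖ = ‖D.δ‖ := by
        rw [inv_apply_10, norm_neg]; simp [hwdef, weylMat, δUnit]
      have h4 : ‖(g * w) 1 0‖ = ‖D.δ‖ := by
        rw [mat_mul_apply]
        simp [hwdef, weylMat, δUnit, D.norm_11_eq_one hx hc']
      have h5 := D.weil_lift_mem_halfIntegral_aux (D.weil_lift_mem_halfIntegral_aux hv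
        (D.Lam_inv hw) h3) (D.Lam_mul hx hw) h4
      rw [h2] at h5
      rcases Int.units_eq_one_or (kubota (g * w) w⁻¹) with h6 | h6
      · simpa [h6] using h5
      · simpa [h6] using D.const_mul_mem_halfIntegral h5 (-1)
  convert D.const_mul_mem_halfIntegral h1 ((x.sign : ℤ) : ℂ) using 2 with t
  exact D.weil_eq_sign_mul x v t

/-! ### Functions on the cover -/

/-- The function `g ↦ (ω_ψ(g) φ₀)(t)`. -/
def coeff (t : F) (g : Mp F) : ℂ := D.weil g D.φ₀ t

theorem conj_sign (ζ : ℤˣ) : conj ((ζ : ℤ) : ℂ) = ((ζ : ℤ) : ℂ) := by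
  simp

theorem weil_sign_mul (ζ : ℤˣ) (g : Mp F) (φ : F → ℂ) :
    D.weil (⟨1, ζ⟩ * g) φ = fun t => ((ζ : ℤ) : ℂ) * D.weil g φ t := by
  funext t
  rw [mp_sign_mul, weil_eq_sign_mul, D.weil_eq_sign_mul g]
  push_cast; ring

theorem isGenuine_coeff (t : F) : IsGenuine (D.coeff t) := by
  intro g ζ
  rw [coeff, weil_sign_mul, coeff]

theorem coeff_add (x : Mp F) (hx : x.mat ∈ D.Lam) (t : F) {y : F} (hy : ‖y‖ ≤ 1) :
    D.coeff (t + y) x = D.coeff t x :=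
  (D.weil_mem_halfIntegral D.isSchwartz_φ₀ D.φ₀_mem_halfIntegral hx).2 t y hy

theorem norm_le_of_coeff_ne_zero (x : Mp F) (hx : x.mat ∈ D.Lam) {t : F} (ht : D.coeff t x ≠ 0) :
    ‖t‖ ≤ ‖(2 : F)⁻¹‖ := by
  have := charZero_of_padic p F
  have h := (D.weil_mem_halfIntegral D.isSchwartz_φ₀ D.φ₀_mem_halfIntegral hx).1 t ht
  rw [norm_mul] at h
  rwa [norm_inv, ← one_div, le_div_iff₀' (norm_pos_iff.2 two_ne_zero)]

theorem integral_φ₀_mul (f : F → ℂ) :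
    ∫ t, D.φ₀ t * f t ∂(dF p F) = ∫ t in Metric.closedBall 0 1, f t ∂(dF p F) := by
  rw [← integral_indicator Metric.isClosed_closedBall.measurableSet]
  congr 1
  funext t
  by_cases h : ‖t‖ ≤ 1
  · rw [φ₀, if_pos h, Set.indicator_of_mem (mem_closedBall_zero_iff.2 h), one_mul]
  · rw [φ₀, if_neg h, Set.indicator_of_notMem (by rwa [mem_closedBall_zero_iff]), zero_mul]

/-- On the inverse image of `Λ` the function `e^K` is a multiple of a matrix coefficient
evaluated at `0`. -/
theorem eK_eq {x : Mp F} (hx : x.mat ∈ D.Lam) : D.eK x = D.q ^ D.e * conj (D.coeff 0 x) := by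
  rw [eK, if_pos hx, innerF, integral_φ₀_mul]
  congr 1
  have h : Set.EqOn (fun t => conj (D.weil x D.φ₀ t)) (fun _ => conj (D.coeff 0 x))
      (Metric.closedBall 0 1) := by
    intro t ht
    have := D.coeff_add x hx 0 (mem_closedBall_zero_iff.1 ht)
    rw [zero_add] at this
    change conj (D.coeff t x) = _
    rw [this]
  rw [setIntegral_congr_fun Metric.isClosed_closedBall.measurableSet h, setIntegral_const,
    measureReal_def, dF_closedBall_one]
  simp

theorem isGenuine_eK : IsGenuine D.eK := by
  intro g ζ
  rw [eK, eK]
  have h : (⟨1, ζ⟩ * g : Mp F).mat = g.mat := one_mul _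
  rw [h]
  split_ifs
  · rw [weil_sign_mul, innerF, innerF]
    simp_rw [map_mul, conj_sign, mul_left_comm _ ((ζ : ℤ) : ℂ)]
    rw [integral_const_mul]; ring
  · rw [mul_zero]

/-! ### The Weil representation near the identity -/

theorem fourier_φ₀ (x : F) : D.fourier D.φ₀ x = if ‖D.δ * x‖ ≤ 1 then D.sqrtδ else 0 := by
  have h := D.setIntegral_ψ (r := 1) one_ne_zero x
  rw [norm_one, one_mul, nabs_one] at h
  rw [fourier, integral_φ₀_mul]
  simp_rw [mul_comm x]
  rw [h, sqrtδ]
  split_ifs <;> simp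

theorem sqrtδ_eq : D.sqrtδ = D.sqrtAbs D.δ := rfl

theorem sqrtAbs_of_norm_eq_one {x : F} (hx : ‖x‖ = 1) : D.sqrtAbs x = 1 := by
  rw [sqrtAbs, nabs, hx]; simp

theorem opU_φ₀ {b : F} (hb : ‖D.δ * b‖ ≤ 1) : D.opU b D.φ₀ = D.φ₀ := by
  funext t
  rw [opU, φ₀]
  split_ifs with h
  · rw [D.ψ_eq_one, one_mul]
    rw [← mul_assoc, sq]
    exact norm_mul_le_left hb (norm_mul_le_left h h)
  · rw [mul_zero]

theorem opM_φ₀ {a : F} (ha : ‖a‖ = 1) (hsq : IsSquare a) : D.opM a D.φ₀ = D.φ₀ := by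
  obtain ⟨x, hx⟩ := hsq
  have hx0 : x ≠ 0 := by rintro rfl; simp [hx] at ha
  funext t
  have h1 : D.weilConst a = D.weilConst 1 := by
    rw [hx, ← D.weilConst_mul_sq one_ne_zero hx0, one_mul, sq]
  rw [opM_apply, h1, div_self (D.weilConst_ne_zero one_ne_zero), D.sqrtAbs_of_norm_eq_one ha,
    one_mul, one_mul, φ₀, φ₀, norm_mul, ha, one_mul]

/-- The function `φ₀` is fixed by the matrices in `Γ` whose lower right entry is a square unit.
For `c ≠ 0` completing the square reduces this to the identity that defines the Weil constant. -/
theorem weil_lift_φ₀ {k : SL2 F} (hk : k ∈ D.Lam) (hc : ‖k 1 0‖ ≤ ‖4 * D.δ‖) (hd : ‖k 1 1‖ = 1)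
    (hsq : IsSquare (k 1 1)) : D.weil (lift k) D.φ₀ = D.φ₀ := by
  have := charZero_of_padic p F
  have hδ := D.norm_δ_pos
  obtain ⟨ka, -, kb, -⟩ := hk
  have hd0 : k 1 1 ≠ 0 := by rw [← norm_ne_zero_iff, hd]; exact one_ne_zero
  have h2 : (0 : ℝ) < ‖(2 : F)‖ := norm_pos_iff.2 two_ne_zero
  have hkb : ‖D.δ * k 0 1‖ ≤ 1 := by
    rw [mul_comm]; exact D.norm_mul_δ_le kb le_rfl
  by_cases h0 : k 1 0 = 0
  · have ha : k 0 0 = (k 1 1)⁻¹ := by rw [mat_11_eq_inv h0, inv_inv]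
    rw [weil_lift_of_eq_zero _ h0, D.opM_φ₀ (by rw [ha, norm_inv, hd, inv_one])
      (by rw [ha]; exact hsq.inv), opU_φ₀]
    rw [mul_left_comm]; exact norm_mul_le_left ka hkb
  · rw [weil_lift_of_ne_zero _ h0]
    set a := k 0 0
    set b := k 0 1
    set c := k 1 0
    set d := k 1 1
    have hdet : a * d - b * c = 1 := mat_det_eq k
    have hcpos : 0 < ‖c‖ := norm_pos_iff.2 h0
    have hc4 : ‖D.δ‖⁻¹ * ‖c‖ ≤ ‖(2 : F)‖ * ‖(2 : F)‖ := by
      rw [show (4 : F) = 2 * 2 by norm_num, norm_mul, norm_mul] at hc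
      rw [inv_mul_le_iff₀ hδ]; linarith
    funext t
    rw [opU, opW_apply]
    by_cases ht : ‖t‖ ≤ 1
    · have hI := D.weilConst_spec (a := d / c) (div_ne_zero hd0 h0) D.isSchwartz_φ₀
      have hR : ∫ x, D.fourier D.φ₀ x * D.ψ (-(x ^ 2 / (4 * (d / c)))) ∂(dF p F) =
          D.fourier (D.fourier D.φ₀) 0 * D.sqrtδ⁻¹ := by
        rw [show D.fourier (D.fourier D.φ₀) 0 =
          D.sqrtδ * ∫ x, D.fourier D.φ₀ x * D.ψ (0 * x) ∂(dF p F) from rfl, mul_comm D.sqrtδ,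
          mul_inv_cancel_right₀ D.sqrtδ_ne_zero]
        congr 1
        funext x
        rw [zero_mul, AddChar.map_zero_eq_one, fourier_φ₀]
        split_ifs with hx
        · rw [D.ψ_eq_one]
          rw [mul_neg, norm_neg, show D.δ * (x ^ 2 / (4 * (d / c))) =
            (D.δ * x) * (D.δ * x) * (D.δ⁻¹ * c / (2 * 2) / d) by field_simp; norm_num]
          refine norm_mul_le_left (norm_mul_le_left hx hx) ?_
          rw [norm_div, hd, div_one, norm_div, norm_mul, norm_mul, norm_inv]
          exact div_le_one_of_le₀ hc4 (by positivity)
        · rw [zero_mul, zero_mul]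
      rw [hR, D.fourier_fourier D.isSchwartz_φ₀, neg_zero, φ₀_zero, one_mul] at hI
      have h3 : D.fourier (D.opU (d / c) D.φ₀) (-(2 * c⁻¹ * t)) = D.ψ (-(t ^ 2 / (d * c))) *
          (D.sqrtδ * ∫ x, D.φ₀ x * D.ψ (d / c * x ^ 2) ∂(dF p F)) := by
        rw [fourier, ← sqrtδ, mul_left_comm (D.ψ _), ← integral_const_mul (D.ψ _), ← integral_add_right_eq_self
          (fun y => D.opU (d / c) D.φ₀ y * D.ψ (-(2 * c⁻¹ * t) * y)) (t / d)]
        congr 2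
        funext y
        have h4 : D.φ₀ (y + t / d) = D.φ₀ y := D.φ₀_mem_halfIntegral.2 y _
          (by rwa [norm_div, hd, div_one])
        rw [opU, h4, mul_right_comm, ← AddChar.map_add_eq_mul, mul_left_comm,
          ← AddChar.map_add_eq_mul, mul_comm]
        congr 2
        field_simp; ring
      rw [h3, hI]
      have h5 : D.ψ (a / c * t ^ 2) * D.ψ (-(t ^ 2 / (d * c))) = 1 := by
        rw [← AddChar.map_add_eq_mul, show a / c * t ^ 2 + -(t ^ 2 / (d * c)) = b * (t * t) / d by
          field_simp; linear_combination (t ^ 2) * hdet, D.ψ_eq_one]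
        rw [mul_div_assoc', norm_div, hd, div_one, ← mul_assoc]
        exact norm_mul_le_left hkb (norm_mul_le_left ht ht)
      obtain ⟨x, hx⟩ := hsq
      have hx0 : x ≠ 0 := by rintro rfl; simp [hx] at hd
      have h6 : D.weilConst (d / c) = D.weilConst c := by
        rw [D.weilConst_div hd0 h0, hx, mul_comm, ← sq, D.weilConst_mul_sq h0 hx0]
      have h7 : ((nabs p (2 * (d / c)) ^ (-(1 / 2) : ℝ) : ℝ) : ℂ) =
          (D.sqrtAbs (2 * c⁻¹))⁻¹ := by
        rw [sqrtAbs, Real.rpow_neg (nabs_nonneg p _), Complex.ofReal_inv]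
        congr 3
        rw [show 2 * (d / c) = (2 * c⁻¹) * d by field_simp]
        apply nabs_eq_of_norm_eq; rw [norm_mul, hd, mul_one]
      have h8 := D.weilConst_mul_conj h0
      have h9 : D.sqrtAbs (2 * c⁻¹) ≠ 0 := D.sqrtAbs_ne_zero (by simp [h0])
      have h10 := D.sqrtδ_ne_zero
      rw [h6, h7, φ₀, if_pos ht]
      calc _ = (D.ψ (a / c * t ^ 2) * D.ψ (-(t ^ 2 / (d * c)))) *
            (D.weilConst c * conj (D.weilConst c)) *
            (D.sqrtAbs (2 * c⁻¹) * (D.sqrtAbs (2 * c⁻¹))⁻¹) * (D.sqrtδ * D.sqrtδ⁻¹) := by ring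
        _ = 1 := by rw [h5, h8, mul_inv_cancel₀ h9, mul_inv_cancel₀ h10]; ring
    · rw [φ₀, if_neg ht]
      have h3 : D.fourier (D.opU (d / c) D.φ₀) (-(2 * c⁻¹ * t)) = 0 := by
        refine D.fourier_eq_zero (r := c / (2 * D.δ)) (fun x y hy => ?_) ?_
        · rw [norm_div, norm_mul] at hy
          have hy1 : ‖D.δ * (2 * y) / c‖ ≤ 1 := by
            rw [norm_div, norm_mul, norm_mul]
            refine div_le_one_of_le₀ ?_ hcpos.le
            calc ‖D.δ‖ * (‖(2 : F)‖ * ‖y‖) ≤ ‖D.δ‖ * (‖(2 : F)‖ * (‖c‖ / (‖(2 : F)‖ * ‖D.δ‖))) := by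
                  gcongr
              _ = ‖c‖ := by field_simp
          have hy2 : ‖y‖ ≤ ‖(2 : F)‖ := by
            refine hy.trans ?_
            rw [div_le_iff₀ (by positivity)]
            rw [inv_mul_le_iff₀ hδ] at hc4
            linarith
          have hy3 : ‖y / 2‖ ≤ 1 := by
            rw [norm_div]; exact div_le_one_of_le₀ hy2 h2.le
          have hy4 : ‖y‖ ≤ 1 := hy2.trans D.norm_two_le_one
          rw [opU, opU, D.φ₀_mem_halfIntegral.2 x y hy4]
          by_cases hx : ‖x‖ ≤ 1
          · rw [show d / c * (x + y) ^ 2 = d / c * x ^ 2 + d * (2 * y / c) * (x + y / 2) by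
              field_simp; ring, D.ψ_add_of_small]
            rw [← mul_assoc, mul_left_comm]
            refine norm_mul_le_left (norm_mul_le_left hd.le ?_) (norm_add_le_of_le' hx hy3)
            rwa [mul_div_assoc']
          · rw [φ₀, if_neg hx, mul_zero, mul_zero]
        · rw [show D.δ * (c / (2 * D.δ) * -(2 * c⁻¹ * t)) = -t by
            have := D.δ_ne_zero
            field_simp, norm_neg]
          exact not_le.1 ht
      rw [h3, mul_zero, mul_zero]

/-- A neighbourhood of `1` in `SL₂(F)` whose lifts fix `φ₀`. -/
def nearOne (D : LocalDatum p F) : Set (SL2 F) :=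
  {k | k ∈ D.Lam ∧ ‖k 1 0‖ ≤ ‖4 * D.δ‖ ∧ ‖k 0 0 - 1‖ < ‖(4 : F)‖ ∧ ‖k 1 1 - 1‖ < ‖(4 : F)‖}

theorem norm_four_le_one (D : LocalDatum p F) : ‖(4 : F)‖ ≤ 1 := by
  rw [show (4 : F) = 2 * 2 by norm_num]
  exact norm_mul_le_left D.norm_two_le_one D.norm_two_le_one

theorem norm_eq_one_of_sub_lt {x : F} (D : LocalDatum p F) (h : ‖x - 1‖ < ‖(4 : F)‖) :
    ‖x‖ = 1 := by
  have := norm_add_eq_left (x := (1 : F)) (y := x - 1)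
    (by rw [norm_one]; exact h.trans_le D.norm_four_le_one)
  rwa [add_sub_cancel, norm_one] at this

theorem weil_lift_φ₀_of_mem_nearOne {k : SL2 F} (hk : k ∈ D.nearOne) :
    D.weil (lift k) D.φ₀ = D.φ₀ := by
  have := charZero_of_padic p F
  obtain ⟨h1, h2, -, h4⟩ := hk
  have h40 : (4 : F) ≠ 0 := by norm_num
  refine D.weil_lift_φ₀ h1 h2 (D.norm_eq_one_of_sub_lt h4) ?_
  have h5 := isSquare_one_sub_four_mul (F := F) (ε := (1 - k 1 1) / 4) (by
    rw [norm_div, div_lt_one (norm_pos_iff.2 h40), norm_sub_rev]; exact h4)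
  rwa [mul_div_cancel₀ _ h40, sub_sub_cancel] at h5

theorem continuous_entry {F : Type*} [NormedField F] (i j : Fin 2) :
    Continuous fun g : SL2 F => g i j :=
  (continuous_apply j).comp (Matrix.SpecialLinearGroup.continuous_apply _ continuous_id i)

theorem eventually_norm_entry_le {F : Type*} [NormedField F] (i j : Fin 2) (z : F) {r : ℝ}
    (hr : ‖(1 : SL2 F) i j - z‖ < r) : ∀ᶠ k in 𝓝 (1 : SL2 F), ‖k i j - z‖ < r :=
  (((continuous_entry i j).sub continuous_const).norm.tendsto _).eventually_lt_const hr

theorem nearOne_mem_nhds (D : LocalDatum p F) : D.nearOne ∈ 𝓝 (1 : SL2 F) := by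
  have := charZero_of_padic p F
  have h4 : (0 : ℝ) < ‖(4 : F)‖ := norm_pos_iff.2 (by norm_num)
  have hδ := D.norm_δ_pos
  filter_upwards [eventually_norm_entry_le (F := F) 0 0 1 (r := ‖(4 : F)‖) (by simp),
    eventually_norm_entry_le (F := F) 1 1 1 (r := ‖(4 : F)‖) (by simp),
    eventually_norm_entry_le (F := F) 0 1 0 (r := ‖D.δ⁻¹‖) (by simp [D.δ_ne_zero]),
    eventually_norm_entry_le (F := F) 1 0 0 (r := ‖4 * D.δ‖) (by simp [D.δ_ne_zero])]
    with k k00 k11 k01 k10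
  rw [sub_zero] at k01 k10
  refine ⟨⟨(D.norm_eq_one_of_sub_lt k00).le, (D.norm_eq_one_of_sub_lt k11).le, k01.le, ?_⟩,
    k10.le, k00, k11⟩
  exact k10.le.trans (norm_mul_le_left D.norm_four_le_one le_rfl)

theorem coeff_mul_lift {k : SL2 F} (hk : k ∈ D.nearOne) (t : F) (g : Mp F) :
    D.coeff t (g * lift k) = D.coeff t g := by
  rw [coeff, D.weil_mul _ _ D.isSchwartz_φ₀, D.weil_lift_φ₀_of_mem_nearOne hk, coeff]

end LocalDatum

/-! ### Integration over `Λ` -/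

section Instances

variable {F : Type*} [NormedField F] [ProperSpace F]

instance : SecondCountableTopology (SL2 F) :=
  have : SecondCountableTopology (Matrix (Fin 2) (Fin 2) F) :=
    inferInstanceAs (SecondCountableTopology (Fin 2 → Fin 2 → F))
  (Matrix.SpecialLinearGroup.isClosedEmbedding_val
    (n := Fin 2) (R := F)).isEmbedding.secondCountableTopology

instance : LocallyCompactSpace (SL2 F) :=
  have : LocallyCompactSpace (Matrix (Fin 2) (Fin 2) F) :=
    inferInstanceAs (LocallyCompactSpace (Fin 2 → Fin 2 → F))
  (Matrix.SpecialLinearGroup.isClosedEmbedding_val (n := Fin 2) (R := F)).locallyCompactSpace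

end Instances

/-- A function that is right invariant under a neighbourhood of `1` in its first argument and
continuous in the second is jointly continuous. -/
theorem continuous_uncurry_of_right_invariant {G X : Type*} [Group G] [TopologicalSpace G]
    [IsTopologicalGroup G] [TopologicalSpace X] {Ψ : G → X → ℂ} {U : Set G} (hU : U ∈ 𝓝 1)
    (h1 : ∀ k ∈ U, ∀ h t, Ψ (h * k) t = Ψ h t) (h2 : ∀ h, Continuous (Ψ h)) :
    Continuous (Function.uncurry Ψ) := by
  rw [continuous_iff_continuousAt]
  rintro ⟨h, t⟩
  have h3 : ∀ᶠ x : G × X in 𝓝 (h, t), Ψ h x.2 = Function.uncurry Ψ x := by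
    have h4 : Filter.Tendsto (fun x : G × X => h⁻¹ * x.1) (𝓝 (h, t)) (𝓝 1) := by
      have : Continuous fun x : G × X => h⁻¹ * x.1 := by fun_prop
      simpa using this.tendsto (h, t)
    filter_upwards [h4 hU] with x hx
    have := h1 _ hx h x.2
    rw [mul_inv_cancel_left] at this
    exact this.symm
  refine ContinuousAt.congr ?_ h3
  exact ((h2 h).comp continuous_snd).continuousAt

section Genuine

variable {F : Type*} [Field F]

theorem IsGenuine.mul_conj_eq {f g : Mp F → ℂ} (hf : IsGenuine f) (hg : IsGenuine g) {x y : Mp F}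
    (h : x.mat = y.mat) : f x * conj (g x) = f y * conj (g y) := by
  have h1 : ∀ ζ : ℤˣ, ((ζ : ℤ) : ℂ) * conj ((ζ : ℤ) : ℂ) = 1 := by
    intro ζ; rcases Int.units_eq_one_or ζ with h | h <;> rw [h] <;> simp
  rw [hf.eq_sign_mul x, hg.eq_sign_mul x, hf.eq_sign_mul y, hg.eq_sign_mul y, h, map_mul, map_mul,
    mul_mul_mul_comm, h1, mul_mul_mul_comm _ (f _), h1]

theorem IsGenuine.mul_eq {f g : Mp F → ℂ} (hf : IsGenuine f) (hg : IsGenuine g) {x y : Mp F}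
    (h : x.mat = y.mat) : f x * g x = f y * g y := by
  have h1 : ∀ ζ : ℤˣ, ((ζ : ℤ) : ℂ) * ((ζ : ℤ) : ℂ) = 1 := by
    intro ζ; rcases Int.units_eq_one_or ζ with h | h <;> rw [h] <;> simp
  rw [hf.eq_sign_mul x, hg.eq_sign_mul x, hf.eq_sign_mul y, hg.eq_sign_mul y, h,
    mul_mul_mul_comm, h1, mul_mul_mul_comm _ (f _), h1]

theorem mp_mul_sign_mul (y x : Mp F) (ζ : ℤˣ) : y * (⟨1, ζ⟩ * x) = ⟨1, ζ⟩ * (y * x) := by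
  rw [mp_sign_mul, mp_sign_mul]
  ext1
  · rfl
  · simp only [mp_mul_sign]
    rw [mul_left_comm y.sign, mul_assoc ζ]

theorem IsGenuine.comp_mul_left {f : Mp F → ℂ} (hf : IsGenuine f) (y : Mp F) :
    IsGenuine fun x => f (y * x) := fun x ζ => by
  change f (y * (⟨1, ζ⟩ * x)) = _
  rw [mp_mul_sign_mul, hf]

end Genuine

namespace LocalDatum

variable {p : ℕ} [Fact p.Prime] {F : Type*} [NormedField F] [NormedAlgebra ℚ_[p] F]
  [IsUltrametricDist F] (D : LocalDatum p F) [FiniteDimensional ℚ_[p] F] [ProperSpace F]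
  [MeasurableSpace F] [BorelSpace F]

instance : D.dG.IsHaarMeasure := by unfold dG; infer_instance

theorem isCompact_Lam : IsCompact D.Lam := isCompact_GammaSet p _ _

theorem measurableSet_Lam : MeasurableSet D.Lam := D.isCompact_Lam.isClosed.measurableSet

theorem dG_real_Lam : D.dG.real D.Lam = 1 := by
  have : D.dG D.Lam = 1 := Measure.haarMeasure_self (K₀ := D.LamCompact)
  rw [measureReal_def, this, ENNReal.toReal_one]

theorem setIntegral_Lam_mul_left {k : SL2 F} (hk : k ∈ D.Lam) (Ψ : SL2 F → ℂ) :
    ∫ h in D.Lam, Ψ (k * h) ∂D.dG = ∫ h in D.Lam, Ψ h ∂D.dG := by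
  rw [← integral_indicator D.measurableSet_Lam, ← integral_indicator D.measurableSet_Lam,
    ← integral_mul_left_eq_self (D.Lam.indicator Ψ) k]
  congr 1
  funext h
  have : k * h ∈ D.Lam ↔ h ∈ D.Lam := D.LamSubgroup.mul_mem_cancel_left hk
  by_cases hh : h ∈ D.Lam
  · rw [Set.indicator_of_mem hh, Set.indicator_of_mem (this.2 hh)]
  · rw [Set.indicator_of_notMem hh, Set.indicator_of_notMem (mt this.1 hh)]

theorem upperMat_mem_Lam {b : F} (hb : ‖D.δ * b‖ ≤ 1) : upperMat b ∈ D.Lam := by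
  have hδ := D.norm_δ_pos
  refine ⟨?_, ?_, ?_, ?_⟩
  · simp [upperMat]
  · simp [upperMat]
  · rw [norm_mul] at hb
    rw [norm_inv, ← one_div, le_div_iff₀' hδ]
    simpa [upperMat] using hb
  · simp [upperMat]

/-- The pairing of genuine functions over `Λ`. The integrand is a function on `SL₂(F)`, the
signs of the two factors cancel. -/
def pairing (f g : Mp F → ℂ) : ℂ := ∫ h in D.Lam, f (lift h) * conj (g (lift h)) ∂D.dG

theorem pairing_mul_left {f g : Mp F → ℂ} (hf : IsGenuine f) (hg : IsGenuine g) {y : Mp F}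
    (hy : y.mat ∈ D.Lam) :
    D.pairing (fun x => f (y * x)) (fun x => g (y * x)) = D.pairing f g := by
  rw [pairing, pairing,
    ← D.setIntegral_Lam_mul_left hy fun h => f (lift h) * conj (g (lift h))]
  congr 1
  funext h
  exact hf.mul_conj_eq hg rfl

/-- Functions that transform under different characters of the unipotent elements of `Λ` are
orthogonal over `Λ`. -/
theorem pairing_eq_zero {f g : Mp F → ℂ} (hf : IsGenuine f) (hg : IsGenuine g) {b : F}
    (hb : ‖D.δ * b‖ ≤ 1) {x y : F} (hfx : ∀ g, f (uSharp b * g) = D.ψ (b * x) * f g)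
    (hgy : ∀ x, g (uSharp b * x) = D.ψ (b * y) * g x) (hne : D.ψ (b * (x - y)) ≠ 1) :
    D.pairing f g = 0 := by
  have h1 := D.pairing_mul_left hf hg (y := uSharp b) (D.upperMat_mem_Lam hb)
  have h2 : D.pairing (fun x => f (uSharp b * x)) (fun x => g (uSharp b * x)) =
      D.ψ (b * (x - y)) * D.pairing f g := by
    rw [pairing, pairing, ← integral_const_mul]
    congr 1
    funext h
    rw [hfx, hgy, map_mul (starRingEnd ℂ), conj_ψ, mul_sub, sub_eq_add_neg,
      AddChar.map_add_eq_mul]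
    ring
  rw [h2] at h1
  by_contra h0
  exact hne (mul_right_cancel₀ h0 (h1.trans (one_mul _).symm))

theorem weil_uSharp (b : F) (φ : F → ℂ) : D.weil (uSharp b) φ = D.opU b φ := by
  rw [uSharp, weil_lift_of_eq_zero _ (by simp [upperMat])]
  simp [upperMat, opM_one]

theorem coeff_uSharp_mul (b t : F) (g : Mp F) :
    D.coeff t (uSharp b * g) = D.ψ (b * t ^ 2) * D.coeff t g := by
  rw [coeff, D.weil_mul _ _ D.isSchwartz_φ₀, weil_uSharp]; rfl

theorem exists_b_ne_one {z : F} (hz : 1 < ‖z‖) : ∃ b : F, ‖D.δ * b‖ ≤ 1 ∧ D.ψ (b * z) ≠ 1 := by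
  obtain ⟨y, h1, h2⟩ := D.exists_ψ_ne_one (t := z / D.δ)
    (by rwa [mul_div_cancel₀ _ D.δ_ne_zero])
  refine ⟨y / D.δ, by rwa [mul_div_cancel₀ _ D.δ_ne_zero], ?_⟩
  rwa [div_mul_comm]

theorem pairing_coeff_eq_zero {f : Mp F → ℂ} (hf : IsGenuine f)
    (hfu : ∀ b g, f (uSharp b * g) = f g) {t : F} (ht : 1 < ‖t‖) :
    D.pairing f (D.coeff t) = 0 := by
  obtain ⟨b, h1, h2⟩ := D.exists_b_ne_one (z := 0 - t ^ 2)
    (by rw [zero_sub, norm_neg, norm_pow]; exact one_lt_pow₀ ht two_ne_zero)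
  exact D.pairing_eq_zero hf (D.isGenuine_coeff t) h1 (x := 0) (y := t ^ 2)
    (fun g => by rw [hfu, mul_zero, AddChar.map_zero_eq_one, one_mul])
    (fun g => D.coeff_uSharp_mul b t g) h2

theorem pairing_coeff_coeff_eq_zero {s t : F} (hs : ‖2 * s‖ ≤ 1) (ht : 1 < ‖t‖) :
    D.pairing (D.coeff (t + s)) (D.coeff s) = 0 := by
  obtain ⟨b, h1, h2⟩ := D.exists_b_ne_one (z := (t + s) ^ 2 - s ^ 2) (by
    rw [show (t + s) ^ 2 - s ^ 2 = t * (t + 2 * s) by ring, norm_mul,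
      norm_add_eq_left (hs.trans_lt ht)]
    exact one_lt_mul_of_lt_of_le ht ht.le)
  exact D.pairing_eq_zero (D.isGenuine_coeff _) (D.isGenuine_coeff _) h1
    (fun g => D.coeff_uSharp_mul _ _ g) (fun g => D.coeff_uSharp_mul _ _ g) h2

theorem pairing_coeff_add_right (f : Mp F → ℂ) (t : F) {y : F} (hy : ‖y‖ ≤ 1) :
    D.pairing f (D.coeff (t + y)) = D.pairing f (D.coeff t) :=
  setIntegral_congr_fun D.measurableSet_Lam fun h hh => by
    simp only [D.coeff_add (lift h) hh t hy]

theorem pairing_coeff_add_left (g : Mp F → ℂ) (t : F) {y : F} (hy : ‖y‖ ≤ 1) :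
    D.pairing (D.coeff (t + y)) g = D.pairing (D.coeff t) g :=
  setIntegral_congr_fun D.measurableSet_Lam fun h hh => by
    simp only [D.coeff_add (lift h) hh t hy]

/-- The integral over `½𝔬` of a function supported on `𝔬` and constant there. -/
theorem setIntegral_half_eq {f : F → ℂ} {c : ℂ} (h1 : ∀ t, ‖t‖ ≤ 1 → f t = c)
    (h2 : ∀ t, 1 < ‖t‖ → f t = 0) :
    ∫ t in Metric.closedBall 0 ‖(2 : F)⁻¹‖, f t ∂(dF p F) = c := by
  have h3 : f = (Metric.closedBall 0 1).indicator fun _ => c := by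
    funext t
    by_cases ht : ‖t‖ ≤ 1
    · rw [Set.indicator_of_mem (mem_closedBall_zero_iff.2 ht), h1 t ht]
    · rw [Set.indicator_of_notMem (by rwa [mem_closedBall_zero_iff]), h2 t (not_le.1 ht)]
  have h4 : Metric.closedBall (0 : F) 1 ⊆ Metric.closedBall 0 ‖(2 : F)⁻¹‖ := by
    have := charZero_of_padic p F
    apply Metric.closedBall_subset_closedBall
    have h5 : ‖(2 : F)‖ ≤ 1 := by
      have := norm_add_le_of_le' (x := (1 : F)) (y := 1) norm_one.le norm_one.le
      rwa [one_add_one_eq_two] at this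
    rw [norm_inv]
    exact (one_le_inv₀ (norm_pos_iff.2 two_ne_zero)).2 h5
  rw [h3, setIntegral_indicator Metric.isClosed_closedBall.measurableSet,
    Set.inter_eq_self_of_subset_right h4, setIntegral_const, measureReal_def, dF_closedBall_one]
  simp

theorem isSchwartz_coeff (g : Mp F) : IsSchwartz fun t => D.coeff t g :=
  D.isSchwartz_weil D.isSchwartz_φ₀ g

theorem integral_coeff_mul {x : Mp F} (hx : x.mat ∈ D.Lam) (f : F → ℂ) :
    ∫ t, D.coeff t x * f t ∂(dF p F) =
      ∫ t in Metric.closedBall 0 ‖(2 : F)⁻¹‖, D.coeff t x * f t ∂(dF p F) := by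
  rw [setIntegral_eq_integral_of_forall_compl_eq_zero]
  intro t ht
  by_contra h0
  exact ht (mem_closedBall_zero_iff.2 (D.norm_le_of_coeff_ne_zero x hx (left_ne_zero_of_mul h0)))

theorem continuous_mul_conj_coeff {f : Mp F → ℂ} (hf : IsGenuine f) {U : Set (SL2 F)}
    (hU : U ∈ 𝓝 1) (hfU : ∀ k ∈ U, ∀ g, f (g * lift k) = f g) :
    Continuous (Function.uncurry fun (h : SL2 F) (t : F) =>
      f (lift h) * conj (D.coeff t (lift h))) := by
  refine continuous_uncurry_of_right_invariant (Filter.inter_mem hU D.nearOne_mem_nhds)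
    (fun k hk h t => ?_) fun h => ?_
  · rw [hf.mul_conj_eq (D.isGenuine_coeff t) (x := lift (h * k)) (y := lift h * lift k) rfl,
      hfU k hk.1, D.coeff_mul_lift hk.2]
  · have := (D.isSchwartz_coeff (lift h)).continuous
    fun_prop

/-- By unitarity, `e^K(k⁻¹h)` is an integral of products of coefficients at `k` and `h`. -/
theorem eK_inv_mul {k h : SL2 F} (hk : k ∈ D.Lam) (hh : h ∈ D.Lam) :
    D.eK ((lift k)⁻¹ * lift h) =
      D.q ^ D.e * ∫ t, D.coeff t (lift k) * conj (D.coeff t (lift h)) ∂(dF p F) := by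
  have hmem : ((lift k)⁻¹ * lift h).mat ∈ D.Lam := D.Lam_mul (D.Lam_inv hk) hh
  rw [eK, if_pos hmem, ← D.innerF_weil (lift k) D.isSchwartz_φ₀ (D.isSchwartz_weil
    D.isSchwartz_φ₀ _), ← D.weil_mul _ _ D.isSchwartz_φ₀, D.mp_mul_inv_cancel_left]
  rfl

/-- The operator `ρ(e^K)` maps a function invariant under the unipotent group to a multiple of the
coefficient `g ↦ (ω_ψ(g) φ₀)(0)` on the inverse image of `Λ`. -/
theorem rho_eK_lift {f : Mp F → ℂ} (hf : IsGenuine f) (hfu : ∀ b g, f (uSharp b * g) = f g)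
    {U : Set (SL2 F)} (hU : U ∈ 𝓝 1) (hfU : ∀ k ∈ U, ∀ g, f (g * lift k) = f g) {k : SL2 F}
    (hk : k ∈ D.Lam) :
    D.rho D.eK f (lift k) =
      D.q ^ D.e * D.pairing f (D.coeff 0) * D.coeff 0 (lift k) := by
  have h1 : ∀ h, D.eK (lift (k⁻¹ * h)) * f (lift k * lift (k⁻¹ * h)) =
      D.Lam.indicator (fun h => D.q ^ D.e * ∫ t in Metric.closedBall 0 ‖(2 : F)⁻¹‖,
        D.coeff t (lift k) * (f (lift h) * conj (D.coeff t (lift h))) ∂(dF p F)) h := by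
    intro h
    by_cases hh : h ∈ D.Lam
    · have h2 := D.isGenuine_eK.mul_eq (hf.comp_mul_left (lift k)) (x := lift (k⁻¹ * h))
        (y := (lift k)⁻¹ * lift h) rfl
      rw [Set.indicator_of_mem hh, h2, D.mp_mul_inv_cancel_left, D.eK_inv_mul hk hh,
        ← D.integral_coeff_mul (x := lift k) hk, mul_assoc, ← integral_mul_const]
      congr 2
      funext t
      ring
    · have : k⁻¹ * h ∉ D.Lam := mt (D.LamSubgroup.mul_mem_cancel_left (D.Lam_inv hk)).1 hh
      rw [Set.indicator_of_notMem hh, eK, if_neg (show (lift (k⁻¹ * h)).mat ∉ D.Lam from this),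
        zero_mul]
  rw [rho, ← integral_mul_left_eq_self _ k⁻¹]
  simp_rw [h1]
  have hcont := D.continuous_mul_conj_coeff hf hU hfU
  have hck := (D.isSchwartz_coeff (lift k)).continuous
  rw [integral_indicator D.measurableSet_Lam, integral_const_mul,
    setIntegral_swap D.dG (dF p F) D.isCompact_Lam (isCompact_closedBall _ _)
      (f := fun h t => D.coeff t (lift k) * (f (lift h) * conj (D.coeff t (lift h))))
      ((hck.comp continuous_snd).mul hcont), mul_assoc]
  congr 1
  simp_rw [integral_const_mul]
  refine setIntegral_half_eq (fun t ht => ?_) fun t ht => ?_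
  · have h2 := D.coeff_add (lift k) hk 0 ht
    have h3 := D.pairing_coeff_add_right f 0 ht
    rw [zero_add] at h2 h3
    rw [h2, mul_comm, ← h3]; rfl
  · have h3 := D.pairing_coeff_eq_zero hf hfu ht
    rw [pairing] at h3
    rw [h3, mul_zero]

theorem weil_wEl (c : Fˣ) (φ : F → ℂ) : D.weil (wEl c) φ = D.opW c φ := by
  rw [wEl, weil_lift_of_ne_zero _ (by simp [weylMat])]
  simp [weylMat, opU_zero]

theorem coeff_zero_wEl_mul (g : Mp F) (hg : g.mat ∈ D.Lam) :
    D.coeff 0 (wEl D.δUnit * g) = conj (D.weilConst D.δ) * D.sqrtAbs 2 *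
      ∫ t in Metric.closedBall 0 ‖(2 : F)⁻¹‖, D.coeff t g ∂(dF p F) := by
  have h1 := D.integral_coeff_mul hg fun _ => 1
  simp only [mul_one] at h1
  have h2 : D.fourier (D.weil g D.φ₀) 0 = D.sqrtδ * ∫ t, D.coeff t g ∂(dF p F) := by
    rw [fourier, sqrtδ]
    simp_rw [zero_mul, AddChar.map_zero_eq_one, mul_one]
    rfl
  have h3 : D.sqrtAbs D.δ ≠ 0 := D.sqrtAbs_ne_zero D.δ_ne_zero
  rw [coeff, D.weil_mul _ _ D.isSchwartz_φ₀, weil_wEl, opW_apply, mul_zero, neg_zero, h2, h1,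
    show (D.δUnit : F) = D.δ from rfl, sqrtAbs_mul, sqrtAbs_inv, sqrtδ_eq]
  field_simp

theorem innerF_φ₀ : D.innerF D.φ₀ D.φ₀ = 1 := by
  rw [innerF, integral_φ₀_mul]
  have h : Set.EqOn (fun t => conj (D.φ₀ t)) (fun _ => 1) (Metric.closedBall 0 1) := by
    intro t ht
    simp [φ₀, mem_closedBall_zero_iff.1 ht]
  rw [setIntegral_congr_fun Metric.isClosed_closedBall.measurableSet h, setIntegral_const,
    measureReal_def, dF_closedBall_one]
  simp

theorem integral_pairing_coeff_self :
    ∫ s in Metric.closedBall 0 ‖(2 : F)⁻¹‖, D.pairing (D.coeff s) (D.coeff s) ∂(dF p F) = 1 := by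
  have hcont : Continuous (Function.uncurry fun (s : F) (h : SL2 F) =>
      D.coeff s (lift h) * conj (D.coeff s (lift h))) := by
    have h1 := continuous_uncurry_of_right_invariant (Ψ := fun (h : SL2 F) (s : F) =>
      D.coeff s (lift h) * conj (D.coeff s (lift h))) D.nearOne_mem_nhds (fun k hk h s => by
        have hg := D.isGenuine_coeff s
        rw [hg.mul_conj_eq hg (x := lift (h * k)) (y := lift h * lift k) rfl,
          D.coeff_mul_lift hk]) (fun h => by
        have := (D.isSchwartz_coeff (lift h)).continuous
        fun_prop)
    exact h1.comp continuous_swap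
  simp_rw [pairing]
  rw [setIntegral_swap (dF p F) D.dG (isCompact_closedBall _ _) D.isCompact_Lam hcont]
  have h2 : Set.EqOn (fun h => ∫ s in Metric.closedBall 0 ‖(2 : F)⁻¹‖,
      D.coeff s (lift h) * conj (D.coeff s (lift h)) ∂(dF p F)) (fun _ => 1) D.Lam := by
    intro h hh
    have h3 := D.innerF_weil (lift h) D.isSchwartz_φ₀ D.isSchwartz_φ₀
    rw [innerF_φ₀] at h3
    exact (D.integral_coeff_mul (x := lift h) hh _).symm.trans h3
  rw [setIntegral_congr_fun D.measurableSet_Lam h2, setIntegral_const, dG_real_Lam]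
  simp

/-- The norm of the coefficient `g ↦ (ω_ψ(g) φ₀)(0)` over `Λ`. Translation by the Weyl element
turns the value at `0` into an average over `½𝔬 / 𝔬`, where different points are orthogonal. -/
theorem pairing_coeff_zero : D.pairing (D.coeff 0) (D.coeff 0) = nabs p (2 : F) := by
  have hg := D.isGenuine_coeff 0
  set I : Mp F → ℂ := fun g => ∫ t in Metric.closedBall 0 ‖(2 : F)⁻¹‖, D.coeff t g ∂(dF p F)
    with hI
  have hIg : IsGenuine I := by
    intro g ζ
    simp only [hI]
    rw [← integral_const_mul]
    congr 1
    funext t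
    exact D.isGenuine_coeff t g ζ
  have hIU : ∀ k ∈ D.nearOne, ∀ g, I (g * lift k) = I g := by
    intro k hk g
    simp only [hI, D.coeff_mul_lift hk]
  have h1 : D.pairing (D.coeff 0) (D.coeff 0) =
      nabs p (2 : F) * ∫ h in D.Lam, I (lift h) * conj (I (lift h)) ∂D.dG := by
    rw [← D.pairing_mul_left hg hg (y := wEl D.δUnit) D.weylMat_δ_mem_Lam, pairing,
      ← integral_const_mul]
    refine setIntegral_congr_fun D.measurableSet_Lam fun h hh => ?_
    simp only [D.coeff_zero_wEl_mul (lift h) hh, ← D.sqrtAbs_mul_self (2 : F), map_mul,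
      Complex.conj_conj, conj_sqrtAbs]
    have h2 := D.weilConst_mul_conj D.δ_ne_zero
    linear_combination (D.sqrtAbs 2 * D.sqrtAbs 2 * I (lift h) * conj (I (lift h))) * h2
  have h2 : ∀ h, I (lift h) * conj (I (lift h)) = ∫ s in Metric.closedBall 0 ‖(2 : F)⁻¹‖,
      I (lift h) * conj (D.coeff s (lift h)) ∂(dF p F) := by
    intro h
    rw [integral_const_mul, integral_conj]
  simp_rw [h2] at h1
  rw [setIntegral_swap D.dG (dF p F) D.isCompact_Lam (isCompact_closedBall _ _)
    (D.continuous_mul_conj_coeff hIg D.nearOne_mem_nhds hIU)] at h1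
  have h3 : Set.EqOn (fun s => ∫ h in D.Lam, I (lift h) * conj (D.coeff s (lift h)) ∂D.dG)
      (fun s => D.pairing (D.coeff s) (D.coeff s)) (Metric.closedBall 0 ‖(2 : F)⁻¹‖) := by
    intro s hs
    have h4 : ∀ h, I (lift h) * conj (D.coeff s (lift h)) =
        ∫ t in Metric.closedBall 0 ‖(2 : F)⁻¹‖,
          D.coeff t (lift h) * conj (D.coeff s (lift h)) ∂(dF p F) := by
      intro h; rw [integral_mul_const]
    have hcont : Continuous (Function.uncurry fun (h : SL2 F) (t : F) =>
        D.coeff t (lift h) * conj (D.coeff s (lift h))) :=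
      continuous_uncurry_of_right_invariant D.nearOne_mem_nhds (fun k hk h t => by
        rw [(D.isGenuine_coeff t).mul_conj_eq (D.isGenuine_coeff s) (x := lift (h * k))
          (y := lift h * lift k) rfl, D.coeff_mul_lift hk, D.coeff_mul_lift hk]) (fun h => by
        have := (D.isSchwartz_coeff (lift h)).continuous
        fun_prop)
    simp only [h4]
    rw [setIntegral_swap D.dG (dF p F) D.isCompact_Lam (isCompact_closedBall _ _) hcont]
    change ∫ t in Metric.closedBall 0 ‖(2 : F)⁻¹‖, D.pairing (D.coeff t) (D.coeff s) ∂(dF p F) = _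
    have hs' := mem_closedBall_zero_iff.1 hs
    rw [← setIntegral_comp_add (dF p F) s fun x => add_mem_closedBall_iff hs']
    have h2s : ‖2 * s‖ ≤ 1 := by
      have := charZero_of_padic p F
      rwa [norm_inv, ← one_div, le_div_iff₀' (norm_pos_iff.2 two_ne_zero), ← norm_mul] at hs'
    refine setIntegral_half_eq (fun t ht => ?_) fun t ht => ?_
    · rw [add_comm, D.pairing_coeff_add_left _ _ ht]
    · exact D.pairing_coeff_coeff_eq_zero h2s ht
  rw [setIntegral_congr_fun Metric.isClosed_closedBall.measurableSet h3,
    integral_pairing_coeff_self, mul_one] at h1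
  exact h1

end LocalDatum

/-! ### Vanishing of Gauss sums at odd levels -/

/-- If `2` is not a unit, every integer is a square modulo `𝔭`, as the residue field is perfect of
characteristic `2`. -/
theorem exists_sq_approx {F : Type*} [NormedField F] [IsUltrametricDist F] [ProperSpace F]
    (h2 : ‖(2 : F)‖ < 1) {x : F} (hx : ‖x‖ ≤ 1) : ∃ z : F, ‖z‖ ≤ 1 ∧ ‖x - z ^ 2‖ < 1 := by
  have := finite_residueField F
  have h20 : ((2 : ℕ) : IsLocalRing.ResidueField (integerRing F)) = 0 := by
    have h := (residue_eq_zero_iff_norm (F := F) (x := (2 : integerRing F))).2 h2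
    rw [map_ofNat] at h
    exact_mod_cast h
  have hchar := CharP.ringChar_of_prime_eq_zero Nat.prime_two h20
  obtain ⟨y, hy⟩ := FiniteField.isSquare_of_char_two hchar
    (IsLocalRing.residue (integerRing F) ⟨x, mem_integerRing.2 hx⟩)
  obtain ⟨z, rfl⟩ := IsLocalRing.residue_surjective y
  refine ⟨z, mem_integerRing.1 z.2, ?_⟩
  rw [← map_mul] at hy
  have h := residue_eq_iff_norm.1 hy
  rw [sq]
  exact h

namespace LocalDatum

variable {p : ℕ} [Fact p.Prime] {F : Type*} [NormedField F] [NormedAlgebra ℚ_[p] F]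
  [IsUltrametricDist F] (D : LocalDatum p F) [FiniteDimensional ℚ_[p] F] [ProperSpace F]
  [MeasurableSpace F] [BorelSpace F]

theorem one_lt_q (_ : LocalDatum p F) : (1 : ℝ) < resCard F := by
  exact_mod_cast one_lt_resCard F

theorem nabs_two : nabs p (2 : F) = (resCard F : ℝ) ^ (-(D.e : ℤ)) := by
  have := charZero_of_padic p F
  have h := nabs_eq_zpow_ordF p (two_ne_zero (α := F))
  have h1 : nabs p (2 : F) ≤ 1 := (nabs_le_one_iff p).2 D.norm_two_le_one
  have h2 : 0 ≤ ordF p (2 : F) := by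
    by_contra! hneg
    have := one_lt_zpow₀ D.one_lt_q (n := -ordF p (2 : F)) (by omega)
    rw [← h] at this
    linarith
  rw [h, e, Int.toNat_of_nonneg h2]

theorem nabs_four : nabs p (4 : F) = (resCard F : ℝ) ^ (-(2 * D.e : ℤ)) := by
  have hq := D.one_lt_q
  rw [show (4 : F) = 2 * 2 by norm_num, nabs_mul, D.nabs_two, ← zpow_add₀ (by linarith)]
  congr 1; ring

/-- The quadratic Gauss sum `∫_𝔬 ψ(u t²) dt` vanishes if `uδ` has odd order `-n` with
`0 < n < 2e`. -/
theorem fourier_opU_φ₀_eq_zero {u : F} {m : ℕ} (hm : m + 1 ≤ D.e)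
    (hu : nabs p (D.δ * u) = (resCard F : ℝ) ^ (2 * m + 1 : ℤ)) :
    D.fourier (D.opU u D.φ₀) 0 = 0 := by
  have hq := D.one_lt_q
  have hq0 : (resCard F : ℝ) ≠ 0 := by linarith
  obtain ⟨ϖ, h0, h1, h2⟩ := exists_uniformizer p F
  have hϖ := nabs_uniformizer p h0 h1 h2
  have hN2 := D.nabs_two
  have h2lt : ‖(2 : F)‖ < 1 := by
    rw [← not_le]
    intro hle
    have := (nabs_le_nabs_iff p (x := (1 : F)) (y := 2)).2 (by rwa [norm_one])
    rw [nabs_one, hN2] at this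
    have h3 := zpow_lt_one_of_neg₀ hq (n := -(D.e : ℤ)) (by omega)
    linarith
  have hA : nabs p (D.δ * (u * ϖ ^ (2 * m))) = resCard F := by
    rw [← mul_assoc, nabs_mul, hu, nabs_pow, hϖ, inv_pow, ← zpow_natCast, ← zpow_neg,
      ← zpow_add₀ hq0]
    push_cast
    rw [show (2 * m + 1 + -(2 * m) : ℤ) = 1 by ring, zpow_one]
  obtain ⟨x, hx, hψ⟩ := D.exists_ψ_ne_one (t := u * ϖ ^ (2 * m)) (by
    rw [← not_le, ← nabs_le_one_iff p, hA]; exact not_le.2 hq)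
  obtain ⟨z, hz, hxz⟩ := exists_sq_approx h2lt hx
  -- translation by `ϖ ^ m * z` multiplies the Gauss sum by this value
  have hψz : D.ψ (u * (ϖ ^ m * z) ^ 2) ≠ 1 := by
    rw [show u * (ϖ ^ m * z) ^ 2 = u * ϖ ^ (2 * m) * x + -(u * ϖ ^ (2 * m) * (x - z ^ 2)) by ring,
      D.ψ_add_of_small]
    · exact hψ
    · rw [mul_neg, norm_neg, ← mul_assoc, ← nabs_le_one_iff p, nabs_mul, hA]
      have := (nabs_le_nabs_iff p).2 (h2 _ hxz)
      rw [hϖ] at this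
      calc (resCard F : ℝ) * nabs p (x - z ^ 2) ≤ resCard F * (resCard F : ℝ)⁻¹ := by gcongr
        _ = 1 := mul_inv_cancel₀ hq0
  have hy : ‖ϖ ^ m * z‖ ≤ 1 :=
    norm_mul_le_left (by rw [norm_pow]; exact pow_le_one₀ (norm_nonneg _) h1.le) hz
  have hI : ∫ t in Metric.closedBall 0 1, D.ψ (u * t ^ 2) ∂(dF p F) = 0 := by
    have h3 := setIntegral_comp_add (dF p F) (ϖ ^ m * z)
      (fun x => add_mem_closedBall_iff hy) fun t => D.ψ (u * t ^ 2)
    have h4 : Set.EqOn (fun t => D.ψ (u * (t + ϖ ^ m * z) ^ 2))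
        (fun t => D.ψ (u * (ϖ ^ m * z) ^ 2) * D.ψ (u * t ^ 2)) (Metric.closedBall 0 1) := by
      intro t ht
      have ht' := mem_closedBall_zero_iff.1 ht
      simp only
      rw [← AddChar.map_add_eq_mul, show u * (t + ϖ ^ m * z) ^ 2 =
        u * (ϖ ^ m * z) ^ 2 + u * t ^ 2 + 2 * u * ϖ ^ m * (z * t) by ring, D.ψ_add_of_small]
      rw [← mul_assoc]
      refine norm_mul_le_left ?_ (norm_mul_le_left hz ht')
      rw [← nabs_le_one_iff p, show D.δ * (2 * u * ϖ ^ m) = 2 * ϖ ^ m * (D.δ * u) by ring,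
        nabs_mul, hu, nabs_mul, nabs_pow, hϖ, hN2, inv_pow, ← zpow_natCast, ← zpow_neg,
        ← zpow_add₀ hq0, ← zpow_add₀ hq0]
      exact zpow_le_one_of_nonpos₀ hq.le (by omega)
    rw [setIntegral_congr_fun Metric.isClosed_closedBall.measurableSet h4,
      integral_const_mul] at h3
    by_contra hne
    exact hψz (mul_right_cancel₀ hne (h3.trans (one_mul _).symm))
  rw [fourier]
  have h5 : (fun y => D.opU u D.φ₀ y * D.ψ (0 * y)) = fun y => D.φ₀ y * D.ψ (u * y ^ 2) := by
    funext y
    rw [opU, zero_mul, AddChar.map_zero_eq_one, mul_one, mul_comm]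
  rw [h5, integral_φ₀_mul, hI, mul_zero]

/-- The coefficient at `0` vanishes where `c / δ` has odd order below `2e`. -/
theorem coeff_zero_eq_zero {k : SL2 F} (hk : k ∈ D.Lam) {m : ℕ} (hm : m + 1 ≤ D.e)
    (hc : nabs p (k 1 0 / D.δ) = (resCard F : ℝ) ^ (-(2 * m + 1 : ℤ))) :
    D.coeff 0 (lift k) = 0 := by
  have hq := D.one_lt_q
  have h0 : k 1 0 ≠ 0 := by
    intro h0
    rw [h0, zero_div, nabs_zero] at hc
    exact (zpow_pos (by linarith : (0 : ℝ) < resCard F) _).ne hc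
  have hd : ‖k 1 1‖ = 1 := by
    refine D.norm_11_eq_one hk ?_
    have h1 : ‖k 1 0 / D.δ‖ < 1 := by
      rw [← not_le]
      intro hle
      have := (nabs_le_nabs_iff p (x := (1 : F)) (y := k 1 0 / D.δ)).2 (by rwa [norm_one])
      rw [nabs_one, hc] at this
      have h3 := zpow_lt_one_of_neg₀ hq (n := -(2 * m + 1 : ℤ)) (by omega)
      linarith
    rwa [norm_div, div_lt_one D.norm_δ_pos] at h1
  rw [coeff, weil_lift_of_ne_zero _ h0, opU, opW_apply, mul_zero, neg_zero,
    D.fourier_opU_φ₀_eq_zero hm, mul_zero, mul_zero]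
  rw [show D.δ * (k 1 1 / k 1 0) = k 1 1 * (k 1 0 / D.δ)⁻¹ by
    have := D.δ_ne_zero; field_simp, nabs_mul, nabs_inv, hc, ← zpow_neg, neg_neg]
  rw [nabs, hd, one_pow, one_mul]

/-! ### Height and depth -/

/-- The norm of the lower row `(c / δ, d)`. -/
def rowNorm (g : SL2 F) : ℝ := max ‖g 1 0 / D.δ‖ ‖g 1 1‖

/-- The height of `g`: the modulus `|a|` of the torus part in the decomposition
`g = u(b) m(a) k` with `k ∈ Λ`. -/
def height (g : SL2 F) : ℝ := (D.rowNorm g ^ Module.finrank ℚ_[p] F)⁻¹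

/-- The level of `g` relative to `Λ`: on `Λ` it is `max(|c / δ|, |4|)`, extended to a function
that is left invariant under the upper triangular matrices. -/
def depth (g : SL2 F) : ℝ :=
  (max ‖g 1 0 / D.δ‖ (‖(4 : F)‖ * D.rowNorm g) / D.rowNorm g) ^ Module.finrank ℚ_[p] F

theorem rowNorm_pos (g : SL2 F) : 0 < D.rowNorm g := by
  rw [rowNorm, lt_max_iff, norm_pos_iff, norm_pos_iff]
  by_contra! h
  have hdet := mat_det_eq g
  rw [h.2, (div_eq_zero_iff.1 h.1).resolve_right D.δ_ne_zero] at hdet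
  simp at hdet

theorem height_pos (g : SL2 F) : 0 < D.height g := by
  have := D.rowNorm_pos g
  unfold height; positivity

theorem norm_div_δ_le {c : F} {r : ℝ} (h : ‖c‖ ≤ r * ‖D.δ‖) : ‖c / D.δ‖ ≤ r := by
  rw [norm_div, div_le_iff₀ D.norm_δ_pos]; exact h

theorem mul_lift_10_div (g k : SL2 F) : (g * k) 1 0 / D.δ =
    g 1 0 / D.δ * k 0 0 + g 1 1 * (k 1 0 / D.δ) := by
  rw [mat_mul_apply]; ring

theorem rowNorm_mul_le (g : SL2 F) {k : SL2 F} (hk : k ∈ D.Lam) :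
    D.rowNorm (g * k) ≤ D.rowNorm g := by
  obtain ⟨ka, kd, kb, kc⟩ := hk
  have h1 : ‖g 1 0 / D.δ‖ ≤ D.rowNorm g := le_max_left _ _
  have h2 : ‖g 1 1‖ ≤ D.rowNorm g := le_max_right _ _
  refine max_le ?_ ?_
  · rw [mul_lift_10_div]
    exact norm_add_le_of_le' (norm_mul_le_right h1 ka)
      (norm_mul_le_right h2 (D.norm_div_δ_le (by rwa [one_mul])))
  · rw [mat_mul_apply, show g 1 0 * k 0 1 = g 1 0 / D.δ * (k 0 1 * D.δ) by
      have := D.δ_ne_zero; field_simp]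
    exact norm_add_le_of_le' (norm_mul_le_right h1 (D.norm_mul_δ_le kb le_rfl))
      (norm_mul_le_right h2 kd)

theorem rowNorm_mul (g : SL2 F) {k : SL2 F} (hk : k ∈ D.Lam) :
    D.rowNorm (g * k) = D.rowNorm g := by
  refine le_antisymm (D.rowNorm_mul_le g hk) ?_
  have := D.rowNorm_mul_le (g * k) (D.Lam_inv hk)
  rwa [mul_inv_cancel_right] at this

theorem height_mul (g : SL2 F) {k : SL2 F} (hk : k ∈ D.Lam) : D.height (g * k) = D.height g := by
  rw [height, height, D.rowNorm_mul g hk]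

theorem rowNorm_of_mem {k : SL2 F} (hk : k ∈ D.Lam) : D.rowNorm k = 1 := by
  have := D.rowNorm_mul 1 hk
  rw [one_mul] at this
  rw [this]
  simp [rowNorm]

theorem height_of_mem {k : SL2 F} (hk : k ∈ D.Lam) : D.height k = 1 := by
  rw [height, D.rowNorm_of_mem hk, one_pow, inv_one]

theorem upper_mul_10 (b : F) (a : Fˣ) (g : SL2 F) :
    (upperMat b * diagMat a * g) 1 0 = (a : F)⁻¹ * g 1 0 := by
  rw [mat_mul_apply, mat_mul_apply _ _ 1 0, mat_mul_apply _ _ 1 1]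
  simp [upperMat, diagMat]

theorem upper_mul_11 (b : F) (a : Fˣ) (g : SL2 F) :
    (upperMat b * diagMat a * g) 1 1 = (a : F)⁻¹ * g 1 1 := by
  rw [mat_mul_apply, mat_mul_apply _ _ 1 0, mat_mul_apply _ _ 1 1]
  simp [upperMat, diagMat]

theorem rowNorm_upper_mul (b : F) (a : Fˣ) (g : SL2 F) :
    D.rowNorm (upperMat b * diagMat a * g) = ‖(a : F)‖⁻¹ * D.rowNorm g := by
  rw [rowNorm, rowNorm, upper_mul_10, upper_mul_11, mul_div_assoc, norm_mul, norm_mul, norm_inv,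
    mul_max_of_nonneg _ _ (inv_nonneg.2 (norm_nonneg _))]

theorem height_upper_mul (b : F) (a : Fˣ) (g : SL2 F) :
    D.height (upperMat b * diagMat a * g) = nabs p (a : F) * D.height g := by
  rw [height, height, rowNorm_upper_mul, mul_pow, mul_inv, inv_pow, inv_inv]; rfl

theorem depth_upper_mul (b : F) (a : Fˣ) (g : SL2 F) :
    D.depth (upperMat b * diagMat a * g) = D.depth g := by
  have ha : 0 < ‖(a : F)‖⁻¹ := inv_pos.2 (norm_pos_iff.2 a.ne_zero)
  rw [depth, depth, rowNorm_upper_mul, upper_mul_10, mul_div_assoc, norm_mul, norm_inv,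
    mul_left_comm ‖(4 : F)‖, ← mul_max_of_nonneg _ _ ha.le, mul_div_mul_left _ _ ha.ne']

theorem nearOne_inv {k : SL2 F} (hk : k ∈ D.nearOne) : k⁻¹ ∈ D.nearOne := by
  obtain ⟨h1, h2, h3, h4⟩ := hk
  refine ⟨D.Lam_inv h1, ?_, ?_, ?_⟩
  · rwa [inv_apply_10, norm_neg]
  · rwa [inv_apply_00]
  · rwa [inv_apply_11]

theorem depth_mul (g : SL2 F) {k : SL2 F} (hk : k ∈ D.nearOne) : D.depth (g * k) = D.depth g := by
  have key : ∀ (g : SL2 F) {k : SL2 F}, k ∈ D.nearOne →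
      max ‖(g * k) 1 0 / D.δ‖ (‖(4 : F)‖ * D.rowNorm g) ≤
        max ‖g 1 0 / D.δ‖ (‖(4 : F)‖ * D.rowNorm g) := by
    rintro g k ⟨h1, h2, h3, -⟩
    refine max_le ?_ (le_max_right _ _)
    rw [mul_lift_10_div]
    refine norm_add_le_of_le' ((norm_mul_le_right le_rfl
      (D.norm_eq_one_of_sub_lt h3).le).trans (le_max_left _ _)) (le_trans ?_ (le_max_right _ _))
    rw [norm_mul, mul_comm]
    exact mul_le_mul (D.norm_div_δ_le (by rwa [norm_mul] at h2)) (le_max_right _ _)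
      (norm_nonneg _) (norm_nonneg _)
  rw [depth, depth, D.rowNorm_mul g hk.1]
  congr 2
  refine le_antisymm (key g hk) ?_
  have := key (g * k) (D.nearOne_inv hk)
  rwa [mul_inv_cancel_right, D.rowNorm_mul g hk.1] at this

theorem depth_of_mem {k : SL2 F} (hk : k ∈ D.Lam) :
    D.depth k = max ‖k 1 0 / D.δ‖ ‖(4 : F)‖ ^ Module.finrank ℚ_[p] F := by
  rw [depth, D.rowNorm_of_mem hk, mul_one, div_one]

theorem depth_of_le {k : SL2 F} (hk : k ∈ D.Lam) (h : ‖(4 : F)‖ ≤ ‖k 1 0 / D.δ‖) :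
    D.depth k = nabs p (k 1 0 / D.δ) := by
  rw [D.depth_of_mem hk, max_eq_left h]; rfl

theorem depth_of_le' {k : SL2 F} (hk : k ∈ D.Lam) (h : ‖k 1 0 / D.δ‖ ≤ ‖(4 : F)‖) :
    D.depth k = nabs p (4 : F) := by
  rw [D.depth_of_mem hk, max_eq_right h]; rfl

theorem zpow_q_injective (D : LocalDatum p F) {m n : ℤ}
    (h : (resCard F : ℝ) ^ m = (resCard F : ℝ) ^ n) : m = n :=
  zpow_right_injective₀ (by linarith [D.one_lt_q]) D.one_lt_q.ne' h

/-- On `Λ` the set `𝒳_r` is the level set of the depth function. -/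
theorem mem_X_iff {k : SL2 F} (hk : k ∈ D.Lam) {r : ℕ} (hr : r ≤ D.e) :
    k ∈ D.X r ↔ D.depth k = (resCard F : ℝ) ^ (-(2 * r : ℤ)) := by
  have hq := D.one_lt_q
  have h4 := D.nabs_four
  rw [X]
  split_ifs with hre
  · constructor
    · rintro ⟨-, h0, hord⟩
      have h1 := nabs_eq_zpow_ordF p (div_ne_zero h0 D.δ_ne_zero)
      rw [hord] at h1
      rw [D.depth_of_le hk, h1]
      rw [← nabs_le_nabs_iff p, h1, h4]
      exact zpow_le_zpow_right₀ hq.le (by omega)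
    · intro h
      rcases le_total ‖(4 : F)‖ ‖k 1 0 / D.δ‖ with hle | hle
      · rw [D.depth_of_le hk hle] at h
        refine ⟨hk, fun h0 => ?_, ordF_eq_of_nabs p h⟩
        rw [h0, zero_div, nabs_zero] at h
        exact (zpow_pos (by linarith : (0 : ℝ) < resCard F) _).ne h
      · rw [D.depth_of_le' hk hle, h4] at h
        have := D.zpow_q_injective h
        omega
  · obtain rfl : r = D.e := by omega
    have hΓ : k ∈ D.Gam ↔ ‖k 1 0 / D.δ‖ ≤ ‖(4 : F)‖ := by
      rw [norm_div, div_le_iff₀ D.norm_δ_pos, ← norm_mul]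
      exact ⟨fun h => h.2.2.2, fun h => ⟨hk.1, hk.2.1, hk.2.2.1, h⟩⟩
    rw [hΓ, ← h4]
    refine ⟨fun h => D.depth_of_le' hk h, fun h => ?_⟩
    by_contra! hlt
    rw [D.depth_of_le hk hlt.le] at h
    exact hlt.not_ge ((nabs_le_nabs_iff p).1 h.le)

/-- Off the sets `𝒳_r` the coefficient vanishes. -/
theorem coeff_zero_eq_zero_of_depth {k : SL2 F} (hk : k ∈ D.Lam)
    (h : ∀ r ≤ D.e, D.depth k ≠ (resCard F : ℝ) ^ (-(2 * r : ℤ))) :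
    D.coeff 0 (lift k) = 0 := by
  have hq := D.one_lt_q
  have h4 := D.nabs_four
  have hlt : ‖(4 : F)‖ < ‖k 1 0 / D.δ‖ := by
    by_contra! hle
    exact h D.e le_rfl (by rw [D.depth_of_le' hk hle, h4])
  have hc0 : k 1 0 / D.δ ≠ 0 := norm_pos_iff.1 ((norm_nonneg _).trans_lt hlt)
  have h1 := nabs_eq_zpow_ordF p hc0
  set n := ordF p (k 1 0 / D.δ)
  have hle1 : nabs p (k 1 0 / D.δ) ≤ 1 :=
    (nabs_le_one_iff p).2 (D.norm_div_δ_le (by rw [one_mul]; exact hk.2.2.2))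
  have hn0 : 0 ≤ n := by
    by_contra! hneg
    have := one_lt_zpow₀ hq (n := -n) (by omega)
    rw [← h1] at this
    linarith
  have hn2 : n < 2 * D.e := by
    have h5 : nabs p (4 : F) < nabs p (k 1 0 / D.δ) := by
      rw [← not_le, nabs_le_nabs_iff p]; exact not_le.2 hlt
    rw [h1, h4, zpow_lt_zpow_iff_right₀ hq] at h5
    omega
  rcases Int.even_or_odd' n with ⟨m, hm | hm⟩
  · exfalso
    refine h m.toNat (by omega) ?_
    rw [D.depth_of_le hk hlt.le, h1, hm, Int.toNat_of_nonneg (by omega)]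
  · refine D.coeff_zero_eq_zero hk (m := m.toNat) (by omega) ?_
    rw [h1, hm, Int.toNat_of_nonneg (by omega)]

end LocalDatum

/-! ### The induced representation -/

theorem zpow_cpow {x : ℝ} (hx : 0 < x) (m : ℤ) (z : ℂ) :
    ((x ^ m : ℝ) : ℂ) ^ z = (x : ℂ) ^ ((m : ℂ) * z) := by
  have h1 : (x : ℂ) ≠ 0 := by exact_mod_cast hx.ne'
  have h2 : ((x ^ m : ℝ) : ℂ) ≠ 0 := by exact_mod_cast (zpow_pos hx m).ne'
  rw [Complex.cpow_def_of_ne_zero h1, Complex.cpow_def_of_ne_zero h2,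
    ← Complex.ofReal_log (zpow_pos hx m).le, ← Complex.ofReal_log hx.le, Real.log_zpow]
  push_cast
  congr 1; ring

namespace LocalDatum

variable {p : ℕ} [Fact p.Prime] {F : Type*} [NormedField F] [NormedAlgebra ℚ_[p] F]
  [IsUltrametricDist F] (D : LocalDatum p F) [FiniteDimensional ℚ_[p] F] [ProperSpace F]
  [MeasurableSpace F] [BorelSpace F]

/-- The transformation law of the induced representation under the upper triangular matrices. -/
def IsEquivariant (s : ℂ) (f : Mp F → ℂ) : Prop :=
  ∀ (b : F) (a : Fˣ) (g : Mp F), f (uSharp b * mDiag a * g) =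
    D.weilConst 1 / D.weilConst (a : F) * ((nabs p (a : F) : ℝ) : ℂ) ^ (s + 1) * f g

variable {D} {s : ℂ}

theorem IsEquivariant.mul_right {f : Mp F → ℂ} (hf : D.IsEquivariant s f) (y : Mp F) :
    D.IsEquivariant s fun x => f (x * y) := fun b a g => by
  change f (uSharp b * mDiag a * g * y) = _
  rw [D.mp_mul_assoc, hf]

theorem _root_.MetaplecticSL2.IsGenuine.mul_right (D : LocalDatum p F) {f : Mp F → ℂ}
    (hf : IsGenuine f) (y : Mp F) : IsGenuine fun x => f (x * y) := fun g ζ => by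
  change f (⟨1, ζ⟩ * g * y) = _
  rw [D.mp_mul_assoc, hf]

theorem mDiag_one : mDiag (1 : Fˣ) = lift 1 := by
  rw [mDiag]; congr 1
  apply SL2_ext <;> simp [diagMat]

theorem IsEquivariant.uSharp_mul {f : Mp F → ℂ} (hf : D.IsEquivariant s f) (b : F) (g : Mp F) :
    f (uSharp b * g) = f g := by
  have h := hf b 1 g
  rwa [mDiag_one, mp_mul_one, Units.val_one, div_self (D.weilConst_ne_zero one_ne_zero), nabs_one,
    Complex.ofReal_one, Complex.one_cpow, one_mul, one_mul] at h

/-- The Iwasawa decomposition: every element of `SL₂(F)` is the product of an upper triangular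
matrix and an element of `Λ`. -/
theorem exists_iwasawa (D : LocalDatum p F) (g : SL2 F) :
    ∃ k ∈ D.Lam, ∃ (b : F) (a : Fˣ), g = upperMat b * diagMat a * k := by
  have hδ0 := D.δ_ne_zero
  have hδ := D.norm_δ_pos
  have h10 : ∀ k : SL2 F, (g * k⁻¹) 1 0 = g 1 0 * k 1 1 - g 1 1 * k 1 0 := by
    intro k
    rw [mat_mul_apply, inv_apply_00, inv_apply_10]; ring
  have key : ∃ k ∈ D.Lam, (g * k⁻¹) 1 0 = 0 := by
    rcases le_or_gt ‖g 1 0 / D.δ‖ ‖g 1 1‖ with h | h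
    · have hd : g 1 1 ≠ 0 := by
        intro h0
        have h1 := D.rowNorm_pos g
        rw [rowNorm, max_eq_right h, h0, norm_zero] at h1
        exact lt_irrefl _ h1
      have h2 : ‖g 1 0 / g 1 1‖ ≤ ‖D.δ‖ := by
        rw [norm_div, div_le_iff₀ hδ] at h
        rw [norm_div, div_le_iff₀ (norm_pos_iff.2 hd)]; linarith
      obtain ⟨k, ka, kb, kc, kd⟩ := exists_mat (a := 1) (b := 0) (c := g 1 0 / g 1 1) (d := 1)
        (by ring)
      refine ⟨k, ⟨?_, ?_, ?_, ?_⟩, ?_⟩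
      · rw [ka, norm_one]
      · rw [kd, norm_one]
      · rw [kb, norm_zero]; exact norm_nonneg _
      · rwa [kc]
      · rw [h10, kc, kd]; field_simp; ring
    · have hc : g 1 0 ≠ 0 := by
        rintro h0
        rw [h0, zero_div, norm_zero] at h
        exact (norm_nonneg _).not_gt h
      have h2 : ‖g 1 1 * D.δ / g 1 0‖ ≤ 1 := by
        rw [norm_div, norm_mul, div_le_one (norm_pos_iff.2 hc)]
        rw [norm_div, lt_div_iff₀ hδ] at h
        exact h.le
      obtain ⟨k, ka, kb, kc, kd⟩ := exists_mat (a := 0) (b := -D.δ⁻¹) (c := D.δ)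
        (d := g 1 1 * D.δ / g 1 0) (by field_simp; ring)
      refine ⟨k, ⟨?_, ?_, ?_, ?_⟩, ?_⟩
      · rw [ka, norm_zero]; exact zero_le_one
      · rwa [kd]
      · rw [kb, norm_neg]
      · rw [kc]
      · rw [h10, kc, kd]; field_simp; ring
  obtain ⟨k, hk, h0⟩ := key
  obtain ⟨b, a, h⟩ := eq_upper_mul h0
  exact ⟨k, hk, b, a, by rw [← h, inv_mul_cancel_right]⟩

/-- A genuine equivariant function is determined by its restriction to the inverse image
of `Λ`. -/
theorem eq_of_eqOn_Lam {f g : Mp F → ℂ} (hf : IsGenuine f) (hf' : D.IsEquivariant s f)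
    (hg : IsGenuine g) (hg' : D.IsEquivariant s g)
    (h : ∀ k ∈ D.Lam, f (lift k) = g (lift k)) : f = g := by
  funext x
  obtain ⟨k, hk, b, a, hx⟩ := exists_iwasawa D x.mat
  have h1 : x.mat = (uSharp b * mDiag a * lift k).mat := hx
  rw [hf.eq_sign_mul x, hg.eq_sign_mul x, h1]
  have h2 := hf.eq_sign_mul (uSharp b * mDiag a * lift k)
  have h3 := hg.eq_sign_mul (uSharp b * mDiag a * lift k)
  rw [hf', h k hk] at h2
  rw [hg'] at h3
  rw [h2] at h3
  rcases Int.units_eq_one_or (uSharp b * mDiag a * lift k).sign with h4 | h4 <;>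
    rw [h4] at h3 <;> simpa using h3

variable (D s)

/-- The function `g ↦ H(g)^{s + 1/2} (ω_ψ(g) φ₀)(0)`, where `H` is the height. -/
def sph (g : Mp F) : ℂ := (D.height g.mat : ℂ) ^ (s + 1 / 2) * D.coeff 0 g

theorem sph_lift {k : SL2 F} (hk : k ∈ D.Lam) : D.sph s (lift k) = D.coeff 0 (lift k) := by
  rw [sph, lift_mat, D.height_of_mem hk, Complex.ofReal_one, Complex.one_cpow, one_mul]

theorem isGenuine_sph : IsGenuine (D.sph s) := by
  intro g ζ
  rw [sph, sph, D.isGenuine_coeff, mp_sign_mul]; ring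

theorem weil_mDiag (a : Fˣ) (φ : F → ℂ) : D.weil (mDiag a) φ = D.opM a φ := by
  rw [mDiag, weil_lift_of_eq_zero _ (by simp [diagMat])]
  simp [diagMat, opU_zero]

theorem coeff_zero_mul (b : F) (a : Fˣ) (g : Mp F) :
    D.coeff 0 (uSharp b * mDiag a * g) =
      D.weilConst 1 / D.weilConst (a : F) * D.sqrtAbs a * D.coeff 0 g := by
  rw [D.mp_mul_assoc, coeff_uSharp_mul, coeff, D.weil_mul _ _ D.isSchwartz_φ₀, weil_mDiag,
    opM_apply, mul_zero]
  simp [coeff]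

theorem isEquivariant_sph : D.IsEquivariant s (D.sph s) := by
  intro b a g
  have ha := nabs_pos p a.ne_zero
  rw [sph, sph, coeff_zero_mul, mp_mul_mat, mp_mul_mat]
  change ((D.height (upperMat b * diagMat a * g.mat) : ℝ) : ℂ) ^ (s + 1 / 2) * _ = _
  rw [height_upper_mul, Complex.ofReal_mul, Complex.mul_cpow_ofReal_nonneg ha.le
    (D.height_pos _).le, sqrtAbs, Complex.ofReal_cpow ha.le]
  have h5 : (nabs p (a : F) : ℂ) ^ (s + 1) =
      (nabs p (a : F) : ℂ) ^ (s + 1 / 2) * (nabs p (a : F) : ℂ) ^ ((1 / 2 : ℝ) : ℂ) := by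
    rw [← Complex.cpow_add _ _ (by exact_mod_cast ha.ne')]
    congr 1; push_cast; ring
  rw [h5]
  ring

theorem sph_mul_lift {k : SL2 F} (hk : k ∈ D.nearOne) (g : Mp F) :
    D.sph s (g * lift k) = D.sph s g := by
  rw [sph, sph, D.coeff_mul_lift hk, mp_mul_mat, lift_mat, D.height_mul _ hk.1]

theorem sph_mem_indRep : D.sph s ∈ D.indRep s :=
  ⟨D.isGenuine_sph s, D.isEquivariant_sph s, D.nearOne, D.nearOne_mem_nhds,
    fun _ hk g => D.sph_mul_lift s hk g⟩

theorem isGenuine_rho {φ f : Mp F → ℂ} (hf : IsGenuine f) : IsGenuine (D.rho φ f) := by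
  intro g ζ
  rw [rho, rho, ← integral_const_mul]
  congr 1
  funext h
  rw [D.mp_mul_assoc, hf]; ring

theorem isEquivariant_rho {φ f : Mp F → ℂ} (hf : D.IsEquivariant s f) :
    D.IsEquivariant s (D.rho φ f) := by
  intro b a g
  rw [rho, rho, ← integral_const_mul]
  congr 1
  funext h
  rw [D.mp_mul_assoc, hf]; ring

/-- On the induced representation `ρ(e^K)` has rank one. -/
theorem rho_eK {f : Mp F → ℂ} (hf : f ∈ D.indRep s) :
    D.rho D.eK f = (D.q ^ D.e * D.pairing f (D.coeff 0)) • D.sph s := by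
  obtain ⟨h1, h2, U, hU, h3⟩ := hf
  have h4 := (D.indRep s).smul_mem (D.q ^ D.e * D.pairing f (D.coeff 0)) (D.sph_mem_indRep s)
  refine eq_of_eqOn_Lam (D.isGenuine_rho h1) (D.isEquivariant_rho s h2) h4.1 h4.2.1
    fun k hk => ?_
  rw [D.rho_eK_lift h1 (fun b g => IsEquivariant.uSharp_mul h2 b g) hU h3 hk, Pi.smul_apply,
    smul_eq_mul, D.sph_lift s hk]

theorem q_ne_zero : D.q ≠ 0 := by
  have := D.one_lt_q
  rw [q]; exact_mod_cast (by linarith : (0 : ℝ) < resCard F).ne'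

/-- The eigenvalue is `q^e |2| = 1`. -/
theorem rho_eK_sph : D.rho D.eK (D.sph s) = D.sph s := by
  have h1 : D.pairing (D.sph s) (D.coeff 0) = D.pairing (D.coeff 0) (D.coeff 0) :=
    setIntegral_congr_fun D.measurableSet_Lam fun h hh => by simp only [D.sph_lift s hh]
  rw [D.rho_eK s (D.sph_mem_indRep s), h1, D.pairing_coeff_zero, D.nabs_two]
  have h2 := D.q_ne_zero
  have h3 : D.q ^ D.e * (((resCard F : ℝ) ^ (-(D.e : ℤ)) : ℝ) : ℂ) = 1 := by
    push_cast
    rw [zpow_neg, zpow_natCast]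
    exact mul_inv_cancel₀ (pow_ne_zero _ h2)
  rw [h3, one_smul]

theorem rho_smul (φ : Mp F → ℂ) (z : ℂ) (f : Mp F → ℂ) :
    D.rho φ (z • f) = z • D.rho φ f := by
  funext g
  rw [Pi.smul_apply, smul_eq_mul, rho, rho, ← integral_const_mul]
  congr 1
  funext h
  rw [Pi.smul_apply, smul_eq_mul]; ring

theorem mem_fixedBy_eK_iff {f : Mp F → ℂ} : f ∈ D.fixedBy s D.eK ↔ ∃ z : ℂ, z • D.sph s = f := by
  constructor
  · rintro ⟨h1, h2⟩
    rw [D.rho_eK s h1] at h2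
    exact ⟨_, h2⟩
  · rintro ⟨z, rfl⟩
    exact ⟨(D.indRep s).smul_mem z (D.sph_mem_indRep s), by rw [rho_smul, rho_eK_sph]⟩

/-! ### Conjugation by the Weyl element -/

/-- Conjugation by `w_{2δ}`, an involution of `SL₂(F)`. -/
def conjWeyl : SL2 F ≃ₜ* SL2 F where
  toMulEquiv := MulAut.conj (weylMat D.twoδ)
  continuous_toFun := by
    change Continuous fun h => weylMat D.twoδ * h * (weylMat D.twoδ)⁻¹
    fun_prop
  continuous_invFun := by
    change Continuous fun h => (weylMat D.twoδ)⁻¹ * h * weylMat D.twoδ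
    fun_prop

/-- The square of the Weyl element is `-1`, which is central. -/
theorem weylMat_conj_eq (a : Fˣ) (h : SL2 F) :
    (weylMat a)⁻¹ * h * weylMat a = weylMat a * h * (weylMat a)⁻¹ := by
  apply SL2_ext <;> rw [mat_mul_apply, mat_mul_apply] <;>
    simp only [mat_mul_apply, inv_apply_00, inv_apply_01, inv_apply_10, inv_apply_11] <;>
    simp [weylMat]

theorem integral_conjWeyl (Ψ : SL2 F → ℂ) :
    ∫ h, Ψ (weylMat D.twoδ * h * (weylMat D.twoδ)⁻¹) ∂D.dG = ∫ h, Ψ h ∂D.dG := by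
  have : D.dG.Regular := by unfold dG; infer_instance
  have h1 : D.conjWeyl.symm = D.conjWeyl := by
    ext1 h
    exact weylMat_conj_eq _ h
  -- the module of an involution squares to `1`
  have h2 : mulEquivHaarChar D.conjWeyl = 1 := by
    have h3 := mulEquivHaarChar_symm (φ := D.conjWeyl)
    have h4 := mulEquivHaarChar_pos D.conjWeyl
    rw [h1, ← mul_eq_one_iff_eq_inv₀ h4.ne', ← sq] at h3
    exact (pow_eq_one_iff_of_nonneg zero_le two_ne_zero).1 h3
  have h3 := mulEquivHaarChar_smul_map D.dG D.conjWeyl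
  rw [h2, one_smul] at h3
  have h4 : MeasurePreserving D.conjWeyl D.dG D.dG :=
    ⟨D.conjWeyl.continuous.measurable, h3⟩
  exact h4.integral_comp D.conjWeyl.toHomeomorph.measurableEmbedding Ψ

theorem weil_wEl_twoδ : D.weil (wEl D.twoδ) D.φ₀ =
    fun t => conj (D.weilConst (2 * D.δ)) * D.φ₀ t := by
  have := charZero_of_padic p F
  have hδ := D.δ_ne_zero
  funext t
  rw [weil_wEl, opW_apply, fourier_φ₀, show (D.twoδ : F) = 2 * D.δ from rfl,
    show 2 * (2 * D.δ)⁻¹ = D.δ⁻¹ by field_simp,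
    show D.δ * -(D.δ⁻¹ * t) = -t by field_simp, norm_neg, φ₀, sqrtAbs_inv, sqrtδ_eq]
  have h1 := D.sqrtAbs_ne_zero hδ
  split_ifs
  · field_simp
  · simp

theorem weil_wEl_twoδ_inv : D.weil (wEl D.twoδ)⁻¹ D.φ₀ =
    fun t => D.weilConst (2 * D.δ) * D.φ₀ t := by
  have h1 := D.weil_mul (wEl D.twoδ)⁻¹ (wEl D.twoδ) D.isSchwartz_φ₀
  rw [D.mp_inv_mul, weil_one, weil_wEl_twoδ, weil_const_mul] at h1
  have h2 := D.weilConst_mul_conj (two_mul_ne_zero' p D.δ_ne_zero)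
  funext t
  rw [congrFun h1 t]
  linear_combination (-D.weil (wEl D.twoδ)⁻¹ D.φ₀ t) * h2

/-- Near `1`, conjugation by an element for which `φ₀` is an eigenvector commutes with the
lift. -/
theorem inv_mul_lift_mul {y : Mp F} {z : ℂ} (hy : D.weil y D.φ₀ = fun t => z * D.φ₀ t)
    {k : SL2 F} (hk : k ∈ D.nearOne) (hk' : y.mat⁻¹ * k * y.mat ∈ D.nearOne) :
    y⁻¹ * lift k * y = lift (y.mat⁻¹ * k * y.mat) := by
  have h := D.isSchwartz_φ₀
  refine D.mp_eq_of_weil_eq rfl h D.φ₀_ne_zero ?_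
  rw [D.weil_lift_φ₀_of_mem_nearOne hk', D.mp_mul_assoc, D.weil_mul _ _ h, D.weil_mul _ _ h, hy,
    weil_const_mul, D.weil_lift_φ₀_of_mem_nearOne hk, ← hy, ← D.weil_mul _ _ h, D.mp_inv_mul,
    weil_one]

/-- Right translation by an element `y` for which `φ₀` is an eigenvector preserves smoothness in the
sense of invariance under lifts of matrices near `1`. -/
theorem mul_right_mem_indRep {f : Mp F → ℂ} (hf : f ∈ D.indRep s) {y : Mp F} {z : ℂ}
    (hy : D.weil y D.φ₀ = fun t => z * D.φ₀ t) : (fun x => f (x * y)) ∈ D.indRep s := by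
  obtain ⟨h1, h2, U, hU, h3⟩ := hf
  have hc : Continuous fun k => y.mat⁻¹ * k * y.mat := by fun_prop
  have h4 : (fun k => y.mat⁻¹ * k * y.mat) ⁻¹' (U ∩ D.nearOne) ∈ 𝓝 (1 : SL2 F) := by
    apply hc.continuousAt
    simpa using Filter.inter_mem hU D.nearOne_mem_nhds
  refine ⟨IsGenuine.mul_right D h1 y, IsEquivariant.mul_right h2 y, _,
    Filter.inter_mem D.nearOne_mem_nhds h4, fun k hk g => ?_⟩
  have h5 := D.inv_mul_lift_mul hy hk.1 hk.2.2
  have h6 : g * lift k * y = g * y * (y⁻¹ * lift k * y) := by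
    rw [D.mp_mul_assoc, D.mp_mul_assoc, D.mp_mul_assoc, D.mp_mul_inv_cancel_left]
  change f (g * lift k * y) = f (g * y)
  rw [h6, h5, h3 _ hk.2.1]

/-- The operator `ρ(E^K)` is conjugate to `ρ(e^K)` by the right translation by `w_{2δ}`. -/
theorem rho_EK {f : Mp F → ℂ} (hf : IsGenuine f) (g : Mp F) :
    D.rho D.EK f g = D.rho D.eK (fun x => f (x * (wEl D.twoδ)⁻¹)) (g * wEl D.twoδ) := by
  rw [rho, rho, ← D.integral_conjWeyl]
  congr 1
  funext h
  set w := wEl D.twoδ with hw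
  have h1 : IsGenuine D.EK :=
    (D.isGenuine_eK.mul_right D w).comp_mul_left w⁻¹
  have h2 := h1.mul_eq (hf.comp_mul_left g) (y := w * lift h * w⁻¹)
    (x := lift (weylMat D.twoδ * h * (weylMat D.twoδ)⁻¹)) rfl
  rw [h2, EK, ← hw, D.mp_mul_assoc w, D.mp_inv_mul_cancel_left, D.mp_inv_mul_cancel_right,
    D.mp_mul_assoc g w, D.mp_mul_assoc g, D.mp_mul_assoc w]

theorem mem_fixedBy_EK_iff {f : Mp F → ℂ} :
    f ∈ D.fixedBy s D.EK ↔ ∃ z : ℂ, (z • fun g => D.sph s (g * wEl D.twoδ)) = f := by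
  have h0 : f ∈ D.fixedBy s D.EK ↔ (fun x => f (x * (wEl D.twoδ)⁻¹)) ∈ D.fixedBy s D.eK := by
    constructor
    · rintro ⟨h1, h2⟩
      refine ⟨D.mul_right_mem_indRep s h1 D.weil_wEl_twoδ_inv, ?_⟩
      funext x
      have h3 := D.rho_EK h1.1 (x * (wEl D.twoδ)⁻¹)
      rw [D.mp_inv_mul_cancel_right, h2] at h3
      exact h3.symm
    · rintro ⟨h1, h2⟩
      have h3 := D.mul_right_mem_indRep s h1 D.weil_wEl_twoδ
      simp only [D.mp_mul_inv_cancel_right] at h3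
      refine ⟨h3, ?_⟩
      funext x
      rw [D.rho_EK h3.1, h2]
      change f (x * wEl D.twoδ * (wEl D.twoδ)⁻¹) = f x
      rw [D.mp_mul_inv_cancel_right]
  rw [h0, mem_fixedBy_eK_iff]
  refine exists_congr fun z => ⟨fun h => ?_, fun h => ?_⟩
  · funext x
    have := congrFun h (x * wEl D.twoδ)
    rw [D.mp_mul_inv_cancel_right] at this
    exact this
  · funext x
    rw [← h]
    simp only [Pi.smul_apply, D.mp_inv_mul_cancel_right]

/-! ### The functions `f_r` -/

/-- The constant `q^{c_ψ s - e/2} α_ψ(1) q^e` relating the restriction of `f_r` to the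
coefficient `g ↦ (ω_ψ(g) φ₀)(0)`. -/
def frConst : ℂ :=
  D.q ^ ((D.cψ : ℂ) * s - (D.e : ℂ) / 2) * D.weilConst 1 * D.q ^ D.e

theorem frConst_ne_zero : D.frConst s ≠ 0 := by
  have h1 := D.q_ne_zero
  refine mul_ne_zero (mul_ne_zero ?_ (D.weilConst_ne_zero one_ne_zero)) (pow_ne_zero _ h1)
  rw [Complex.cpow_def_of_ne_zero h1]
  exact Complex.exp_ne_zero _

open Classical in
theorem exists_fr {r : ℕ} (hr : r ≤ D.e) : ∃ f ∈ D.indRep s, ∀ g : Mp F, g.mat ∈ D.Lam → f g =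
    if g.mat ∈ D.X r then
      D.q ^ ((D.cψ : ℂ) * s - (D.e : ℂ) / 2) * D.weilConst 1 * conj (D.eK g) else 0 := by
  refine ⟨fun g => if D.depth g.mat = (resCard F : ℝ) ^ (-(2 * r : ℤ)) then
    D.frConst s * D.sph s g else 0, ⟨fun g ζ => ?_, fun b a g => ?_, D.nearOne,
      D.nearOne_mem_nhds, fun k hk g => ?_⟩, fun g hg => ?_⟩
  · have h1 : ((⟨1, ζ⟩ : Mp F) * g).mat = g.mat := one_mul _
    simp only [h1, D.isGenuine_sph s g ζ, mul_ite, mul_zero]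
    congr 1; ring
  · have h1 : D.depth (uSharp b * mDiag a * g).mat = D.depth g.mat := D.depth_upper_mul b a g.mat
    simp only [h1, D.isEquivariant_sph s b a g, mul_ite, mul_zero]
    congr 1; ring
  · have h1 : D.depth (g * lift k).mat = D.depth g.mat := D.depth_mul g.mat hk
    simp only [h1, D.sph_mul_lift s hk g]
  · simp only [D.mem_X_iff hg hr]
    congr 1
    have h1 : D.sph s g = D.coeff 0 g := by
      rw [sph, D.height_of_mem hg, Complex.ofReal_one, Complex.one_cpow, one_mul]
    have h2 : conj (D.q ^ D.e) = D.q ^ D.e := by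
      rw [map_pow, q, map_natCast]
    rw [h1, D.eK_eq hg, map_mul, Complex.conj_conj, h2, frConst]
    ring

open Classical in
theorem fr_mem_and_eq {r : ℕ} (hr : r ≤ D.e) :
    D.fr s r ∈ D.indRep s ∧ ∀ k ∈ D.Lam, D.fr s r (lift k) =
      if D.depth k = (resCard F : ℝ) ^ (-(2 * r : ℤ)) then
        D.frConst s * D.coeff 0 (lift k) else 0 := by
  have h := Classical.epsilon_spec (D.exists_fr s hr)
  refine ⟨h.1, fun k hk => ?_⟩
  have h2 : conj (D.q ^ D.e) = D.q ^ D.e := by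
    rw [map_pow, q, map_natCast]
  have h3 := h.2 (lift k) hk
  rw [lift_mat] at h3
  refine h3.trans ?_
  simp only [D.mem_X_iff hk hr]
  congr 1
  rw [D.eK_eq (x := lift k) hk, map_mul, Complex.conj_conj, h2, frConst]
  ring

/-- A combination of the functions `f_r`, restricted to the inverse image of `Λ`. -/
theorem sum_fr_lift (c : ℕ → ℂ) {k : SL2 F} (hk : k ∈ D.Lam) {z : ℂ}
    (hz : ∀ r ≤ D.e, D.depth k = (resCard F : ℝ) ^ (-(2 * r : ℤ)) → c r = z) :
    (∑ r ∈ Finset.range (D.e + 1), c r • D.fr s r) (lift k) =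
      z * (D.frConst s * D.coeff 0 (lift k)) := by
  classical
  rw [Finset.sum_apply]
  have h1 : ∀ r ∈ Finset.range (D.e + 1), (c r • D.fr s r) (lift k) =
      if D.depth k = (resCard F : ℝ) ^ (-(2 * r : ℤ)) then
        z * (D.frConst s * D.coeff 0 (lift k)) else 0 := by
    intro r hr
    have hr' : r ≤ D.e := Nat.lt_succ_iff.1 (Finset.mem_range.1 hr)
    rw [Pi.smul_apply, smul_eq_mul, (D.fr_mem_and_eq s hr').2 k hk]
    split_ifs with h
    · rw [hz r hr' h]
    · rw [mul_zero]
  rw [Finset.sum_congr rfl h1]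
  by_cases h2 : ∃ r ≤ D.e, D.depth k = (resCard F : ℝ) ^ (-(2 * r : ℤ))
  · obtain ⟨r, hr, h3⟩ := h2
    rw [Finset.sum_eq_single r, if_pos h3]
    · intro r' _ hne
      refine if_neg fun h4 => hne ?_
      have := D.zpow_q_injective (h3.symm.trans h4)
      omega
    · intro h4
      exact absurd (Finset.mem_range.2 (Nat.lt_succ_iff.2 hr)) h4
  · push Not at h2
    rw [D.coeff_zero_eq_zero_of_depth hk h2, mul_zero, mul_zero]
    exact Finset.sum_eq_zero fun r _ => ite_self 0

theorem sum_fr_mem (c : ℕ → ℂ) :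
    (∑ r ∈ Finset.range (D.e + 1), c r • D.fr s r) ∈ D.indRep s :=
  (D.indRep s).sum_mem fun _ hr => (D.indRep s).smul_mem _
    (D.fr_mem_and_eq s (Nat.lt_succ_iff.1 (Finset.mem_range.1 hr))).1

/-- Since the coefficient at `0` vanishes off the sets `𝒳_r`, the sum of all `f_r` is a multiple of
`sph`. -/
theorem fZero_eq : D.fZero s = D.frConst s • D.sph s := by
  have h0 : D.fZero s = ∑ r ∈ Finset.range (D.e + 1), (1 : ℂ) • D.fr s r := by
    simp only [one_smul]; rfl
  have h1 := D.sum_fr_mem s fun _ => 1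
  have h2 := (D.indRep s).smul_mem (D.frConst s) (D.sph_mem_indRep s)
  rw [h0]
  refine eq_of_eqOn_Lam h1.1 h1.2.1 h2.1 h2.2.1 fun k hk => ?_
  rw [D.sum_fr_lift s (fun _ => 1) hk (z := 1) fun _ _ _ => rfl, one_mul, Pi.smul_apply,
    smul_eq_mul, D.sph_lift s hk]

/-- On `Λ` the height of the translate by `w_{2δ}` is a function of the depth alone. This produces
the coefficients `q^{2sr - e + r}` of `f_K^+`. -/
theorem height_mul_weylMat {k : SL2 F} (hk : k ∈ D.Lam) :
    D.height (k * weylMat D.twoδ) = nabs p (2 : F) / D.depth k := by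
  have := charZero_of_padic p F
  have h2 : (0 : ℝ) < ‖(2 : F)‖ := norm_pos_iff.2 two_ne_zero
  have h2' := D.norm_two_le_one
  have hδ := D.norm_δ_pos
  have h4 : ‖(4 : F)‖ = ‖(2 : F)‖ * ‖(2 : F)‖ := by rw [← norm_mul]; norm_num
  have e1 : (k * weylMat D.twoδ) 1 0 / D.δ = 2 * k 1 1 := by
    have := D.δ_ne_zero
    rw [mat_mul_apply]
    simp [weylMat, twoδ]
    field_simp
  have e2 : (k * weylMat D.twoδ) 1 1 = -(k 1 0 / D.δ / 2) := by
    have := D.δ_ne_zero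
    rw [mat_mul_apply]
    simp [weylMat, twoδ]
    field_simp
  have h5 : D.rowNorm (k * weylMat D.twoδ) = max ‖k 1 0 / D.δ‖ ‖(4 : F)‖ / ‖(2 : F)‖ := by
    rw [rowNorm, e1, e2, norm_neg, norm_div _ (2 : F), norm_mul, h4]
    by_cases hc : ‖k 1 0‖ = ‖D.δ‖
    · have h6 : ‖k 1 0 / D.δ‖ = 1 := by rw [norm_div, hc, div_self hδ.ne']
      have h7 : 1 ≤ 1 / ‖(2 : F)‖ := by rwa [one_le_div h2]
      have h8 : ‖(2 : F)‖ * ‖k 1 1‖ ≤ 1 := mul_le_one₀ h2' (norm_nonneg _) hk.2.1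
      rw [h6, max_eq_right (h8.trans h7), max_eq_left (mul_le_one₀ h2' h2.le h2')]
    · rw [D.norm_11_eq_one hk (lt_of_le_of_ne hk.2.2.2 hc), mul_one,
        ← max_div_div_right h2.le, mul_div_cancel_right₀ _ h2.ne', max_comm]
  rw [height, h5, D.depth_of_mem hk, div_pow, inv_div]; rfl

theorem sph_mul_wEl {k : SL2 F} (hk : k ∈ D.Lam) : D.sph s (lift k * wEl D.twoδ) =
    ((nabs p (2 : F) / D.depth k : ℝ) : ℂ) ^ (s + 1 / 2) *
      (conj (D.weilConst (2 * D.δ)) * D.coeff 0 (lift k)) := by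
  have h1 : (lift k * wEl D.twoδ).mat = k * weylMat D.twoδ := rfl
  rw [sph, h1, D.height_mul_weylMat hk, coeff, D.weil_mul _ _ D.isSchwartz_φ₀, weil_wEl_twoδ,
    weil_const_mul, coeff]

theorem fPlus_eq : ∃ z : ℂ, z ≠ 0 ∧ D.fPlus s = z • fun g => D.sph s (g * wEl D.twoδ) := by
  have hq := D.q_ne_zero
  have hqr : (0 : ℝ) < resCard F := by linarith [D.one_lt_q]
  have hα := D.weilConst_mul_conj (two_mul_ne_zero' p D.δ_ne_zero)
  have hα0 := D.weilConst_ne_zero (two_mul_ne_zero' p D.δ_ne_zero)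
  have hexp : D.q ^ ((D.e : ℂ) * s - (D.e : ℂ) / 2) ≠ 0 := by
    rw [Complex.cpow_def_of_ne_zero hq]; exact Complex.exp_ne_zero _
  refine ⟨D.frConst s * D.weilConst (2 * D.δ) * D.q ^ ((D.e : ℂ) * s - (D.e : ℂ) / 2),
    mul_ne_zero (mul_ne_zero (D.frConst_ne_zero s) hα0) hexp, ?_⟩
  have h1 := D.sum_fr_mem s fun r => D.q ^ (2 * s * (r : ℂ) - (D.e : ℂ) + (r : ℂ))
  have h2 := (D.indRep s).smul_mem
    (D.frConst s * D.weilConst (2 * D.δ) * D.q ^ ((D.e : ℂ) * s - (D.e : ℂ) / 2))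
    (D.mul_right_mem_indRep s (D.sph_mem_indRep s) D.weil_wEl_twoδ)
  refine eq_of_eqOn_Lam h1.1 h1.2.1 h2.1 h2.2.1 fun k hk => ?_
  refine (D.sum_fr_lift s (fun r => D.q ^ (2 * s * (r : ℂ) - (D.e : ℂ) + (r : ℂ))) hk
    (z := D.q ^ ((D.e : ℂ) * s - (D.e : ℂ) / 2) *
      ((nabs p (2 : F) / D.depth k : ℝ) : ℂ) ^ (s + 1 / 2)) ?_).trans ?_
  · intro r hr h3
    rw [h3, D.nabs_two, ← zpow_sub₀ hqr.ne', zpow_cpow hqr, Complex.ofReal_natCast]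
    change _ = D.q ^ _ * D.q ^ _
    rw [← Complex.cpow_add _ _ hq]
    congr 1
    push_cast
    ring
  · rw [Pi.smul_apply, smul_eq_mul, D.sph_mul_wEl s hk]
    linear_combination (-(D.q ^ ((D.e : ℂ) * s - (D.e : ℂ) / 2) *
      ((nabs p (2 : F) / D.depth k : ℝ) : ℂ) ^ (s + 1 / 2) * D.frConst s *
      D.coeff 0 (lift k))) * hα

theorem sph_one : D.sph s (lift 1) = 1 := by
  rw [D.sph_lift s D.one_mem_Lam, coeff, weil_one, φ₀_zero]

end LocalDatum

end MetaplecticSL2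

theorem theorem4p9 (p : ℕ) [Fact p.Prime] {F : Type*} [NormedField F] [NormedAlgebra ℚ_[p] F]
    [FiniteDimensional ℚ_[p] F] [IsUltrametricDist F] [MeasurableSpace F] [BorelSpace F]
    (D : MetaplecticSL2.LocalDatum p F) (s : ℂ)
    (hs : D.q ^ (-2 * s) ≠ D.q ∧ D.q ^ (-2 * s) ≠ D.q⁻¹) :
    D.fixedBy s D.eK = (Submodule.span ℂ {D.fZero s} : Set (MetaplecticSL2.Mp F → ℂ)) ∧
    D.fixedBy s D.EK = (Submodule.span ℂ {D.fPlus s} : Set (MetaplecticSL2.Mp F → ℂ)) ∧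
    D.fZero s ≠ 0 ∧ D.fPlus s ≠ 0 := by
  have := FiniteDimensional.proper ℚ_[p] F
  obtain ⟨z, hz, hfPlus⟩ := D.fPlus_eq s
  refine ⟨?_, ?_, fun h => ?_, fun h => ?_⟩
  · ext f
    rw [D.mem_fixedBy_eK_iff, D.fZero_eq,
      Submodule.span_singleton_smul_eq (IsUnit.mk0 _ (D.frConst_ne_zero s)), SetLike.mem_coe,
      Submodule.mem_span_singleton]
  · ext f
    rw [D.mem_fixedBy_EK_iff, hfPlus, Submodule.span_singleton_smul_eq (IsUnit.mk0 _ hz),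
      SetLike.mem_coe, Submodule.mem_span_singleton]
  · have h1 := congrFun h (MetaplecticSL2.lift 1)
    rw [D.fZero_eq, Pi.smul_apply, D.sph_one, smul_eq_mul, mul_one] at h1
    exact D.frConst_ne_zero s h1
  · have h1 := congrFun h (MetaplecticSL2.wEl D.twoδ)⁻¹
    rw [hfPlus, Pi.smul_apply, D.mp_inv_mul, D.sph_one, smul_eq_mul, mul_one] at h1
    exact hz h1

end
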